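/- **Setting.** Let $y_t=g(\mathbf Y_{t-1},\theta_0)+\sigma(\mathbf Y_{t-1},\theta_0)\eta_t$ a.s. for every $t\in\mathbb Z$, where $\mathbf Y_{t-1}=(y_{t-1},y_{t-2},\dots)\in\mathbb R^\infty$, the functions $g:\mathbb R^\infty\times\mathbb R^d\to\mathbb R$ and $\sigma:\mathbb R^\infty\times\mathbb R^d\to(0,\infty)$ are measurable, and $\eta_t$ is independent of $\{y_s:s<t\}$. Put $F(x)=1/(1+e^{-x})$, $f(x)=e^{-x}/(1+e^{-x})^2$, $h(x)=x\{2F(x)-1\}$ and $\mathcal F_0=\sigma(y_j:j\le 0)$. Given an initial value $\widetilde{\mathbf Y}_0$ (an element of $\mathbb R^\infty$, constant or random), let $\widetilde{\mathbf Y}_{t-1}=(y_{t-1},\dots,y_1,\widetilde{\mathbf Y}_0)$ for $t\ge1$. Write $g_t(\theta)=g(\mathbf Y_{t-1},\theta)$, $\sigma_t(\theta)=\sigma(\mathbf Y_{t-1},\theta)$, $$\ell_t(\theta)=-\log\sigma_t(\theta)+\log f\Big(\frac{y_t-g_t(\theta)}{\sigma_t(\theta)}\Big),\qquad \mathbf s_t(\theta)=\frac{\partial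 \ell_t(\theta)}{\partial\theta},\qquad \mathbf H_t(\theta)=-\frac{\partial^2\ell_t(\theta)}{\partial\theta\,\partial\theta^{T}},$$ and let $\widetilde g_t,\widetilde\sigma_t,\widetilde\ell_t,\widetilde{\mathbf s}_t,\widetilde{\mathbf H}_t$ ($t\ge 1$) be the same quantities with $\widetilde{\mathbf Y}_{t-1}$ in place of $\mathbf Y_{t-1}$. Let $\widehat\theta_n$ be a (measurable) maximizer over $\Theta\subset\mathbb R^d$ of $\sum_{t=1}^n\widetilde\ell_t(\theta)$. Write $\|\cdot\|$ for the Euclidean norm of vectors and the spectral norm of matrices. **Assumptions.** 1. $\Theta$ is compact. 2. $\{\eta_t\}$ is an i.i.d. sequence of symmetric random variables with $\mathbb E\,h(\eta_t)=1$. 3. $\{y_t\}$ is strictly stationary and ergodic. 4. There is a constant $\underline\sigma>0$ with $\sigma_t(\theta)>\underline\sigma$ a.s. for every $\theta\in\Theta$. 5. $g(\mathbf Y,\cdot)$ and $\sigma(\mathbf Y,\cdot)$ are continuous on $\Theta$ for every $\mathbf Y$. 6. For $\theta\in\Theta$: $(g_t(\theta),\sigma_t(\theta))=(g_t(\theta_0),\sigma_t(\theta_0))$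 a.s. if and only if $\theta=\theta_0$. 7. $\mathbb E\sup_{\theta\in\Theta}|g_t(\theta)|^\iota+\mathbb E\,\sigma_t(\theta_0)^\iota<\infty$ for some $\iota>0$. 8. There are a nonnegative $\mathcal F_0$-measurable random variable $C_1$, not depending on $\theta$, and a constant $\rho_1\in(0,1)$ with $\sup_{\theta\in\Theta}\{|\widetilde g_t(\theta)-g_t(\theta)|+|\widetilde\sigma_t^2(\theta)-\sigma_t^2(\theta)|\}\le C_1\rho_1^t$ a.s. for all $t\ge1$. 9. $\theta_0$ is an interior point of $\Theta$. 10. $0<\mathbb E\{h(\eta_t)-1\}^2<\infty$. 11. $g(\mathbf Y,\cdot)$ and $\sigma(\mathbf Y,\cdot)$ are twice continuously differentiable on the interior of $\Theta$ for every $\mathbf Y$. 12. $\mathbb E\|\sigma_t(\theta_0)^{-1}\,\partial g_t(\theta_0)/\partial\theta\|<\infty$ and $\mathbb E\|\sigma_t(\theta_0)^{-2}\,\partial\sigma_t^2(\theta_0)/\partial\theta\|<\infty$. 13. Either there is no nonzero $x\in\mathbb R^d$ with $x^T\partial\sigma_t^2(\theta_0)/\partial\theta=0$ a.s., or there is no nonzero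 $x\in\mathbb R^d$ with $x^T\partial g_t(\theta_0)/\partial\theta=0$ a.s. 14. $\mathbb E\sup_{\|\theta-\theta_0\|\le\kappa}\|\mathbf H_t(\theta)\|<\infty$ for some $\kappa>0$. 15. There are a nonnegative random variable $C_2$, not depending on $\theta$, and a constant $\rho_2\in(0,1)$ such that, for all $t\ge1$, a.s. $\|\widetilde{\mathbf s}_t(\theta)-\mathbf s_t(\theta)\|+\|\widetilde{\mathbf H}_t(\theta)-\mathbf H_t(\theta)\|\le C_2\rho_2^t$ for all $\theta$ in the interior of $\Theta$. **Theorem.** Under Assumptions 1--15, $\mathbf A_0=\mathbb E\{\mathbf H_t(\theta_0)\}$ and $\mathbf B_0=\mathbb E\{\mathbf s_t(\theta_0)\mathbf s_t(\theta_0)^T\}$ (for any $t\in\mathbb Z$) are well defined and finite, and $$\widehat{\mathbf A}_n=\frac1n\sum_{t=1}^n\widetilde{\mathbf H}_t(\widehat\theta_n)=\mathbf A_0+o_p(1),\qquad \widehat{\mathbf B}_n=\frac1n\sum_{t=1}^n\widetilde{\mathbf s}_t(\widehat\theta_n)\widetilde{\mathbf s}_t(\widehat\theta_n)^T=\mathbf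 B_0+o_p(1)\qquad(n\to\infty).$$ -/

import Mathlib

open MeasureTheory ProbabilityTheory Filter
open scoped Topology ENNReal Matrix.Norms.L2Operator

noncomputable section

namespace LQMLE

/-- The density of the standard logistic distribution. -/
def logisticPDF (x : ℝ) : ℝ := Real.exp (-x) / (1 + Real.exp (-x)) ^ 2

/-- `h x = x (2 F x - 1)`, where `F = Real.sigmoid` is the standard logistic distribution
function. -/
def h (x : ℝ) : ℝ := x * (2 * Real.sigmoid x - 1)

variable {Ω : Type*} {d : ℕ}

/-- The infinite past `Y_{t-1} = (y_{t-1}, y_{t-2}, …)`. -/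
def past (y : ℤ → Ω → ℝ) (t : ℤ) (ω : Ω) : ℕ → ℝ := fun j => y (t - 1 - j) ω

/-- The observable past `(y_{t-1}, …, y_1, y0_0, y0_1, …)` for `t ≥ 1`, where the initial value
`y0` replaces the unobserved `(y_0, y_{-1}, …)`. -/
def obsPast (y : ℤ → Ω → ℝ) (y0 : Ω → ℕ → ℝ) (t : ℕ) (ω : Ω) : ℕ → ℝ := fun j =>
  if j + 1 < t then y ((t : ℤ) - 1 - j) ω else y0 ω (j + 1 - t)

/-- The sigma-algebra generated by `{y_j : j ≤ t}`. -/
abbrev pastSigma (y : ℤ → Ω → ℝ) (t : ℤ) : MeasurableSpace Ω :=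
  ⨆ j : {j : ℤ // j ≤ t}, MeasurableSpace.comap (y j) inferInstance

/-- The logistic quasi-log-likelihood of one observation `v` given the past `Y`, as a function of
the parameter `θ`. -/
def logLik (g σ : (ℕ → ℝ) → EuclideanSpace ℝ (Fin d) → ℝ) (Y : ℕ → ℝ) (v : ℝ)
    (θ : EuclideanSpace ℝ (Fin d)) : ℝ :=
  -Real.log (σ Y θ) + Real.log (logisticPDF ((v - g Y θ) / σ Y θ))

/-- The score: the gradient of the quasi-log-likelihood in `θ`. -/
def score (g σ : (ℕ → ℝ) → EuclideanSpace ℝ (Fin d) → ℝ) (Y : ℕ → ℝ) (v : ℝ)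
    (θ : EuclideanSpace ℝ (Fin d)) : EuclideanSpace ℝ (Fin d) :=
  gradient (logLik g σ Y v) θ

/-- Minus the Hessian matrix of the quasi-log-likelihood in `θ`. -/
def negHess (g σ : (ℕ → ℝ) → EuclideanSpace ℝ (Fin d) → ℝ) (Y : ℕ → ℝ) (v : ℝ)
    (θ : EuclideanSpace ℝ (Fin d)) : Matrix (Fin d) (Fin d) ℝ :=
  Matrix.of fun i j =>
    -(fderiv ℝ (fun θ' => fderiv ℝ (logLik g σ Y v) θ' (EuclideanSpace.single j 1)) θ
      (EuclideanSpace.single i 1))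

/-- The outer product `x xᵀ`. -/
def outer (x : EuclideanSpace ℝ (Fin d)) : Matrix (Fin d) (Fin d) ℝ :=
  Matrix.of fun i j => x i * x j

/-- The entrywise expectation of a random matrix. -/
def expMatrix [MeasurableSpace Ω] (P : Measure Ω) (M : Ω → Matrix (Fin d) (Fin d) ℝ) :
    Matrix (Fin d) (Fin d) ℝ :=
  Matrix.of fun i j => ∫ ω, M ω i j ∂P

/-- The conditional logistic quasi-log-likelihood of the observations `y_1, …, y_n`. -/
def quasiLogLik (g σ : (ℕ → ℝ) → EuclideanSpace ℝ (Fin d) → ℝ) (y : ℤ → Ω → ℝ)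
    (y0 : Ω → ℕ → ℝ) (n : ℕ) (ω : Ω) (θ : EuclideanSpace ℝ (Fin d)) : ℝ :=
  ∑ t ∈ Finset.Icc 1 n, logLik g σ (obsPast y y0 t ω) (y t ω) θ

/-- `n⁻¹ ∑ H̃_t(θ)` evaluated at the random parameter `θ = θhat ω`. -/
def hatA (g σ : (ℕ → ℝ) → EuclideanSpace ℝ (Fin d) → ℝ) (y : ℤ → Ω → ℝ)
    (y0 : Ω → ℕ → ℝ) (θhat : Ω → EuclideanSpace ℝ (Fin d)) (n : ℕ) (ω : Ω) :
    Matrix (Fin d) (Fin d) ℝ :=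
  (n : ℝ)⁻¹ • ∑ t ∈ Finset.Icc 1 n, negHess g σ (obsPast y y0 t ω) (y t ω) (θhat ω)

/-- `n⁻¹ ∑ s̃_t(θ) s̃_t(θ)ᵀ` evaluated at the random parameter `θ = θhat ω`. -/
def hatB (g σ : (ℕ → ℝ) → EuclideanSpace ℝ (Fin d) → ℝ) (y : ℤ → Ω → ℝ)
    (y0 : Ω → ℕ → ℝ) (θhat : Ω → EuclideanSpace ℝ (Fin d)) (n : ℕ) (ω : Ω) :
    Matrix (Fin d) (Fin d) ℝ :=
  (n : ℝ)⁻¹ • ∑ t ∈ Finset.Icc 1 n, outer (score g σ (obsPast y y0 t ω) (y t ω) (θhat ω))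

/-- `{y_t}` is strictly stationary and ergodic: the shift on the path space `ℤ → ℝ` preserves the
law of the process and is ergodic for it. -/
def StationaryErgodic [MeasurableSpace Ω] (P : Measure Ω) (y : ℤ → Ω → ℝ) : Prop :=
  Ergodic (fun (x : ℤ → ℝ) (t : ℤ) => x (t + 1)) (P.map fun ω t => y t ω)

end LQMLE

end

/-! Fix a direction `w` and let `a`, `b` be the derivatives of the scale and of the mean at `θ₀`
along `w`, divided by the scale. The score along `w` is `a (h(η) - 1) + b (2F(η) - 1)`. Both
functions of `η` are centred and `η` is independent of the past, so the scores are martingale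
differences. The quadratic form of minus the Hessian has conditional mean `c₁ a² + c₂ b²` given the
past, with `c₁, c₂ > 0`. Integrability of the Hessian therefore puts `a`, `b`, and with them the
score, in `L²`; the rank condition then makes `A₀` positive definite (`integrable_sq_normDir`,
`integral_bilin_hess_pos`).

Consistency of the estimator is Wald's argument. The log-likelihood difference between `θ` and `θ₀`
lies below a tangent expression with conditional mean zero, and touches it only where mean and scale
agree (`logLogistic_sub_tangent`). So the expected likelihood is strictly smaller at `θ ≠ θ₀`, this
persists for the supremum over a small neighbourhood, and compactness does the rest
(`tendsto_estimator`). The initial value is harmless because the residuals grow subexponentially.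
For the Hessian average it then suffices that the modulus of continuity of the Hessian at `θ₀` has
small mean (`tendsto_hatA`).

The outer products are harder, since the scores near `θ₀` are not dominated in `L²`. They are only
Lipschitz in `θ` with an integrable constant `Z_t`, so the average of `Z_t²` may diverge. Still,
`n⁻² ∑ Z_t²` tends to zero in probability (`tendsto_sqrt_inv_mul_avg_sq`). The first-order condition
and `A₀ > 0` bound the estimation error by the averaged score (`exists_rate`), which is of order
`n^(-1/2)` by orthogonality. The product `‖θhat - θ₀‖² · n⁻¹ ∑ Z_t²` is thus negligible, and
Cauchy-Schwarz concludes (`tendsto_hatB`).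

Only convergence in probability is needed, so the law of large numbers comes from the mean ergodic
theorem in `L²` followed by truncation. -/

noncomputable section

namespace LQMLE

section

/-! ### Convergence in probability as convergence along a filter. -/

section InProb

variable {Ω : Type*} [MeasurableSpace Ω] {P : Measure Ω}

/-- The filter of sequences of events whose (outer) probability tends to one. Convergence along
this filter to a constant is convergence in probability. -/
def inProb (P : Measure Ω) : Filter (ℕ × Ω) where
  sets := {S | Tendsto (fun n => P {ω | (n, ω) ∉ S}) atTop (𝓝 0)}
  univ_sets := by simp
  sets_of_superset := by
    intro S T hS hST
    exact tendsto_of_tendsto_of_tendsto_of_le_of_le tendsto_const_nhds hS (fun _ => zero_le)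
      (fun n => measure_mono fun ω hω h => hω (hST h))
  inter_sets := by
    intro S T hS hT
    have h := Tendsto.add hS hT
    rw [add_zero] at h
    refine tendsto_of_tendsto_of_tendsto_of_le_of_le tendsto_const_nhds h (fun _ => zero_le)
      (fun n => le_trans (measure_mono fun ω hω => ?_) (measure_union_le _ _))
    by_cases h1 : (n, ω) ∈ S
    · exact Or.inr fun h2 => hω ⟨h1, h2⟩
    · exact Or.inl h1

theorem eventually_inProb_iff {q : ℕ × Ω → Prop} :
    (∀ᶠ p in inProb P, q p) ↔ Tendsto (fun n => P {ω | ¬ q (n, ω)}) atTop (𝓝 0) := Iff.rfl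

theorem eventually_inProb_of_ae {q : ℕ → Ω → Prop} (hq : ∀ n, ∀ᵐ ω ∂P, q n ω) :
    ∀ᶠ p in inProb P, q p.1 p.2 := by
  rw [eventually_inProb_iff]
  have : ∀ n, P {ω | ¬ q n ω} = 0 := fun n => hq n
  simp [this]

theorem tendsto_fst_inProb : Tendsto Prod.fst (inProb P) atTop := by
  rw [tendsto_atTop]
  intro N
  rw [eventually_inProb_iff]
  refine tendsto_const_nhds.congr' ?_
  filter_upwards [eventually_ge_atTop N] with n hn
  simp [hn]

theorem tendstoInMeasure_const_iff {E : Type*} [PseudoEMetricSpace E] {f : ℕ → Ω → E} {c : E} :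
    TendstoInMeasure P f atTop (fun _ => c) ↔
      Tendsto (fun p : ℕ × Ω => f p.1 p.2) (inProb P) (𝓝 c) := by
  rw [Metric.nhds_basis_eball.tendsto_right_iff, TendstoInMeasure]
  simp only [eventually_inProb_iff, Metric.mem_eball, not_lt]

theorem tendsto_inProb_of_ae [IsFiniteMeasure P] {E : Type*} [PseudoEMetricSpace E]
    {f : ℕ → Ω → E} {c : E} (hf : ∀ n, AEStronglyMeasurable (f n) P)
    (h : ∀ᵐ ω ∂P, Tendsto (fun n => f n ω) atTop (𝓝 c)) :
    Tendsto (fun p : ℕ × Ω => f p.1 p.2) (inProb P) (𝓝 c) :=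
  tendstoInMeasure_const_iff.1 (tendstoInMeasure_of_tendsto_ae hf h)

/-- A sequence bounded in `L²` times a sequence tending to zero in probability tends to zero in
probability. -/
theorem tendsto_inProb_mul_of_lintegral_sq_le {X Q : ℕ → Ω → ℝ} (hX : ∀ n, AEMeasurable (X n) P)
    {C : ℝ≥0∞} (hC : C ≠ ∞) (hXC : ∀ᶠ n in atTop, ∫⁻ ω, ENNReal.ofReal (X n ω ^ 2) ∂P ≤ C)
    (hQ : Tendsto (fun p : ℕ × Ω => Q p.1 p.2) (inProb P) (𝓝 0)) :
    Tendsto (fun p : ℕ × Ω => X p.1 p.2 * Q p.1 p.2) (inProb P) (𝓝 0) := by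
  rw [Metric.tendsto_nhds]
  intro ε hε
  rw [eventually_inProb_iff, ENNReal.tendsto_nhds_zero]
  intro δ hδ
  -- Chebyshev's inequality bounds the probability of `|X n| ≥ K` by `C / K²`; off that event it is
  -- enough that `|Q n| < ε / K`.
  obtain ⟨K, hK0, hK⟩ : ∃ K : ℝ, 0 < K ∧ C / ENNReal.ofReal (K ^ 2) ≤ δ / 2 := by
    have h1 : Tendsto (fun K : ℝ => C / ENNReal.ofReal (K ^ 2)) atTop (𝓝 0) := by
      have h2 : Tendsto (fun K : ℝ => ENNReal.ofReal (K ^ 2)) atTop (𝓝 ∞) :=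
        ENNReal.tendsto_ofReal_atTop.comp (tendsto_pow_atTop two_ne_zero)
      have h3 := ENNReal.Tendsto.const_div (a := C) h2 (Or.inr hC)
      simpa using h3
    have hδ2 : (0 : ℝ≥0∞) < δ / 2 := ENNReal.half_pos hδ.ne'
    obtain ⟨K, hK1, hK2⟩ := ((ENNReal.tendsto_nhds_zero.1 h1 _ hδ2).and
      (eventually_gt_atTop (0 : ℝ))).exists
    exact ⟨K, hK2, hK1⟩
  have hQ' := eventually_inProb_iff.1 (Metric.tendsto_nhds.1 hQ (ε / K) (by positivity))
  have hδ2 : (0 : ℝ≥0∞) < δ / 2 := ENNReal.half_pos hδ.ne'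
  filter_upwards [ENNReal.tendsto_nhds_zero.1 hQ' _ hδ2, hXC] with n hn hn2
  have hsub : {ω | ¬ dist (X n ω * Q n ω) 0 < ε} ⊆
      {ω | ENNReal.ofReal (K ^ 2) ≤ ENNReal.ofReal (X n ω ^ 2)} ∪
        {ω | ¬ dist (Q n ω) 0 < ε / K} := by
    intro ω hω
    by_contra hcon
    simp only [Set.mem_union, Set.mem_ofPred_eq, not_or, not_not, Real.dist_eq, sub_zero] at hcon hω
    obtain ⟨h1, h2⟩ := hcon
    apply hω
    have h3 : |X n ω| < K := by
      by_contra h4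
      exact h1 (ENNReal.ofReal_le_ofReal (by
        rw [← sq_abs (X n ω)]; exact pow_le_pow_left₀ hK0.le (not_lt.1 h4) 2))
    rw [abs_mul]
    calc |X n ω| * |Q n ω| ≤ K * |Q n ω| := by gcongr
      _ < K * (ε / K) := by gcongr
      _ = ε := by field_simp
  calc P {ω | ¬ dist (X n ω * Q n ω) 0 < ε} ≤ _ := measure_mono hsub
    _ ≤ _ := measure_union_le _ _
    _ ≤ δ / 2 + δ / 2 := by
      refine add_le_add ?_ hn
      refine le_trans (meas_ge_le_lintegral_div (((hX n).pow_const 2).ennreal_ofReal)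
        (by simpa using hK0.ne') ENNReal.ofReal_ne_top) ?_
      exact le_trans (by gcongr) hK
    _ = δ := ENNReal.add_halves δ

end InProb

/-! ### Mean ergodic theorem and weak law along orbits. -/

section MeanErgodic

variable {X : Type*} [MeasurableSpace X] {μ : Measure X} [IsProbabilityMeasure μ] {T : X → X}

/-- The average of `φ` along the first `n` points of the orbit. -/
def orbitAvg (T : X → X) (φ : X → ℝ) (n : ℕ) (x : X) : ℝ :=
  (n : ℝ)⁻¹ * ∑ t ∈ Finset.range n, φ (T^[t] x)

theorem measurable_orbitAvg (hT : Measurable T) {φ : X → ℝ} (hφ : Measurable φ) (n : ℕ) :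
    Measurable (orbitAvg T φ n) :=
  (Finset.measurable_sum _ fun t _ => hφ.comp (hT.iterate t)).const_mul _

/-- The mean ergodic theorem for bounded functions: convergence in measure of averages. -/
theorem tendsto_orbitAvg_of_memLp_two (hT : Ergodic T μ) {φ : X → ℝ} (hφ : MemLp φ 2 μ)
    (hφm : Measurable φ) :
    TendstoInMeasure μ (orbitAvg T φ) atTop (fun _ => ∫ x, φ x ∂μ) := by
  have hmp := hT.toMeasurePreserving
  -- The Koopman operator is an isometry of `L²`, so von Neumann's theorem sends the averages to the
  -- projection on its fixed space, which ergodicity reduces to the constants.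
  let U : Lp ℝ 2 μ →ₗᵢ[ℝ] Lp ℝ 2 μ := Lp.compMeasurePreservingₗᵢ ℝ T hmp
  have hlim := (U.toContinuousLinearMap).tendsto_birkhoffAverage_orthogonalProjection
    U.norm_toContinuousLinearMap_le (hφ.toLp φ)
  set g := ((U.toContinuousLinearMap.eqLocus
    (1 : Lp ℝ 2 μ →L[ℝ] Lp ℝ 2 μ)).orthogonalProjectionOnto (hφ.toLp φ)) with hg
  have hgfix : U (g : Lp ℝ 2 μ) = g := g.2
  have hconst : ∃ c : ℝ, ((g : Lp ℝ 2 μ) : X → ℝ) =ᵐ[μ] fun _ => c := by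
    refine hT.ae_eq_const_of_ae_eq_comp_ae (Lp.aestronglyMeasurable _) ?_
    have h1 := Lp.coeFn_compMeasurePreserving (g : Lp ℝ 2 μ) hmp
    have h2 : Lp.compMeasurePreserving T hmp (g : Lp ℝ 2 μ) = g := hgfix
    rw [h2] at h1
    exact h1.symm
  obtain ⟨c, hc⟩ := hconst
  have hiter : ∀ t : ℕ, ((U.toContinuousLinearMap)^[t] (hφ.toLp φ)) =
      (hφ.comp_measurePreserving (hmp.iterate t)).toLp (φ ∘ T^[t]) := by
    intro t
    induction t with
    | zero => rfl
    | succ k ih =>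
      rw [Function.iterate_succ_apply', ih]
      change Lp.compMeasurePreserving T hmp _ = _
      rw [Lp.toLp_compMeasurePreserving]
      congr 1
  have hcoe : ∀ n, ((birkhoffAverage ℝ (U.toContinuousLinearMap) _root_.id n (hφ.toLp φ) :
      Lp ℝ 2 μ) : X → ℝ) =ᵐ[μ] orbitAvg T φ n := by
    intro n
    have hsum : ∀ n, ((∑ t ∈ Finset.range n, (U.toContinuousLinearMap)^[t] (hφ.toLp φ) :
        Lp ℝ 2 μ) : X → ℝ) =ᵐ[μ] fun x => ∑ t ∈ Finset.range n, φ (T^[t] x) := by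
      intro n
      induction n with
      | zero => simp only [Finset.range_zero, Finset.sum_empty]; exact Lp.coeFn_zero ℝ 2 μ
      | succ k ih =>
        rw [Finset.sum_range_succ]
        refine (Lp.coeFn_add _ _).trans ?_
        simp only [Finset.sum_range_succ]
        refine ih.add ?_
        rw [hiter k]
        exact MemLp.coeFn_toLp _
    unfold birkhoffAverage birkhoffSum
    refine (Lp.coeFn_smul _ _).trans ?_
    filter_upwards [hsum n] with x hx
    simp only [Pi.smul_apply, smul_eq_mul, orbitAvg, _root_.id]
    rw [hx]
  have hmeas : TendstoInMeasure μ (orbitAvg T φ) atTop (fun _ => c) :=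
    (tendstoInMeasure_of_tendsto_Lp hlim).congr hcoe hc
  -- Integration is the inner product with the constant `1`, hence continuous on `L²`, and every
  -- average with `n > 0` has the same integral as `φ`.
  have hcφ : c = ∫ x, φ x ∂μ := by
    have hint : ∀ n : ℕ, 0 < n →
        ∫ x, (birkhoffAverage ℝ (U.toContinuousLinearMap) _root_.id n (hφ.toLp φ) : Lp ℝ 2 μ) x ∂μ
          = ∫ x, φ x ∂μ := by
      intro n hn
      rw [integral_congr_ae (hcoe n)]
      unfold orbitAvg
      rw [integral_const_mul, integral_finsetSum]
      · have : ∀ t, ∫ x, φ (T^[t] x) ∂μ = ∫ x, φ x ∂μ := fun t => by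
          rw [← integral_map (hmp.iterate t).measurable.aemeasurable
            hφm.aestronglyMeasurable, (hmp.iterate t).map_eq]
        simp only [this, Finset.sum_const, Finset.card_range, nsmul_eq_mul]
        field_simp
      · intro t _
        exact ((hφ.comp_measurePreserving (hmp.iterate t)).integrable one_le_two)
    have hcont : Tendsto (fun n => ∫ x,
        (birkhoffAverage ℝ (U.toContinuousLinearMap) _root_.id n (hφ.toLp φ) : Lp ℝ 2 μ) x ∂μ)
        atTop (𝓝 (∫ x, (g : Lp ℝ 2 μ) x ∂μ)) := by
      let I : Lp ℝ 2 μ := (memLp_const (1 : ℝ)).toLp (fun _ : X => (1 : ℝ))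
      have hI : ∀ f : Lp ℝ 2 μ, inner ℝ I f = ∫ x, f x ∂μ := by
        intro f
        rw [L2.inner_def]
        refine integral_congr_ae ?_
        filter_upwards [MemLp.coeFn_toLp (memLp_const (1 : ℝ) : MemLp (fun _ : X => (1 : ℝ)) 2 μ)]
          with x hx
        simp only [I]
        rw [hx]; simp
      simp only [← hI]
      exact (continuous_const.inner continuous_id).continuousAt.tendsto.comp hlim
    have h1 : ∫ x, (g : Lp ℝ 2 μ) x ∂μ = c := by
      rw [integral_congr_ae hc]; simp
    rw [h1] at hcont
    refine tendsto_nhds_unique hcont (tendsto_const_nhds.congr' ?_)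
    filter_upwards [eventually_gt_atTop 0] with n hn
    exact (hint n hn).symm
  rw [← hcφ]
  exact hmeas

/-- By invariance every term of the orbit sum has the same `L¹` norm. This controls the truncation
error uniformly in `n`. -/
theorem lintegral_orbitAvg_le (hT : MeasurePreserving T μ μ) {φ : X → ℝ} (hφ : Measurable φ)
    (n : ℕ) : ∫⁻ x, ‖orbitAvg T φ n x‖ₑ ∂μ ≤ ∫⁻ x, ‖φ x‖ₑ ∂μ := by
  rcases Nat.eq_zero_or_pos n with rfl | hn
  · simp [orbitAvg]
  calc ∫⁻ x, ‖orbitAvg T φ n x‖ₑ ∂μ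
      ≤ ∫⁻ x, ‖(n : ℝ)⁻¹‖ₑ * ∑ t ∈ Finset.range n, ‖φ (T^[t] x)‖ₑ ∂μ := by
        refine lintegral_mono fun x => ?_
        unfold orbitAvg
        rw [enorm_mul]
        gcongr
        exact enorm_sum_le _ _
    _ = ‖(n : ℝ)⁻¹‖ₑ * ∑ t ∈ Finset.range n, ∫⁻ x, ‖φ (T^[t] x)‖ₑ ∂μ := by
        rw [lintegral_const_mul, lintegral_finsetSum]
        · exact fun t _ => (hφ.comp (hT.iterate t).measurable).enorm
        · exact Finset.measurable_sum _ fun t _ => (hφ.comp (hT.iterate t).measurable).enorm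
    _ = ‖(n : ℝ)⁻¹‖ₑ * (n * ∫⁻ x, ‖φ x‖ₑ ∂μ) := by
        congr 1
        have : ∀ t, ∫⁻ x, ‖φ (T^[t] x)‖ₑ ∂μ = ∫⁻ x, ‖φ x‖ₑ ∂μ := fun t =>
          (hT.iterate t).lintegral_comp hφ.enorm
        simp [this]
    _ = ∫⁻ x, ‖φ x‖ₑ ∂μ := by
        rw [← mul_assoc]
        have : ‖(n : ℝ)⁻¹‖ₑ * (n : ℝ≥0∞) = 1 := by
          have h1 : (n : ℝ≥0∞) = ‖(n : ℝ)‖ₑ := by simp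
          rw [h1, ← enorm_mul, inv_mul_cancel₀ (by positivity)]; simp
        rw [this, one_mul]
    _ ≤ _ := le_rfl

/-- The mean ergodic theorem for integrable functions: convergence in measure of averages. -/
theorem tendsto_orbitAvg (hT : Ergodic T μ) {φ : X → ℝ} (hφ : Integrable φ μ)
    (hφm : Measurable φ) :
    TendstoInMeasure μ (orbitAvg T φ) atTop (fun _ => ∫ x, φ x ∂μ) := by
  rw [tendstoInMeasure_const_iff, Metric.tendsto_nhds]
  intro ε hε
  rw [eventually_inProb_iff, ENNReal.tendsto_nhds_zero]
  intro δ hδ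
  -- Truncation at level `M` puts the function in `L²`, where the previous theorem applies.
  let c : ℕ → X → ℝ := fun M x => max (-(M : ℝ)) (min (φ x) M)
  have hcm : ∀ M, Measurable (c M) := fun M => measurable_const.max (hφm.min measurable_const)
  have hcb : ∀ M x, |c M x| ≤ M := by
    intro M x
    have : (0 : ℝ) ≤ M := by positivity
    rw [abs_le]
    exact ⟨le_max_left _ _, max_le (by linarith) (min_le_right _ _)⟩
  have hcl : ∀ M x, |c M x - φ x| ≤ |φ x| := by
    intro M x
    have h0 : (0 : ℝ) ≤ M := by positivity
    simp only [c]
    rcases max_cases (-(M : ℝ)) (min (φ x) M) with h | h <;>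
    rcases min_cases (φ x) (M : ℝ) with h' | h' <;>
    rcases abs_cases (φ x) with h2 | h2 <;>
    rw [abs_le] <;> constructor <;> linarith
  have hlim : Tendsto (fun M => ∫⁻ x, ‖c M x - φ x‖ₑ ∂μ) atTop (𝓝 0) := by
    have h0 : (0 : ℝ≥0∞) = ∫⁻ x : X, 0 ∂μ := by simp
    rw [h0]
    refine tendsto_lintegral_of_dominated_convergence (fun x => ‖φ x‖ₑ)
      (fun M => ((hcm M).sub hφm).enorm) (fun M => ae_of_all _ fun x => ?_) hφ.2.ne
      (ae_of_all _ fun x => ?_)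
    · exact enorm_le_iff_norm_le.2 (hcl M x)
    · refine tendsto_const_nhds.congr' ?_
      obtain ⟨N, hN⟩ := exists_nat_ge |φ x|
      filter_upwards [eventually_ge_atTop N] with M hM
      have hM' : |φ x| ≤ M := hN.trans (by exact_mod_cast hM)
      rw [abs_le] at hM'
      simp [c, min_eq_left hM'.2, max_eq_right hM'.1]
  -- The first bound feeds Markov's inequality for the averaged truncation error, the second bounds
  -- the change of the integral; in the end `ε / 3 + ε / 3 + ε / 4 < ε`.
  have hδ' : 0 < min (δ / 2 * ENNReal.ofReal (ε / 3)) (ENNReal.ofReal (ε / 4)) := by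
    refine lt_min (ENNReal.mul_pos (ENNReal.half_pos hδ.ne').ne' ?_) ?_
    · simpa using (by positivity : 0 < ε / 3)
    · simpa using (by positivity : 0 < ε / 4)
  obtain ⟨M, hM⟩ := (ENNReal.tendsto_nhds_zero.1 hlim _ hδ').exists
  have hc2 : MemLp (c M) 2 μ := MemLp.of_bound (hcm M).aestronglyMeasurable M
    (ae_of_all _ (hcb M))
  have hcint : Integrable (c M) μ := hc2.integrable one_le_two
  have hd : |∫ x, c M x ∂μ - ∫ x, φ x ∂μ| ≤ ε / 4 := by
    rw [← integral_sub hcint hφ]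
    have h1 : ‖∫ x, (c M x - φ x) ∂μ‖ₑ ≤ ENNReal.ofReal (ε / 4) :=
      (enorm_integral_le_lintegral_enorm _).trans (hM.trans (min_le_right _ _))
    rw [← ofReal_norm, ENNReal.ofReal_le_ofReal_iff (by positivity)] at h1
    exact h1
  have h1 := eventually_inProb_iff.1 (Metric.tendsto_nhds.1
    (tendstoInMeasure_const_iff.1 (tendsto_orbitAvg_of_memLp_two hT hc2 (hcm M))) (ε / 3)
    (by positivity))
  filter_upwards [ENNReal.tendsto_nhds_zero.1 h1 _ (ENNReal.half_pos hδ.ne')] with n hn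
  have hsplit : ∀ x, orbitAvg T φ n x = orbitAvg T (c M) n x - orbitAvg T (c M - φ) n x := by
    intro x
    simp only [orbitAvg, Pi.sub_apply, Finset.sum_sub_distrib]; ring
  have hsub : {x | ¬ dist (orbitAvg T φ n x) (∫ x, φ x ∂μ) < ε} ⊆
      {x | ENNReal.ofReal (ε / 3) ≤ ‖orbitAvg T (c M - φ) n x‖ₑ} ∪
        {x | ¬ dist (orbitAvg T (c M) n x) (∫ x, c M x ∂μ) < ε / 3} := by
    intro x hx
    by_contra hcon
    simp only [Set.mem_union, Set.mem_ofPred_eq, not_or, not_not, Real.dist_eq] at hcon hx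
    obtain ⟨h1, h2⟩ := hcon
    apply hx
    rw [not_le, ← ofReal_norm, ENNReal.ofReal_lt_ofReal_iff (by positivity), Real.norm_eq_abs]
      at h1
    rw [hsplit]
    rw [abs_lt] at *
    rw [abs_le] at hd
    constructor <;> linarith [hd.1, hd.2, h1.1, h1.2, h2.1, h2.2]
  calc μ {x | ¬ dist (orbitAvg T φ n x) (∫ x, φ x ∂μ) < ε} ≤ _ := measure_mono hsub
    _ ≤ _ := measure_union_le _ _
    _ ≤ δ / 2 + δ / 2 := by
      refine add_le_add ?_ hn
      refine le_trans (meas_ge_le_lintegral_div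
        (measurable_orbitAvg hT.measurable ((hcm M).sub hφm) n).enorm.aemeasurable
        (by simpa using (by positivity : 0 < ε / 3)) ENNReal.ofReal_ne_top) ?_
      rw [ENNReal.div_le_iff (by simpa using (by positivity : 0 < ε / 3)) ENNReal.ofReal_ne_top]
      exact (lintegral_orbitAvg_le hT.toMeasurePreserving ((hcm M).sub hφm) n).trans
        (hM.trans (min_le_left _ _))
    _ = δ := ENNReal.add_halves δ

end MeanErgodic

end

section

/-! ### Stationary ergodic processes and their weak law of large numbers. -/

section Stationary

variable {Ω : Type*} [MeasurableSpace Ω] {P : Measure Ω} {y : ℤ → Ω → ℝ}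

/-- The past and the present of the process at time `t`. -/
def obs (y : ℤ → Ω → ℝ) (t : ℤ) (ω : Ω) : (ℕ → ℝ) × ℝ := (past y t ω, y t ω)

theorem measurable_past (hy : ∀ t, Measurable (y t)) (t : ℤ) : Measurable (past y t) :=
  measurable_pi_lambda _ fun _ => hy _

theorem measurable_obs (hy : ∀ t, Measurable (y t)) (t : ℤ) : Measurable (obs y t) :=
  (measurable_past hy t).prodMk (hy t)

/-- The past and the present at time `t`, read off a trajectory. -/
def pathObs (t : ℤ) (x : ℤ → ℝ) : (ℕ → ℝ) × ℝ := (fun j => x (t - 1 - j), x t)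

/-- The shift of trajectories. -/
def pathShift (x : ℤ → ℝ) (t : ℤ) : ℝ := x (t + 1)

theorem measurable_pathObs (t : ℤ) : Measurable (pathObs t) :=
  (measurable_pi_lambda _ fun _ => measurable_pi_apply _).prodMk (measurable_pi_apply _)

theorem pathObs_shift (t : ℤ) (x : ℤ → ℝ) : pathObs t (pathShift x) = pathObs (t + 1) x := by
  simp only [pathObs, pathShift, Prod.mk.injEq, and_true]
  funext j
  congr 1
  ring

/-- The base point is time `1` because orbit averages run over `0, …, n - 1` and sample averages
over `1, …, n`. -/
theorem pathObs_shift_iterate (t : ℕ) (x : ℤ → ℝ) :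
    pathObs 1 (pathShift^[t] x) = pathObs (t + 1) x := by
  induction t generalizing x with
  | zero => simp
  | succ k ih =>
    rw [Function.iterate_succ_apply, ih, pathObs_shift]
    push_cast
    rfl

theorem measurable_path (hy : ∀ t, Measurable (y t)) : Measurable fun ω t => y t ω :=
  measurable_pi_lambda _ hy

/-- Shifting a trajectory advances the observation by one time unit, and the shift preserves the law
of the process. All changes of time under expectations rest on this. -/
theorem map_obs_eq (hy : ∀ t, Measurable (y t)) (he : StationaryErgodic P y) (t : ℤ) :
    P.map (obs y t) = P.map (obs y 0) := by
  have h : ∀ t, P.map (obs y t) = (P.map fun ω t => y t ω).map (pathObs t) := fun t => by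
    rw [Measure.map_map (measurable_pathObs t) (measurable_path hy)]; rfl
  have hstep : ∀ t, P.map (obs y (t + 1)) = P.map (obs y t) := by
    intro t
    have hT : MeasurePreserving pathShift (P.map fun ω t => y t ω) (P.map fun ω t => y t ω) :=
      he.toMeasurePreserving
    rw [h, h]
    conv_rhs => rw [← hT.map_eq]
    rw [Measure.map_map (measurable_pathObs t) hT.measurable]
    congr 1
    funext x
    exact (pathObs_shift t x).symm
  induction t using Int.induction_on with
  | zero => rfl
  | succ k ih => rw [hstep, ih]
  | pred k ih => rw [← ih, ← hstep]; congr 2; ring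

theorem lintegral_obs_eq (hy : ∀ t, Measurable (y t)) (he : StationaryErgodic P y) (t : ℤ)
    {φ : (ℕ → ℝ) × ℝ → ℝ≥0∞} (hφ : Measurable φ) :
    ∫⁻ ω, φ (obs y t ω) ∂P = ∫⁻ ω, φ (obs y 0 ω) ∂P := by
  rw [← lintegral_map hφ (measurable_obs hy t), map_obs_eq hy he, lintegral_map hφ
    (measurable_obs hy 0)]

theorem integral_obs_eq (hy : ∀ t, Measurable (y t)) (he : StationaryErgodic P y) (t : ℤ)
    {φ : (ℕ → ℝ) × ℝ → ℝ} (hφ : Measurable φ) :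
    ∫ ω, φ (obs y t ω) ∂P = ∫ ω, φ (obs y 0 ω) ∂P := by
  rw [← integral_map (measurable_obs hy t).aemeasurable hφ.aestronglyMeasurable,
    map_obs_eq hy he, integral_map (measurable_obs hy 0).aemeasurable hφ.aestronglyMeasurable]

theorem integrable_obs_iff (hy : ∀ t, Measurable (y t)) (he : StationaryErgodic P y) (t : ℤ)
    {φ : (ℕ → ℝ) × ℝ → ℝ} (hφ : Measurable φ) :
    Integrable (fun ω => φ (obs y t ω)) P ↔ Integrable (fun ω => φ (obs y 0 ω)) P := by
  have h : ∀ t, Integrable (fun ω => φ (obs y t ω)) P ↔ Integrable φ (P.map (obs y t)) := fun t =>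
    (integrable_map_measure hφ.aestronglyMeasurable (measurable_obs hy t).aemeasurable).symm
  rw [h, h, map_obs_eq hy he]

/-- The average of `a 1, …, a n`. -/
def avg (n : ℕ) (a : ℕ → ℝ) : ℝ := (n : ℝ)⁻¹ * ∑ t ∈ Finset.Icc 1 n, a t

/-- The weak law of large numbers for functionals of a stationary ergodic process. -/
theorem tendsto_avg_obs [IsProbabilityMeasure P] (hy : ∀ t, Measurable (y t))
    (he : StationaryErgodic P y) {φ : (ℕ → ℝ) × ℝ → ℝ} (hφ : Measurable φ)
    (hint : Integrable (fun ω => φ (obs y 0 ω)) P) :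
    Tendsto (fun p : ℕ × Ω => avg p.1 fun t => φ (obs y t p.2)) (inProb P)
      (𝓝 (∫ ω, φ (obs y 0 ω) ∂P)) := by
  have hpm := measurable_path hy
  have : IsProbabilityMeasure (P.map fun ω t => y t ω) :=
    Measure.isProbabilityMeasure_map hpm.aemeasurable
  have he' : Ergodic pathShift (P.map fun ω t => y t ω) := he
  -- The ergodic theorem is applied on path space; the exceptional events are then pulled back along
  -- the trajectory map.
  let ψ : (ℤ → ℝ) → ℝ := fun x => φ (pathObs 1 x)
  have hψ : Measurable ψ := hφ.comp (measurable_pathObs 1)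
  have hψi : Integrable ψ (P.map fun ω t => y t ω) := by
    rw [integrable_map_measure hψ.aestronglyMeasurable hpm.aemeasurable]
    exact (integrable_obs_iff hy he 1 hφ).2 hint
  have h := tendsto_orbitAvg he' hψi hψ
  have hval : ∫ x, ψ x ∂(P.map fun ω t => y t ω) = ∫ ω, φ (obs y 0 ω) ∂P := by
    rw [integral_map hpm.aemeasurable hψ.aestronglyMeasurable]
    exact integral_obs_eq hy he 1 hφ
  rw [hval] at h
  rw [← tendstoInMeasure_const_iff (f := fun n ω => avg n fun t => φ (obs y t ω))]
  intro ε hε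
  refine (h ε hε).congr fun n => ?_
  have hmeas : MeasurableSet {x | ε ≤ edist (orbitAvg pathShift ψ n x)
      (∫ ω, φ (obs y 0 ω) ∂P)} :=
    measurableSet_le measurable_const
      ((measurable_orbitAvg he'.measurable hψ n).edist measurable_const)
  rw [Measure.map_apply hpm hmeas]
  congr 1
  ext ω
  have : orbitAvg pathShift ψ n (fun t => y t ω) = avg n fun t => φ (obs y t ω) := by
    unfold orbitAvg avg
    congr 1
    rw [Finset.range_eq_Ico, show Finset.Icc 1 n = Finset.Ico (0 + 1) (n + 1) from rfl,
      ← Finset.sum_Ico_add' (fun t : ℕ => φ (obs y t ω)) 0 n 1]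
    refine Finset.sum_congr rfl fun t _ => ?_
    simp only [ψ, pathObs_shift_iterate]
    rfl
  simp [this]

end Stationary

end

section

/-! ### The logistic density: concavity, the tangent inequality, derivatives along curves. -/

section Logistic

/-- The logarithm of the logistic density. -/
def logLogistic (x : ℝ) : ℝ := Real.log (logisticPDF x)

theorem logisticPDF_eq (x : ℝ) : logisticPDF x = Real.sigmoid x * (1 - Real.sigmoid x) := by
  have : (0 : ℝ) < 1 + Real.exp (-x) := by positivity
  rw [logisticPDF, Real.sigmoid_def]
  field_simp
  ring

theorem logisticPDF_pos (x : ℝ) : 0 < logisticPDF x := by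
  unfold logisticPDF; positivity

theorem logisticPDF_neg (x : ℝ) : logisticPDF (-x) = logisticPDF x := by
  rw [logisticPDF_eq, logisticPDF_eq, Real.sigmoid_neg]; ring

theorem logisticPDF_le_one (x : ℝ) : logisticPDF x ≤ 1 := by
  rw [logisticPDF_eq]
  have h1 := Real.sigmoid_pos x
  have h2 := Real.sigmoid_lt_one x
  nlinarith

theorem continuous_logisticPDF : Continuous logisticPDF := by
  have : logisticPDF = fun x => Real.sigmoid x * (1 - Real.sigmoid x) := funext logisticPDF_eq
  rw [this]
  exact continuous_sigmoid.mul (continuous_const.sub continuous_sigmoid)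

theorem continuous_h : Continuous h :=
  continuous_id.mul ((continuous_const.mul continuous_sigmoid).sub continuous_const)

theorem logLogistic_le_zero (x : ℝ) : logLogistic x ≤ 0 :=
  Real.log_nonpos (logisticPDF_pos x).le (logisticPDF_le_one x)

theorem hasDerivAt_logLogistic (x : ℝ) :
    HasDerivAt logLogistic (1 - 2 * Real.sigmoid x) x := by
  have h1 := Real.hasDerivAt_sigmoid x
  have h2 := (h1.mul (h1.const_sub 1)).log (by
    have := logisticPDF_pos x; rw [logisticPDF_eq] at this; exact this.ne')
  have h3 : logLogistic =
      fun x => Real.log ((Real.sigmoid * fun x => 1 - Real.sigmoid x) x) := by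
    funext x; simp [logLogistic, logisticPDF_eq]
  rw [h3]
  refine h2.congr_deriv ?_
  have h4 := Real.sigmoid_pos x
  have h5 : 0 < 1 - Real.sigmoid x := by linarith [Real.sigmoid_lt_one x]
  simp only [Pi.mul_apply]
  field_simp
  ring

/-- The derivative `1 - 2F` is strictly decreasing, so the function is strictly concave; the mean
value theorem turns this into a strict tangent bound. -/
theorem logLogistic_add_lt {x δ : ℝ} (hδ : δ ≠ 0) :
    logLogistic (x + δ) < logLogistic x + δ * (1 - 2 * Real.sigmoid x) := by
  have hc : Continuous logLogistic :=
    continuous_iff_continuousAt.2 fun x => (hasDerivAt_logLogistic x).continuousAt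
  rcases lt_or_gt_of_ne hδ with hneg | hpos
  · obtain ⟨c, hc1, hc2⟩ := exists_hasDerivAt_eq_slope logLogistic
      (fun x => 1 - 2 * Real.sigmoid x) (show x + δ < x by linarith) hc.continuousOn
      (fun x _ => hasDerivAt_logLogistic x)
    have := Real.sigmoid_lt hc1.2
    rw [eq_div_iff (by linarith)] at hc2
    nlinarith
  · obtain ⟨c, hc1, hc2⟩ := exists_hasDerivAt_eq_slope logLogistic
      (fun x => 1 - 2 * Real.sigmoid x) (show x < x + δ by linarith) hc.continuousOn
      (fun x _ => hasDerivAt_logLogistic x)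
    have := Real.sigmoid_lt hc1.1
    rw [eq_div_iff (by linarith)] at hc2
    nlinarith

theorem logLogistic_add_le (x δ : ℝ) :
    logLogistic (x + δ) ≤ logLogistic x + δ * (1 - 2 * Real.sigmoid x) := by
  rcases eq_or_ne δ 0 with rfl | hδ
  · simp
  · exact (logLogistic_add_lt hδ).le

theorem abs_logLogistic_sub_le (x z : ℝ) : |logLogistic x - logLogistic z| ≤ |x - z| := by
  have key : ∀ x z : ℝ, logLogistic x - logLogistic z ≤ |x - z| := by
    intro x z
    have h1 := logLogistic_add_le z (x - z)
    rw [add_sub_cancel] at h1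
    have h2 : (x - z) * (1 - 2 * Real.sigmoid z) ≤ |x - z| := by
      refine (le_abs_self _).trans ?_
      rw [abs_mul]
      refine mul_le_of_le_one_right (abs_nonneg _) (abs_le.2 ⟨?_, ?_⟩) <;>
      linarith [Real.sigmoid_pos z, Real.sigmoid_lt_one z]
    linarith
  exact abs_sub_le_iff.2 ⟨key x z, by rw [abs_sub_comm]; exact key z x⟩

theorem h_nonneg (x : ℝ) : 0 ≤ h x := by
  unfold h
  rcases le_total 0 x with hx | hx
  · have := Real.sigmoid_le hx
    rw [Real.sigmoid_zero] at this
    exact mul_nonneg hx (by linarith)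
  · have := Real.sigmoid_le hx
    rw [Real.sigmoid_zero] at this
    exact mul_nonneg_of_nonpos_of_nonpos hx (by linarith)

/-- For `|x| > 1` the factor `|2F(x) - 1|` is at least `2F(1) - 1 > 0`. Through this bound the
condition `E h(η) = 1` makes `η` integrable. -/
theorem exists_abs_le_one_add_mul_h : ∃ K : ℝ, 0 < K ∧ ∀ x : ℝ, |x| ≤ 1 + K * h x := by
  have h1 : 0 < 2 * Real.sigmoid 1 - 1 := by
    have := Real.sigmoid_lt (show (0 : ℝ) < 1 by norm_num)
    rw [Real.sigmoid_zero] at this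
    linarith
  refine ⟨(2 * Real.sigmoid 1 - 1)⁻¹, inv_pos.2 h1, fun x => ?_⟩
  rw [← sub_le_iff_le_add', inv_mul_eq_div, le_div_iff₀ h1]
  by_cases hx : |x| ≤ 1
  · exact (mul_nonpos_of_nonpos_of_nonneg (by linarith) h1.le).trans (h_nonneg x)
  · push Not at hx
    have h2 : |x| * (2 * Real.sigmoid 1 - 1) ≤ h x := by
      unfold h
      rcases lt_abs.1 hx with h3 | h3
      · rw [abs_of_pos (by linarith)]
        have := Real.sigmoid_le h3.le
        exact mul_le_mul_of_nonneg_left (by linarith) (by linarith)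
      · rw [abs_of_neg (by linarith)]
        have := Real.sigmoid_le h3.le
        rw [Real.sigmoid_neg] at this
        nlinarith
    nlinarith

/-- The heart of identification: `log u ≤ u - 1` at `u = σ₀ / s` is added to the tangent bound for
the log-density at `e`. The bound `B` is linear in `1 - h e` and `2F(e) - 1`, which have mean zero
when `e` is an innovation. Equality forces equality in both inequalities, that is `u = 1` and a zero
increment. -/
theorem logLogistic_sub_tangent {σ₀ s g₀ m e : ℝ} (hσ₀ : 0 < σ₀) (hs : 0 < s) :
    let A := (-Real.log s + logLogistic ((g₀ + σ₀ * e - m) / s)) -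
      (-Real.log σ₀ + logLogistic e)
    let B := (σ₀ / s - 1) * (1 - h e) - (g₀ - m) / s * (2 * Real.sigmoid e - 1)
    A ≤ B ∧ (A = B → m = g₀ ∧ s = σ₀) := by
  intro A B
  have hu : 0 < σ₀ / s := div_pos hσ₀ hs
  have hlog : Real.log (σ₀ / s) = Real.log σ₀ - Real.log s :=
    Real.log_div hσ₀.ne' hs.ne'
  have harg : (g₀ + σ₀ * e - m) / s = e + ((σ₀ / s - 1) * e + (g₀ - m) / s) := by
    field_simp; ring
  have h1 := Real.log_le_sub_one_of_pos hu
  have h2 := logLogistic_add_le e ((σ₀ / s - 1) * e + (g₀ - m) / s)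
  have hB : (σ₀ / s - 1) + ((σ₀ / s - 1) * e + (g₀ - m) / s) * (1 - 2 * Real.sigmoid e) = B := by
    simp only [B, h]; ring
  refine ⟨?_, fun hAB => ?_⟩
  · simp only [A]
    rw [harg, ← hB]
    linarith
  · have h3 : σ₀ / s = 1 := by
      by_contra hne
      have := Real.log_lt_sub_one_of_pos hu hne
      simp only [A] at hAB
      rw [harg, ← hB] at hAB
      linarith
    have h4 : (σ₀ / s - 1) * e + (g₀ - m) / s = 0 := by
      by_contra hne
      have := logLogistic_add_lt (x := e) hne
      simp only [A] at hAB
      rw [harg, ← hB] at hAB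
      linarith
    rw [h3] at h4
    have h5 : (g₀ - m) / s = 0 := by linarith
    rw [div_eq_zero_iff, or_iff_left hs.ne'] at h5
    rw [div_eq_one_iff_eq hs.ne'] at h3
    exact ⟨by linarith, h3.symm⟩

/-- The derivative of the log-likelihood along a curve. -/
theorem hasDerivAt_logLik_curve {s m : ℝ → ℝ} {s' m' v a : ℝ} (hs : 0 < s a)
    (hs' : HasDerivAt s s' a) (hm' : HasDerivAt m m' a) :
    HasDerivAt (fun r => -Real.log (s r) + logLogistic ((v - m r) / s r))
      (s' / s a * (h ((v - m a) / s a) - 1) +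
        m' / s a * (2 * Real.sigmoid ((v - m a) / s a) - 1)) a := by
  have he := (hm'.const_sub v).div hs' hs.ne'
  have h1 := (hs'.log hs.ne').neg.add
    ((hasDerivAt_logLogistic ((v - m a) / s a)).comp a he)
  refine h1.congr_deriv ?_
  unfold h
  field_simp
  ring

/-- The derivative of the score along a curve. -/
theorem hasDerivAt_score_curve {s m s₁ m₁ : ℝ → ℝ} {s₂ m₂ v a e : ℝ} (hs : 0 < s a)
    (hs' : HasDerivAt s (s₁ a) a) (hm' : HasDerivAt m (m₁ a) a)
    (hs'' : HasDerivAt s₁ s₂ a) (hm'' : HasDerivAt m₁ m₂ a) (he : e = (v - m a) / s a) :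
    HasDerivAt (fun r => s₁ r / s r * (h ((v - m r) / s r) - 1) +
        m₁ r / s r * (2 * Real.sigmoid ((v - m r) / s r) - 1))
      (-(((s₁ a / s a) ^ 2 - s₂ / s a) * (h e - 1) + (s₁ a / s a) ^ 2 * h e +
        2 * logisticPDF e * (m₁ a / s a + e * (s₁ a / s a)) ^ 2 +
        (2 * Real.sigmoid e - 1) * (2 * (s₁ a / s a) * (m₁ a / s a) - m₂ / s a))) a := by
  have hq := (hm'.const_sub v).div hs' hs.ne'
  have hF := (Real.hasDerivAt_sigmoid ((v - m a) / s a)).comp a hq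
  have hh : HasDerivAt h (2 * Real.sigmoid ((v - m a) / s a) - 1 + (v - m a) / s a *
      (2 * (Real.sigmoid ((v - m a) / s a) * (1 - Real.sigmoid ((v - m a) / s a)))))
      ((v - m a) / s a) := by
    have := (hasDerivAt_id ((v - m a) / s a)).mul
      (((Real.hasDerivAt_sigmoid ((v - m a) / s a)).const_mul 2).sub_const 1)
    refine this.congr_deriv ?_
    simp
  have h1 := ((hs''.div hs' hs.ne').mul ((hh.comp a hq).sub_const 1)).add
    ((hm''.div hs' hs.ne').mul ((hF.const_mul 2).sub_const 1))
  refine h1.congr_deriv ?_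
  have hv : v - m a = e * s a := by rw [he]; field_simp
  simp only [Function.comp_apply, Pi.div_apply, logisticPDF_eq, h, hv]
  field_simp
  ring

end Logistic

end

section

/-! ### Second derivatives, Hessian matrices and quadratic forms. -/

section Calculus

variable {d : ℕ}

/-- Minus the Hessian matrix of a function. -/
def hessMat (ℓ : EuclideanSpace ℝ (Fin d) → ℝ) (θ : EuclideanSpace ℝ (Fin d)) :
    Matrix (Fin d) (Fin d) ℝ :=
  Matrix.of fun i j =>
    -(fderiv ℝ (fun θ' => fderiv ℝ ℓ θ' (EuclideanSpace.single j 1)) θ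
      (EuclideanSpace.single i 1))

variable {ℓ : EuclideanSpace ℝ (Fin d) → ℝ} {U : Set (EuclideanSpace ℝ (Fin d))}
    {θ θ₀ : EuclideanSpace ℝ (Fin d)}

theorem differentiableAt_of_contDiffOn_two (hU : IsOpen U) (hℓ : ContDiffOn ℝ 2 ℓ U)
    (hθ : θ ∈ U) : DifferentiableAt ℝ ℓ θ :=
  (hℓ.contDiffAt (hU.mem_nhds hθ)).differentiableAt (by norm_num)

theorem contDiffOn_fderiv (hU : IsOpen U) (hℓ : ContDiffOn ℝ 2 ℓ U) :
    ContDiffOn ℝ 1 (fderiv ℝ ℓ) U :=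
  hℓ.fderiv_of_isOpen hU (by norm_num)

theorem differentiableAt_fderiv (hU : IsOpen U) (hℓ : ContDiffOn ℝ 2 ℓ U) (hθ : θ ∈ U) :
    DifferentiableAt ℝ (fderiv ℝ ℓ) θ :=
  ((contDiffOn_fderiv hU hℓ).contDiffAt (hU.mem_nhds hθ)).differentiableAt (by norm_num)

theorem fderiv_fderiv_apply (hU : IsOpen U) (hℓ : ContDiffOn ℝ 2 ℓ U) (hθ : θ ∈ U)
    (u w : EuclideanSpace ℝ (Fin d)) :
    fderiv ℝ (fun θ' => fderiv ℝ ℓ θ' w) θ u = fderiv ℝ (fderiv ℝ ℓ) θ u w := by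
  rw [fderiv_clm_apply (differentiableAt_fderiv hU hℓ hθ) (differentiableAt_const w)]
  simp

theorem hessMat_apply (hU : IsOpen U) (hℓ : ContDiffOn ℝ 2 ℓ U) (hθ : θ ∈ U) (i j : Fin d) :
    hessMat ℓ θ i j = -(fderiv ℝ (fderiv ℝ ℓ) θ (EuclideanSpace.single i 1)
      (EuclideanSpace.single j 1)) := by
  rw [← fderiv_fderiv_apply hU hℓ hθ]
  rfl

/-- The quadratic form of a matrix. -/
def bilin (M : Matrix (Fin d) (Fin d) ℝ) (u w : EuclideanSpace ℝ (Fin d)) : ℝ :=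
    ∑ i, ∑ j, u i * M i j * w j

theorem bilin_eq_inner (M : Matrix (Fin d) (Fin d) ℝ) (u w : EuclideanSpace ℝ (Fin d)) :
    bilin M u w = inner ℝ u (WithLp.toLp 2 (M.mulVec w)) := by
  simp only [bilin, PiLp.inner_apply, Matrix.mulVec, dotProduct, RCLike.inner_apply, conj_trivial,
    Finset.sum_mul]
  refine Finset.sum_congr rfl fun i _ => Finset.sum_congr rfl fun j _ => by ring

theorem abs_bilin_le (M : Matrix (Fin d) (Fin d) ℝ) (u w : EuclideanSpace ℝ (Fin d)) :
    |bilin M u w| ≤ ‖M‖ * ‖u‖ * ‖w‖ := by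
  rw [bilin_eq_inner]
  calc _ ≤ ‖u‖ * ‖WithLp.toLp 2 (M.mulVec w)‖ := abs_real_inner_le_norm _ _
    _ ≤ ‖u‖ * (‖M‖ * ‖w‖) := by gcongr; exact Matrix.l2_opNorm_mulVec M w
    _ = _ := by ring

theorem bilin_single (M : Matrix (Fin d) (Fin d) ℝ) (i j : Fin d) :
    bilin M (EuclideanSpace.single i 1) (EuclideanSpace.single j 1) = M i j := by
  simp [bilin, Finset.sum_ite_eq, Pi.single_apply]

theorem abs_entry_le (M : Matrix (Fin d) (Fin d) ℝ) (i j : Fin d) : |M i j| ≤ ‖M‖ := by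
  have := abs_bilin_le M (EuclideanSpace.single i 1) (EuclideanSpace.single j 1)
  rw [bilin_single] at this
  simpa using this

theorem bilin_sub (M N : Matrix (Fin d) (Fin d) ℝ) (u w : EuclideanSpace ℝ (Fin d)) :
    bilin (M - N) u w = bilin M u w - bilin N u w := by
  simp only [bilin, Matrix.sub_apply, ← Finset.sum_sub_distrib]
  refine Finset.sum_congr rfl fun i _ => Finset.sum_congr rfl fun j _ => by ring

theorem bilin_smul (a : ℝ) (M : Matrix (Fin d) (Fin d) ℝ) (u w : EuclideanSpace ℝ (Fin d)) :
    bilin (a • M) u w = a * bilin M u w := by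
  simp only [bilin, Matrix.smul_apply, Finset.mul_sum, smul_eq_mul]
  refine Finset.sum_congr rfl fun i _ => Finset.sum_congr rfl fun j _ => by ring

theorem bilin_sum {ι : Type*} (s : Finset ι) (M : ι → Matrix (Fin d) (Fin d) ℝ)
    (u w : EuclideanSpace ℝ (Fin d)) :
    bilin (∑ t ∈ s, M t) u w = ∑ t ∈ s, bilin (M t) u w := by
  simp only [bilin, Matrix.sum_apply, Finset.mul_sum, Finset.sum_mul]
  rw [Finset.sum_comm (s := s)]
  refine Finset.sum_congr rfl fun i _ => Finset.sum_comm

theorem fderiv_fderiv_eq_neg_bilin (hU : IsOpen U) (hℓ : ContDiffOn ℝ 2 ℓ U) (hθ : θ ∈ U)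
    (u w : EuclideanSpace ℝ (Fin d)) : fderiv ℝ (fderiv ℝ ℓ) θ u w = -bilin (hessMat ℓ θ) u w := by
  have hsum : ∀ x : EuclideanSpace ℝ (Fin d), x = ∑ i, x i • EuclideanSpace.single i (1 : ℝ) :=
    fun x => by
    simpa using ((EuclideanSpace.basisFun (Fin d) ℝ).sum_repr x).symm
  conv_lhs => rw [hsum u, hsum w]
  simp only [map_sum, map_smul, _root_.sum_apply, _root_.smul_apply,
    smul_eq_mul, bilin, hessMat_apply hU hℓ hθ]
  simp only [Finset.mul_sum, ← Finset.sum_neg_distrib]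
  rw [Finset.sum_comm]
  exact Finset.sum_congr rfl fun i _ => Finset.sum_congr rfl fun j _ => by ring

/-- Passes from the spectral norm, in which the assumptions are stated, to the operator norm
required by the mean value inequality. -/
theorem norm_fderiv_fderiv_sub_le (hU : IsOpen U) (hℓ : ContDiffOn ℝ 2 ℓ U) (hθ : θ ∈ U)
    (hθ₀ : θ₀ ∈ U) : ‖fderiv ℝ (fderiv ℝ ℓ) θ - fderiv ℝ (fderiv ℝ ℓ) θ₀‖ ≤
      ‖hessMat ℓ θ - hessMat ℓ θ₀‖ := by
  refine ContinuousLinearMap.opNorm_le_bound _ (norm_nonneg _) fun u => ?_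
  refine ContinuousLinearMap.opNorm_le_bound _ (by positivity) fun w => ?_
  rw [_root_.sub_apply, _root_.sub_apply,
    fderiv_fderiv_eq_neg_bilin hU hℓ hθ, fderiv_fderiv_eq_neg_bilin hU hℓ hθ₀,
    show -bilin (hessMat ℓ θ) u w - -bilin (hessMat ℓ θ₀) u w =
      -(bilin (hessMat ℓ θ - hessMat ℓ θ₀) u w) by rw [bilin_sub]; ring, norm_neg]
  exact abs_bilin_le _ u w

theorem continuousOn_hessMat (hU : IsOpen U) (hℓ : ContDiffOn ℝ 2 ℓ U) :
    ContinuousOn (hessMat ℓ) U := by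
  have h1 : ContinuousOn (fderiv ℝ (fderiv ℝ ℓ)) U :=
    (contDiffOn_fderiv hU hℓ).continuousOn_fderiv_of_isOpen hU le_rfl
  -- The spectral norm induces the product topology on matrices, so continuity is checked entrywise.
  refine continuousOn_pi.2 fun i => continuousOn_pi.2 fun j => ?_
  have h2 : ContinuousOn (fun θ => -(fderiv ℝ (fderiv ℝ ℓ) θ (EuclideanSpace.single i 1)
      (EuclideanSpace.single j 1))) U :=
    ((h1.clm_apply continuousOn_const).clm_apply continuousOn_const).neg
  exact h2.congr fun θ hθ => hessMat_apply hU hℓ hθ i j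

/-- First-order expansion of the derivative, with the oscillation of the Hessian as remainder. -/
theorem norm_fderiv_sub_le {δ C : ℝ} (hball : Metric.ball θ₀ δ ⊆ U) (hU : IsOpen U)
    (hℓ : ContDiffOn ℝ 2 ℓ U) (hθ : θ ∈ Metric.ball θ₀ δ)
    (hC : ∀ θ' ∈ Metric.ball θ₀ δ, ‖hessMat ℓ θ' - hessMat ℓ θ₀‖ ≤ C)
    (w : EuclideanSpace ℝ (Fin d)) :
    |fderiv ℝ ℓ θ w - fderiv ℝ ℓ θ₀ w + bilin (hessMat ℓ θ₀) (θ - θ₀) w| ≤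
      C * ‖θ - θ₀‖ * ‖w‖ := by
  have h0 : θ₀ ∈ Metric.ball θ₀ δ :=
    Metric.mem_ball_self (dist_nonneg.trans_lt (Metric.mem_ball.1 hθ))
  -- Mean value inequality on the ball for the derivative minus its linearization at `θ₀`.
  have h1 := (convex_ball θ₀ δ).norm_image_sub_le_of_norm_fderiv_le' (𝕜 := ℝ) (f := fderiv ℝ ℓ)
    (φ := fderiv ℝ (fderiv ℝ ℓ) θ₀) (C := C)
    (fun x hx => differentiableAt_fderiv hU hℓ (hball hx))
    (fun x hx => (norm_fderiv_fderiv_sub_le hU hℓ (hball hx) (hball h0)).trans (hC x hx)) h0 hθ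
  have h2 := ContinuousLinearMap.le_of_opNorm_le _ h1 w
  simp only [_root_.sub_apply] at h2
  rw [fderiv_fderiv_eq_neg_bilin hU hℓ (hball h0), sub_neg_eq_add] at h2
  exact h2

end Calculus

/-! ### Measurability of derivatives and of suprema over the parameter. -/

section Measurability

variable {d : ℕ} {X : Type*} [MeasurableSpace X]

/-- The derivative is a pointwise limit of difference quotients. The sequence starts at an index `N`
past which the displaced points stay in `U`, where measurability is known. -/
theorem measurable_fderiv_apply {F : X → EuclideanSpace ℝ (Fin d) → ℝ}
    {U : Set (EuclideanSpace ℝ (Fin d))} (hU : IsOpen U)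
    (hF : ∀ θ ∈ U, Measurable fun z => F z θ) (hd : ∀ z, ∀ θ ∈ U, DifferentiableAt ℝ (F z) θ)
    {θ : EuclideanSpace ℝ (Fin d)} (hθ : θ ∈ U) (w : EuclideanSpace ℝ (Fin d)) :
    Measurable fun z => fderiv ℝ (F z) θ w := by
  have hc : Tendsto (fun n : ℕ => θ + ((n : ℝ) + 1)⁻¹ • w) atTop (𝓝 θ) := by
    have : Tendsto (fun n : ℕ => ((n : ℝ) + 1)⁻¹) atTop (𝓝 0) := by
      simpa using tendsto_one_div_add_atTop_nhds_zero_nat (𝕜 := ℝ)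
    simpa using tendsto_const_nhds.add (this.smul_const w)
  obtain ⟨N, hN⟩ := eventually_atTop.1 (hc.eventually_mem (hU.mem_nhds hθ))
  have hlim : ∀ z, Tendsto (fun n : ℕ => (((n + N : ℕ) : ℝ) + 1) •
      (F z (θ + (((n + N : ℕ) : ℝ) + 1)⁻¹ • w) - F z θ)) atTop (𝓝 (fderiv ℝ (F z) θ w)) := by
    intro z
    have h1 := (hd z θ hθ).hasFDerivAt.lim_real w
    have h2 : Tendsto (fun n : ℕ => ((n + N : ℕ) : ℝ) + 1) atTop atTop :=
      tendsto_atTop_add_const_right _ _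
        (tendsto_natCast_atTop_atTop.comp (tendsto_add_atTop_nat N))
    exact h1.comp h2
  refine measurable_of_tendsto_metrizable (fun n => ?_) (tendsto_pi_nhds.2 hlim)
  exact ((hF _ (hN _ (Nat.le_add_left _ _))).sub (hF θ hθ)).const_mul (((n + N : ℕ) : ℝ) + 1)

/-- Closed conditions pass from a dense subset to all of `S` by continuity, and openness of `B`
keeps `D ∩ B` dense in `S ∩ B`. With `D` countable this gives measurable suprema and null sets that
do not depend on the parameter. -/
theorem mem_of_forall_mem_dense {β : Type*} [TopologicalSpace β]
    {S D B : Set (EuclideanSpace ℝ (Fin d))}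
    (hD : S ⊆ closure D) (hDS : D ⊆ S) (hB : IsOpen B) {F : EuclideanSpace ℝ (Fin d) → β}
    (hF : ContinuousOn F S)
    {C : Set β} (hC : IsClosed C) (h : ∀ θ ∈ D ∩ B, F θ ∈ C) : ∀ θ ∈ S ∩ B, F θ ∈ C := by
  rintro θ ⟨hS, hθB⟩
  have h1 : θ ∈ closure (D ∩ B) := by
    rw [Set.inter_comm]; exact hB.inter_closure ⟨hθB, hD hS⟩
  have h2 : ContinuousWithinAt F (D ∩ B) θ :=
    (hF θ hS).mono (Set.inter_subset_left.trans hDS)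
  have h3 := h2.mem_closure_image h1
  exact hC.closure_subset_iff.2 (Set.image_subset_iff.2 h) h3

theorem exists_countable_dense_subset (S : Set (EuclideanSpace ℝ (Fin d))) :
    ∃ D : Set (EuclideanSpace ℝ (Fin d)), D.Countable ∧ D ⊆ S ∧ S ⊆ closure D := by
  obtain ⟨D, h1, h2, h3⟩ :=
    (TopologicalSpace.IsSeparable.of_separableSpace S).exists_countable_dense_subset
  exact ⟨D, h2, h1, h3⟩

theorem measurable_biSup_of_continuousOn {S B : Set (EuclideanSpace ℝ (Fin d))} (hB : IsOpen B)
    {F : X → EuclideanSpace ℝ (Fin d) → ℝ≥0∞}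
    (hF : ∀ z, ContinuousOn (F z) S) (hm : ∀ θ ∈ S, Measurable fun z => F z θ) :
    Measurable fun z => ⨆ θ ∈ S ∩ B, F z θ := by
  obtain ⟨D, hDc, hDS, hSD⟩ := exists_countable_dense_subset S
  have : (fun z => ⨆ θ ∈ S ∩ B, F z θ) = fun z => ⨆ θ ∈ D ∩ B, F z θ := by
    funext z
    refine le_antisymm ?_ (biSup_mono fun θ hθ => ⟨hDS hθ.1, hθ.2⟩)
    refine iSup₂_le ?_
    exact mem_of_forall_mem_dense hSD hDS hB (hF z) isClosed_Iic
      fun θ hθ => Set.mem_Iic.2 (le_iSup₂_of_le θ hθ le_rfl)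
  rw [this]
  exact Measurable.biSup _ (hDc.mono Set.inter_subset_left) fun θ hθ => hm θ (hDS hθ.1)

theorem measurable_biInf_of_continuousOn {S B : Set (EuclideanSpace ℝ (Fin d))} (hB : IsOpen B)
    {F : X → EuclideanSpace ℝ (Fin d) → ℝ≥0∞}
    (hF : ∀ z, ContinuousOn (F z) S) (hm : ∀ θ ∈ S, Measurable fun z => F z θ) :
    Measurable fun z => ⨅ θ ∈ S ∩ B, F z θ := by
  obtain ⟨D, hDc, hDS, hSD⟩ := exists_countable_dense_subset S
  have : (fun z => ⨅ θ ∈ S ∩ B, F z θ) = fun z => ⨅ θ ∈ D ∩ B, F z θ := by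
    funext z
    refine le_antisymm (biInf_mono fun θ hθ => ⟨hDS hθ.1, hθ.2⟩) ?_
    refine le_iInf₂ ?_
    exact mem_of_forall_mem_dense hSD hDS hB (hF z) isClosed_Ici
      fun θ hθ => Set.mem_Ici.2 (iInf₂_le_of_le θ hθ le_rfl)
  rw [this]
  exact Measurable.biInf _ (hDc.mono Set.inter_subset_left) fun θ hθ => hm θ (hDS hθ.1)

theorem measurable_hessMat {F : X → EuclideanSpace ℝ (Fin d) → ℝ}
    {U : Set (EuclideanSpace ℝ (Fin d))} (hU : IsOpen U)
    (hF : ∀ θ ∈ U, Measurable fun z => F z θ) (hd : ∀ z, ContDiffOn ℝ 2 (F z) U)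
    {θ : EuclideanSpace ℝ (Fin d)} (hθ : θ ∈ U) (i j : Fin d) :
    Measurable fun z => hessMat (F z) θ i j := by
  refine Measurable.neg ?_
  exact measurable_fderiv_apply hU (F := fun z θ' => fderiv ℝ (F z) θ' (EuclideanSpace.single j 1))
    (fun θ' hθ' => measurable_fderiv_apply hU hF
      (fun z θ hθ => differentiableAt_of_contDiffOn_two hU (hd z) hθ) hθ' _)
    (fun z θ' hθ' => (differentiableAt_fderiv hU (hd z) hθ').clm_apply
      (differentiableAt_const _)) hθ _

theorem measurable_enorm_of_entries {M : X → Matrix (Fin d) (Fin d) ℝ}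
    (hM : ∀ i j, Measurable fun z => M z i j) : Measurable fun z => ‖M z‖ₑ := by
  have h1 : Measurable fun z => (fun i j => M z i j : Fin d → Fin d → ℝ) :=
    measurable_pi_lambda _ fun i => measurable_pi_lambda _ fun j => hM i j
  have h2 : Continuous fun f : Fin d → Fin d → ℝ => ‖(Matrix.of f : Matrix (Fin d) (Fin d) ℝ)‖ₑ :=
    continuous_enorm.comp (continuous_id : Continuous fun f : Fin d → Fin d → ℝ => f)
  exact h2.measurable.comp h1

end Measurability

end

section

/-! ### Regularity of the log-likelihood and formulas for its derivatives. -/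

section LogLik

variable {d : ℕ} {g σ : (ℕ → ℝ) → EuclideanSpace ℝ (Fin d) → ℝ} {Y : ℕ → ℝ} {v : ℝ}
  {U : Set (EuclideanSpace ℝ (Fin d))} {θ : EuclideanSpace ℝ (Fin d)}

theorem inner_gradient (f : EuclideanSpace ℝ (Fin d) → ℝ) (θ w : EuclideanSpace ℝ (Fin d)) :
    inner ℝ (gradient f θ) w = fderiv ℝ f θ w :=
  InnerProductSpace.toDual_symm_apply

theorem inner_score (θ w : EuclideanSpace ℝ (Fin d)) :
    inner ℝ (score g σ Y v θ) w = fderiv ℝ (logLik g σ Y v) θ w :=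
  inner_gradient _ θ w

theorem score_apply (θ : EuclideanSpace ℝ (Fin d)) (i : Fin d) :
    score g σ Y v θ i = fderiv ℝ (logLik g σ Y v) θ (EuclideanSpace.single i 1) := by
  rw [← inner_score, EuclideanSpace.inner_single_right]; simp

theorem contDiff_logLogistic : ContDiff ℝ 2 logLogistic := by
  have h1 : ContDiff ℝ 2 Real.sigmoid := contDiff_sigmoid.of_le le_top
  have h2 : logLogistic = fun x => Real.log (Real.sigmoid x * (1 - Real.sigmoid x)) := by
    funext x; rw [logLogistic, logisticPDF_eq]
  rw [h2]
  refine (h1.mul (contDiff_const.sub h1)).log fun x => ?_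
  rw [← logisticPDF_eq]
  exact (logisticPDF_pos x).ne'

theorem logLik_eq (θ : EuclideanSpace ℝ (Fin d)) :
    logLik g σ Y v θ = -Real.log (σ Y θ) + logLogistic ((v - g Y θ) / σ Y θ) := rfl

theorem contDiffOn_logLik (hσ_pos : ∀ Y θ, 0 < σ Y θ) (hg : ContDiffOn ℝ 2 (g Y) U)
    (hσ : ContDiffOn ℝ 2 (σ Y) U) : ContDiffOn ℝ 2 (logLik g σ Y v) U := by
  have h1 : ContDiffOn ℝ 2 (fun θ => -Real.log (σ Y θ)) U :=
    (hσ.log fun θ _ => (hσ_pos Y θ).ne').neg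
  have h2 : ContDiffOn ℝ 2 (fun θ => (v - g Y θ) / σ Y θ) U :=
    (contDiffOn_const.sub hg).div hσ fun θ _ => (hσ_pos Y θ).ne'
  exact h1.add (contDiff_logLogistic.comp_contDiffOn h2)

theorem continuousOn_logLik {S : Set (EuclideanSpace ℝ (Fin d))} (hσ_pos : ∀ Y θ, 0 < σ Y θ)
    (hg : ContinuousOn (g Y) S) (hσ : ContinuousOn (σ Y) S) :
    ContinuousOn (logLik g σ Y v) S := by
  have h1 : ContinuousOn (fun θ => -Real.log (σ Y θ)) S :=
    (hσ.log fun θ _ => (hσ_pos Y θ).ne').neg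
  have h2 : ContinuousOn (fun θ => (v - g Y θ) / σ Y θ) S :=
    (continuousOn_const.sub hg).div hσ fun θ _ => (hσ_pos Y θ).ne'
  exact h1.add (contDiff_logLogistic.continuous.comp_continuousOn h2)

theorem measurable_logLik (hg : Measurable (Function.uncurry g))
    (hσ : Measurable (Function.uncurry σ)) (θ : EuclideanSpace ℝ (Fin d)) :
    Measurable fun z : (ℕ → ℝ) × ℝ => logLik g σ z.1 z.2 θ := by
  have h1 : Measurable fun z : (ℕ → ℝ) × ℝ => g z.1 θ :=
    hg.comp (measurable_fst.prodMk measurable_const)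
  have h2 : Measurable fun z : (ℕ → ℝ) × ℝ => σ z.1 θ :=
    hσ.comp (measurable_fst.prodMk measurable_const)
  exact (Real.measurable_log.comp h2).neg.add
    (contDiff_logLogistic.continuous.measurable.comp ((measurable_snd.sub h1).div h2))

theorem hasDerivAt_line (θ w : EuclideanSpace ℝ (Fin d)) (r : ℝ) :
    HasDerivAt (fun r : ℝ => θ + r • w) w r := by
  simpa using ((hasDerivAt_id r).smul_const w).const_add θ

/-- Both sides are derivatives at `0` of the restriction to the line `θ + r w`, which reduces the
claim to the one-dimensional formula. -/
theorem fderiv_logLik (hU : IsOpen U) (hσ_pos : ∀ Y θ, 0 < σ Y θ) (hg : ContDiffOn ℝ 2 (g Y) U)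
    (hσ : ContDiffOn ℝ 2 (σ Y) U) (hθ : θ ∈ U) (w : EuclideanSpace ℝ (Fin d)) :
    fderiv ℝ (logLik g σ Y v) θ w =
      fderiv ℝ (σ Y) θ w / σ Y θ * (h ((v - g Y θ) / σ Y θ) - 1) +
        fderiv ℝ (g Y) θ w / σ Y θ * (2 * Real.sigmoid ((v - g Y θ) / σ Y θ) - 1) := by
  have key : ∀ f : EuclideanSpace ℝ (Fin d) → ℝ, DifferentiableAt ℝ f θ →
      HasDerivAt (fun r : ℝ => f (θ + r • w)) (fderiv ℝ f θ w) 0 := by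
    intro f hf
    have h1 : HasFDerivAt f (fderiv ℝ f θ) (θ + (0 : ℝ) • w) := by simpa using hf.hasFDerivAt
    exact h1.comp_hasDerivAt (0 : ℝ) (hasDerivAt_line θ w 0)
  have h1 := key _ (differentiableAt_of_contDiffOn_two hU
    (contDiffOn_logLik (v := v) hσ_pos hg hσ) hθ)
  have h2 := hasDerivAt_logLik_curve (s := fun r : ℝ => σ Y (θ + r • w))
    (m := fun r : ℝ => g Y (θ + r • w)) (v := v) (a := 0) (hσ_pos _ _)
    (key _ (differentiableAt_of_contDiffOn_two hU hσ hθ))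
    (key _ (differentiableAt_of_contDiffOn_two hU hg hθ))
  have h3 := h1.unique h2
  simpa using h3

/-- The terms are grouped for conditioning on the past. With `e` the innovation, `h e - 1` and
`2F(e) - 1` are centred and so remove the second derivatives; what remains consists of squares with
nonnegative weights. -/
theorem bilin_hessMat_logLik (hU : IsOpen U) (hσ_pos : ∀ Y θ, 0 < σ Y θ)
    (hg : ContDiffOn ℝ 2 (g Y) U) (hσ : ContDiffOn ℝ 2 (σ Y) U) (hθ : θ ∈ U)
    (w : EuclideanSpace ℝ (Fin d)) {e : ℝ} (he : v = g Y θ + σ Y θ * e) :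
    bilin (hessMat (logLik g σ Y v) θ) w w =
      ((fderiv ℝ (σ Y) θ w / σ Y θ) ^ 2 - fderiv ℝ (fderiv ℝ (σ Y)) θ w w / σ Y θ) * (h e - 1) +
        (fderiv ℝ (σ Y) θ w / σ Y θ) ^ 2 * h e +
        2 * logisticPDF e *
          (fderiv ℝ (g Y) θ w / σ Y θ + e * (fderiv ℝ (σ Y) θ w / σ Y θ)) ^ 2 +
        (2 * Real.sigmoid e - 1) *
          (2 * (fderiv ℝ (σ Y) θ w / σ Y θ) * (fderiv ℝ (g Y) θ w / σ Y θ) -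
            fderiv ℝ (fderiv ℝ (g Y)) θ w w / σ Y θ) := by
  have key : ∀ f : EuclideanSpace ℝ (Fin d) → ℝ, DifferentiableAt ℝ f θ →
      HasDerivAt (fun r : ℝ => f (θ + r • w)) (fderiv ℝ f θ w) 0 := by
    intro f hf
    have h1 : HasFDerivAt f (fderiv ℝ f θ) (θ + (0 : ℝ) • w) := by simpa using hf.hasFDerivAt
    exact h1.comp_hasDerivAt (0 : ℝ) (hasDerivAt_line θ w 0)
  have key2 : ∀ f : EuclideanSpace ℝ (Fin d) → ℝ, ContDiffOn ℝ 2 f U →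
      HasDerivAt (fun r : ℝ => fderiv ℝ f (θ + r • w) w) (fderiv ℝ (fderiv ℝ f) θ w w) 0 := by
    intro f hf
    have h1 := key (fun θ' => fderiv ℝ f θ' w)
      ((differentiableAt_fderiv hU hf hθ).clm_apply (differentiableAt_const _))
    rwa [fderiv_fderiv_apply hU hf hθ] at h1
  have hL : ContDiffOn ℝ 2 (logLik g σ Y v) U := contDiffOn_logLik hσ_pos hg hσ
  have h1 := key2 _ hL
  have h2 := hasDerivAt_score_curve (s := fun r : ℝ => σ Y (θ + r • w))
    (m := fun r : ℝ => g Y (θ + r • w)) (s₁ := fun r : ℝ => fderiv ℝ (σ Y) (θ + r • w) w)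
    (m₁ := fun r : ℝ => fderiv ℝ (g Y) (θ + r • w) w) (v := v) (a := 0) (e := e) (hσ_pos _ _)
    (by simpa using key _ (differentiableAt_of_contDiffOn_two hU hσ hθ))
    (by simpa using key _ (differentiableAt_of_contDiffOn_two hU hg hθ))
    (key2 _ hσ) (key2 _ hg) (by
      have := hσ_pos Y θ
      simp only [zero_smul, add_zero]
      rw [he]; field_simp; ring)
  -- The score formula is available only on `U`, so it can be differentiated only for small `r`.
  have hev : ∀ᶠ r : ℝ in 𝓝 0, θ + r • w ∈ U := by
    have hc : ContinuousAt (fun r : ℝ => θ + r • w) 0 := (hasDerivAt_line θ w 0).continuousAt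
    exact hc.eventually_mem (hU.mem_nhds (by simpa using hθ))
  have h3 := h1.unique (h2.congr_of_eventuallyEq (by
    filter_upwards [hev] with r hr
    exact fderiv_logLik hU hσ_pos hg hσ hr w))
  rw [fderiv_fderiv_eq_neg_bilin hU hL hθ] at h3
  simpa using neg_inj.1 h3

end LogLik

end

section

/-! ### The model and the moments of the innovations. -/

/-- The assumptions on the model which do not involve the initial value and the estimator. -/
structure IsModel {Ω : Type*} [MeasurableSpace Ω] (P : Measure Ω) {d : ℕ}
    (g σ : (ℕ → ℝ) → EuclideanSpace ℝ (Fin d) → ℝ) (Θ : Set (EuclideanSpace ℝ (Fin d)))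
    (θ₀ : EuclideanSpace ℝ (Fin d)) (y η : ℤ → Ω → ℝ) : Prop where
  g_meas : Measurable (Function.uncurry g)
  σ_meas : Measurable (Function.uncurry σ)
  σ_pos : ∀ Y θ, 0 < σ Y θ
  y_meas : ∀ t, Measurable (y t)
  η_meas : ∀ t, Measurable (η t)
  model : ∀ t, ∀ᵐ ω ∂P, y t ω = g (past y t ω) θ₀ + σ (past y t ω) θ₀ * η t ω
  η_past : ∀ t, IndepFun (η t) (past y t) P
  compact : IsCompact Θ
  η_ident : ∀ t u, IdentDistrib (η t) (η u) P P
  η_symm : ∀ t, IdentDistrib (η t) (fun ω => -η t ω) P P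
  η_psi : ∀ t, ∫ ω, h (η t ω) ∂P = 1
  erg : StationaryErgodic P y
  σ_low : ∃ σlow : ℝ, 0 < σlow ∧ ∀ t, ∀ θ ∈ Θ, ∀ᵐ ω ∂P, σlow < σ (past y t ω) θ
  cont : ∀ Y, ContinuousOn (g Y) Θ ∧ ContinuousOn (σ Y) Θ
  ident : ∀ t, ∀ θ ∈ Θ,
    (∀ᵐ ω ∂P, g (past y t ω) θ = g (past y t ω) θ₀ ∧ σ (past y t ω) θ = σ (past y t ω) θ₀) ↔
      θ = θ₀
  mom : ∃ ι : ℝ, 0 < ι ∧ ∀ t,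
    ∫⁻ ω, (⨆ θ ∈ Θ, ENNReal.ofReal (|g (past y t ω) θ| ^ ι)) ∂P
      + ∫⁻ ω, ENNReal.ofReal (σ (past y t ω) θ₀ ^ ι) ∂P < ∞
  interior : θ₀ ∈ interior Θ
  η_two : ∀ t, ∫⁻ ω, ENNReal.ofReal ((h (η t ω) - 1) ^ 2) ∂P < ∞
  C2 : ∀ Y, ContDiffOn ℝ 2 (g Y) (_root_.interior Θ) ∧ ContDiffOn ℝ 2 (σ Y) (_root_.interior Θ)
  rank : ∀ t,
    (¬ ∃ x : EuclideanSpace ℝ (Fin d), x ≠ 0 ∧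
      ∀ᵐ ω ∂P, inner ℝ x (gradient (fun θ => σ (past y t ω) θ ^ 2) θ₀) = 0) ∨
    (¬ ∃ x : EuclideanSpace ℝ (Fin d), x ≠ 0 ∧
      ∀ᵐ ω ∂P, inner ℝ x (gradient (g (past y t ω)) θ₀) = 0)
  hess : ∃ κ : ℝ, 0 < κ ∧ ∀ t,
    ∫⁻ ω, (⨆ θ ∈ Metric.closedBall θ₀ κ, ‖negHess g σ (past y t ω) (y t ω) θ‖ₑ) ∂P < ∞

namespace IsModel

variable {Ω : Type*} [MeasurableSpace Ω] {P : Measure Ω} [IsProbabilityMeasure P] {d : ℕ}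
  {g σ : (ℕ → ℝ) → EuclideanSpace ℝ (Fin d) → ℝ} {Θ : Set (EuclideanSpace ℝ (Fin d))}
  {θ₀ : EuclideanSpace ℝ (Fin d)} {y η : ℤ → Ω → ℝ}

section Innovations

/-- The integral of a non-integrable function is `0` by convention, whereas this one equals `1`. -/
theorem integrable_h (M : IsModel P g σ Θ θ₀ y η) (t : ℤ) :
    Integrable (fun ω => h (η t ω)) P := by
  by_contra hcon
  have := M.η_psi t
  rw [integral_undef hcon] at this
  norm_num at this

theorem integrable_η (M : IsModel P g σ Θ θ₀ y η) (t : ℤ) : Integrable (η t) P := by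
  obtain ⟨K, hK, hKx⟩ := exists_abs_le_one_add_mul_h
  refine ((integrable_const (1 : ℝ)).add ((M.integrable_h t).const_mul K)).mono'
    (M.η_meas t).aestronglyMeasurable (ae_of_all _ fun ω => hKx _)

theorem memLp_h_sub_one (M : IsModel P g σ Θ θ₀ y η) (t : ℤ) :
    MemLp (fun ω => h (η t ω) - 1) 2 P := by
  have hm : Measurable fun ω => h (η t ω) - 1 :=
    (continuous_h.measurable.comp (M.η_meas t)).sub_const 1
  rw [memLp_two_iff_integrable_sq hm.aestronglyMeasurable]
  refine ⟨(hm.pow_const 2).aestronglyMeasurable, ?_⟩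
  rw [hasFiniteIntegral_iff_ofReal (ae_of_all _ fun ω => sq_nonneg _)]
  exact M.η_two t

theorem integral_odd (M : IsModel P g σ Θ θ₀ y η) (t : ℤ) {φ : ℝ → ℝ} (hφ : Measurable φ)
    (hodd : ∀ x, φ (-x) = -φ x) : ∫ ω, φ (η t ω) ∂P = 0 := by
  have h1 : ∫ ω, φ (η t ω) ∂P = ∫ ω, φ (-η t ω) ∂P :=
    ((M.η_symm t).comp hφ).integral_eq
  simp only [hodd, integral_neg] at h1
  linarith

theorem measurable_weight : Measurable fun e : ℝ => 2 * Real.sigmoid e - 1 :=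
  ((continuous_const.mul continuous_sigmoid).sub continuous_const).measurable

theorem abs_weight_le (e : ℝ) : |2 * Real.sigmoid e - 1| ≤ 1 :=
  abs_le.2 ⟨by linarith [Real.sigmoid_pos e], by linarith [Real.sigmoid_lt_one e]⟩

theorem integral_weight (M : IsModel P g σ Θ θ₀ y η) (t : ℤ) :
    ∫ ω, (2 * Real.sigmoid (η t ω) - 1) ∂P = 0 :=
  M.integral_odd t measurable_weight fun x => by rw [Real.sigmoid_neg]; ring

theorem integrable_weight (M : IsModel P g σ Θ θ₀ y η) (t : ℤ) :
    Integrable (fun ω => 2 * Real.sigmoid (η t ω) - 1) P :=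
  Integrable.of_bound (measurable_weight.comp (M.η_meas t)).aestronglyMeasurable 1
    (ae_of_all _ fun ω => abs_weight_le _)

/-- The exponential decay of the density beats `e²`, as `1 + x + x² / 2 ≤ exp x` for `x = |e|`. The
density-weighted moments in the Hessian are thus finite whatever the tails of `η`. -/
theorem logisticPDF_mul_sq_le (e : ℝ) : logisticPDF e * e ^ 2 ≤ 2 := by
  have h1 : e ^ 2 * Real.exp (-e) ≤ 2 * (1 + Real.exp (-e)) ^ 2 := by
    rcases le_total 0 e with he | he
    · have h2 := Real.quadratic_le_exp_of_nonneg he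
      have h3 : Real.exp (-e) * Real.exp e = 1 := by rw [← Real.exp_add]; simp
      have h4 : e ^ 2 * Real.exp (-e) ≤ 2 * Real.exp e * Real.exp (-e) := by
        gcongr; nlinarith
      nlinarith [Real.exp_pos (-e)]
    · have h2 := Real.quadratic_le_exp_of_nonneg (neg_nonneg.2 he)
      have h4 : e ^ 2 * Real.exp (-e) ≤ 2 * Real.exp (-e) * Real.exp (-e) := by
        gcongr; nlinarith
      nlinarith [Real.exp_pos (-e)]
  rw [logisticPDF, div_mul_eq_mul_div, div_le_iff₀ (by positivity)]
  linarith

theorem integrable_logisticPDF_mul (M : IsModel P g σ Θ θ₀ y η) (t : ℤ) (k : ℕ) (hk : k ≤ 2) :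
    Integrable (fun ω => logisticPDF (η t ω) * η t ω ^ k) P := by
  have hm : Measurable fun e : ℝ => logisticPDF e * e ^ k :=
    (continuous_logisticPDF.mul (continuous_pow k)).measurable
  refine Integrable.of_bound (hm.comp (M.η_meas t)).aestronglyMeasurable 3
    (ae_of_all _ fun ω => ?_)
  have h0 := logisticPDF_pos (η t ω)
  have h1 := logisticPDF_le_one (η t ω)
  have h2 := logisticPDF_mul_sq_le (η t ω)
  rw [Real.norm_eq_abs, abs_mul, abs_of_pos h0, abs_pow]
  have h3 : |η t ω| ^ k ≤ 1 + η t ω ^ 2 := by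
    rw [← sq_abs (η t ω)]
    have := abs_nonneg (η t ω)
    interval_cases k <;> nlinarith [sq_nonneg (|η t ω| - 1)]
  nlinarith

/-- The conditional expectation of the Hessian in a direction, given the past, as a function of the
normalized directional derivatives. -/
theorem integral_hess_form (M : IsModel P g σ Θ θ₀ y η) (t : ℤ) (a a₂ b b₂ : ℝ) :
    ∫ ω, ((a ^ 2 - a₂) * (h (η t ω) - 1) + a ^ 2 * h (η t ω) +
        2 * logisticPDF (η t ω) * (b + η t ω * a) ^ 2 +
        (2 * Real.sigmoid (η t ω) - 1) * (2 * a * b - b₂)) ∂P =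
      a ^ 2 * (1 + 2 * ∫ ω, logisticPDF (η t ω) * η t ω ^ 2 ∂P) +
        b ^ 2 * (2 * ∫ ω, logisticPDF (η t ω) ∂P) := by
  have i0 := M.integrable_h t
  have i1 := M.integrable_weight t
  have i2 := M.integrable_logisticPDF_mul t 0 (by norm_num)
  have i3 := M.integrable_logisticPDF_mul t 1 (by norm_num)
  have i4 := M.integrable_logisticPDF_mul t 2 le_rfl
  simp only [pow_zero, mul_one, pow_one] at i2 i3
  have e3 : ∫ ω, logisticPDF (η t ω) * η t ω ∂P = 0 :=
    M.integral_odd t (φ := fun e => logisticPDF e * e)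
      (continuous_logisticPDF.mul continuous_id).measurable
      fun x => by rw [logisticPDF_neg]; ring
  -- Expansion into functions of `η` with known means; the cross term `f(η) η` and the weight `2F(η)
  -- - 1` are odd and vanish by symmetry.
  have hsplit : ∀ ω, (a ^ 2 - a₂) * (h (η t ω) - 1) + a ^ 2 * h (η t ω) +
        2 * logisticPDF (η t ω) * (b + η t ω * a) ^ 2 +
        (2 * Real.sigmoid (η t ω) - 1) * (2 * a * b - b₂) =
      (2 * a ^ 2 - a₂) * h (η t ω) + (-(a ^ 2 - a₂)) + (2 * b ^ 2) * logisticPDF (η t ω) +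
        (4 * a * b) * (logisticPDF (η t ω) * η t ω) +
        (2 * a ^ 2) * (logisticPDF (η t ω) * η t ω ^ 2) +
        (2 * a * b - b₂) * (2 * Real.sigmoid (η t ω) - 1) := fun ω => by ring
  simp only [hsplit]
  have j0 := i0.const_mul (2 * a ^ 2 - a₂)
  have jc : Integrable (fun _ : Ω => (-(a ^ 2 - a₂))) P := integrable_const _
  have j2 := i2.const_mul (2 * b ^ 2)
  have j3 := i3.const_mul (4 * a * b)
  have j4 := i4.const_mul (2 * a ^ 2)
  have j1 := i1.const_mul (2 * a * b - b₂)
  have k1 := j0.fun_add jc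
  have k2 := k1.fun_add j2
  have k3 := k2.fun_add j3
  rw [integral_add (k3.fun_add j4) j1, integral_add k3 j4, integral_add k2 j3,
    integral_add k1 j2, integral_add j0 jc]
  simp only [integral_const_mul, M.η_psi t, e3, M.integral_weight t, integral_const,
    probReal_univ, one_smul]
  ring

end Innovations

/-! ### Directional scores: square integrability, orthogonality, positivity of the expected Hessian.
-/

section Directions

/-- The derivative of `f Y` in the direction `w`, divided by the scale. -/
def normDir (f σ : (ℕ → ℝ) → EuclideanSpace ℝ (Fin d) → ℝ) (θ₀ w : EuclideanSpace ℝ (Fin d))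
    (Y : ℕ → ℝ) : ℝ := fderiv ℝ (f Y) θ₀ w / σ Y θ₀

/-- The score in the direction `w`, as a function of past and present. -/
def dirScore (g σ : (ℕ → ℝ) → EuclideanSpace ℝ (Fin d) → ℝ) (θ₀ w : EuclideanSpace ℝ (Fin d))
    (z : (ℕ → ℝ) × ℝ) : ℝ := fderiv ℝ (logLik g σ z.1 z.2) θ₀ w

variable {θ : EuclideanSpace ℝ (Fin d)}

theorem measurable_g (M : IsModel P g σ Θ θ₀ y η) (θ : EuclideanSpace ℝ (Fin d)) :
    Measurable fun Y => g Y θ :=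
  M.g_meas.comp (measurable_id.prodMk measurable_const)

theorem measurable_σ (M : IsModel P g σ Θ θ₀ y η) (θ : EuclideanSpace ℝ (Fin d)) :
    Measurable fun Y => σ Y θ :=
  M.σ_meas.comp (measurable_id.prodMk measurable_const)

theorem contDiffOn_ℓ (M : IsModel P g σ Θ θ₀ y η) (Y : ℕ → ℝ) (v : ℝ) :
    ContDiffOn ℝ 2 (logLik g σ Y v) (_root_.interior Θ) :=
  contDiffOn_logLik M.σ_pos (M.C2 Y).1 (M.C2 Y).2

theorem measurable_normDir_g (M : IsModel P g σ Θ θ₀ y η) (w : EuclideanSpace ℝ (Fin d)) :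
    Measurable (normDir g σ θ₀ w) :=
  (measurable_fderiv_apply isOpen_interior (fun θ _ => M.measurable_g θ)
    (fun Y _ hθ => differentiableAt_of_contDiffOn_two isOpen_interior (M.C2 Y).1 hθ)
    M.interior w).div (M.measurable_σ θ₀)

theorem measurable_normDir_σ (M : IsModel P g σ Θ θ₀ y η) (w : EuclideanSpace ℝ (Fin d)) :
    Measurable (normDir σ σ θ₀ w) :=
  (measurable_fderiv_apply isOpen_interior (fun θ _ => M.measurable_σ θ)
    (fun Y _ hθ => differentiableAt_of_contDiffOn_two isOpen_interior (M.C2 Y).2 hθ)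
    M.interior w).div (M.measurable_σ θ₀)

theorem measurable_second {f : (ℕ → ℝ) → EuclideanSpace ℝ (Fin d) → ℝ}
    (M : IsModel P g σ Θ θ₀ y η) (hf : ∀ θ, Measurable fun Y => f Y θ)
    (hf2 : ∀ Y, ContDiffOn ℝ 2 (f Y) (_root_.interior Θ)) (w : EuclideanSpace ℝ (Fin d)) :
    Measurable fun Y => fderiv ℝ (fderiv ℝ (f Y)) θ₀ w w / σ Y θ₀ := by
  refine Measurable.div ?_ (M.measurable_σ θ₀)
  have h1 : ∀ Y, fderiv ℝ (fderiv ℝ (f Y)) θ₀ w w = -bilin (hessMat (f Y) θ₀) w w := fun Y =>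
    fderiv_fderiv_eq_neg_bilin isOpen_interior (hf2 Y) M.interior w w
  simp only [h1, bilin]
  refine (Finset.measurable_sum _ fun i _ => Finset.measurable_sum _ fun j _ => ?_).neg
  exact ((measurable_hessMat isOpen_interior (fun θ _ => hf θ) hf2 M.interior i j).const_mul
    _).mul_const _

theorem measurable_hess_entry (M : IsModel P g σ Θ θ₀ y η) (hθ : θ ∈ _root_.interior Θ)
    (i j : Fin d) :
    Measurable fun z : (ℕ → ℝ) × ℝ => hessMat (logLik g σ z.1 z.2) θ i j :=
  measurable_hessMat isOpen_interior
    (fun θ _ => measurable_logLik M.g_meas M.σ_meas θ)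
    (fun z => M.contDiffOn_ℓ z.1 z.2) hθ i j

theorem measurable_dirScore (M : IsModel P g σ Θ θ₀ y η) (w : EuclideanSpace ℝ (Fin d)) :
    Measurable (dirScore g σ θ₀ w) :=
  measurable_fderiv_apply isOpen_interior
    (fun θ _ => measurable_logLik M.g_meas M.σ_meas θ)
    (fun z _ hθ => differentiableAt_of_contDiffOn_two isOpen_interior (M.contDiffOn_ℓ z.1 z.2) hθ)
    M.interior w

theorem integrable_hess_entry (M : IsModel P g σ Θ θ₀ y η) (t : ℤ) (i j : Fin d) :
    Integrable (fun ω => hessMat (logLik g σ (past y t ω) (y t ω)) θ₀ i j) P := by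
  obtain ⟨κ, hκ, hfin⟩ := M.hess
  refine ⟨((M.measurable_hess_entry M.interior i j).comp
    (measurable_obs M.y_meas t)).aestronglyMeasurable, ?_⟩
  refine lt_of_le_of_lt (lintegral_mono fun ω => ?_) (hfin t)
  refine le_trans ?_ (le_iSup₂_of_le θ₀ (Metric.mem_closedBall_self hκ.le) le_rfl)
  exact enorm_le_iff_norm_le.2 (abs_entry_le _ i j)

theorem integrable_bilin_hess (M : IsModel P g σ Θ θ₀ y η) (t : ℤ)
    (u w : EuclideanSpace ℝ (Fin d)) :
    Integrable (fun ω => bilin (hessMat (logLik g σ (past y t ω) (y t ω)) θ₀) u w) P := by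
  unfold bilin
  exact integrable_finsetSum _ fun i _ => integrable_finsetSum _ fun j _ =>
    ((M.integrable_hess_entry t i j).const_mul _).mul_const _

theorem map_past_η (M : IsModel P g σ Θ θ₀ y η) (t : ℤ) :
    P.map (fun ω => (past y t ω, η t ω)) = (P.map (past y t)).prod (P.map (η t)) :=
  (indepFun_iff_map_prod_eq_prod_map_map (measurable_past M.y_meas t).aemeasurable
    (M.η_meas t).aemeasurable).1 (M.η_past t).symm

/-- The second moments of the normalized directional derivatives are finite, and determine the
expected Hessian. -/
theorem integrable_sq_normDir (M : IsModel P g σ Θ θ₀ y η) (t : ℤ)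
    (w : EuclideanSpace ℝ (Fin d)) :
    Integrable (fun ω => normDir σ σ θ₀ w (past y t ω) ^ 2) P ∧
    Integrable (fun ω => normDir g σ θ₀ w (past y t ω) ^ 2) P ∧
    ∃ c₁ c₂ : ℝ, 0 < c₁ ∧ 0 < c₂ ∧
      ∫ ω, bilin (hessMat (logLik g σ (past y t ω) (y t ω)) θ₀) w w ∂P =
        c₁ * ∫ ω, normDir σ σ θ₀ w (past y t ω) ^ 2 ∂P +
          c₂ * ∫ ω, normDir g σ θ₀ w (past y t ω) ^ 2 ∂P := by
  set c₁ : ℝ := 1 + 2 * ∫ ω, logisticPDF (η t ω) * η t ω ^ 2 ∂P with hc₁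
  set c₂ : ℝ := 2 * ∫ ω, logisticPDF (η t ω) ∂P with hc₂
  have hc₁0 : 0 < c₁ := by
    have : 0 ≤ ∫ ω, logisticPDF (η t ω) * η t ω ^ 2 ∂P :=
      integral_nonneg fun ω => mul_nonneg (logisticPDF_pos _).le (sq_nonneg _)
    linarith
  have hc₂0 : 0 < c₂ := by
    have hi := M.integrable_logisticPDF_mul t 0 (by norm_num)
    simp only [pow_zero, mul_one] at hi
    have : 0 < ∫ ω, logisticPDF (η t ω) ∂P := by
      rw [integral_pos_iff_support_of_nonneg (fun ω => (logisticPDF_pos _).le) hi]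
      have : Function.support (fun ω => logisticPDF (η t ω)) = Set.univ :=
        Set.eq_univ_of_forall fun ω => (logisticPDF_pos _).ne'
      rw [this]; simp
    linarith
  let a := normDir σ σ θ₀ w
  let b := normDir g σ θ₀ w
  let a₂ : (ℕ → ℝ) → ℝ := fun Y => fderiv ℝ (fderiv ℝ (σ Y)) θ₀ w w / σ Y θ₀
  let b₂ : (ℕ → ℝ) → ℝ := fun Y => fderiv ℝ (fderiv ℝ (g Y)) θ₀ w w / σ Y θ₀
  have ha : Measurable a := M.measurable_normDir_σ w
  have hb : Measurable b := M.measurable_normDir_g w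
  have ha₂ : Measurable a₂ := M.measurable_second M.measurable_σ (fun Y => (M.C2 Y).2) w
  have hb₂ : Measurable b₂ := M.measurable_second M.measurable_g (fun Y => (M.C2 Y).1) w
  let Φ : (ℕ → ℝ) × ℝ → ℝ := fun z => (a z.1 ^ 2 - a₂ z.1) * (h z.2 - 1) + a z.1 ^ 2 * h z.2 +
        2 * logisticPDF z.2 * (b z.1 + z.2 * a z.1) ^ 2 +
        (2 * Real.sigmoid z.2 - 1) * (2 * a z.1 * b z.1 - b₂ z.1)
  have hΦ : Measurable Φ := by
    have hh : Measurable fun z : (ℕ → ℝ) × ℝ => h z.2 := continuous_h.measurable.comp measurable_snd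
    have hf : Measurable fun z : (ℕ → ℝ) × ℝ => logisticPDF z.2 :=
      continuous_logisticPDF.measurable.comp measurable_snd
    have hs : Measurable fun z : (ℕ → ℝ) × ℝ => Real.sigmoid z.2 :=
      continuous_sigmoid.measurable.comp measurable_snd
    fun_prop
  have hΦeq : (fun ω => bilin (hessMat (logLik g σ (past y t ω) (y t ω)) θ₀) w w) =ᵐ[P]
      fun ω => Φ (past y t ω, η t ω) := by
    filter_upwards [M.model t] with ω hω
    exact bilin_hessMat_logLik isOpen_interior M.σ_pos (M.C2 _).1 (M.C2 _).2 M.interior w hω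
  have hpair : Measurable fun ω => (past y t ω, η t ω) :=
    (measurable_past M.y_meas t).prodMk (M.η_meas t)
  have : IsProbabilityMeasure (P.map (past y t)) :=
    Measure.isProbabilityMeasure_map (measurable_past M.y_meas t).aemeasurable
  have : IsProbabilityMeasure (P.map (η t)) :=
    Measure.isProbabilityMeasure_map (M.η_meas t).aemeasurable
  have hΦi : Integrable Φ ((P.map (past y t)).prod (P.map (η t))) := by
    rw [← M.map_past_η t, integrable_map_measure hΦ.aestronglyMeasurable hpair.aemeasurable]
    exact (M.integrable_bilin_hess t w w).congr hΦeq
  have hinner : ∀ Y, ∫ e, Φ (Y, e) ∂(P.map (η t)) = a Y ^ 2 * c₁ + b Y ^ 2 * c₂ := by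
    intro Y
    have hs : Measurable fun e => Φ (Y, e) := hΦ.comp measurable_prodMk_left
    rw [integral_map (M.η_meas t).aemeasurable hs.aestronglyMeasurable]
    exact M.integral_hess_form t (a Y) (a₂ Y) (b Y) (b₂ Y)
  -- By independence the law of past and innovation is a product, so Fubini makes the conditional
  -- mean `c₁ a² + c₂ b²` integrable. Both summands are nonnegative, so each is integrable: first
  -- moments of the Hessian give second moments of the gradients.
  have hi := hΦi.integral_prod_left
  simp only [hinner] at hi
  rw [integrable_map_measure (by fun_prop) (measurable_past M.y_meas t).aemeasurable] at hi
  have hap := ha.comp (measurable_past M.y_meas t)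
  have hbp := hb.comp (measurable_past M.y_meas t)
  have i1 : Integrable (fun ω => a (past y t ω) ^ 2) P := by
    refine (hi.const_mul c₁⁻¹).mono' (hap.pow_const 2).aestronglyMeasurable
      (ae_of_all _ fun ω => ?_)
    rw [Real.norm_of_nonneg (sq_nonneg _), inv_mul_eq_div, le_div_iff₀ hc₁0]
    simp only [Function.comp_apply]
    have := mul_nonneg (sq_nonneg (b (past y t ω))) hc₂0.le
    linarith
  have i2 : Integrable (fun ω => b (past y t ω) ^ 2) P := by
    refine (hi.const_mul c₂⁻¹).mono' (hbp.pow_const 2).aestronglyMeasurable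
      (ae_of_all _ fun ω => ?_)
    rw [Real.norm_of_nonneg (sq_nonneg _), inv_mul_eq_div, le_div_iff₀ hc₂0]
    simp only [Function.comp_apply]
    have := mul_nonneg (sq_nonneg (a (past y t ω))) hc₁0.le
    linarith
  refine ⟨i1, i2, c₁, c₂, hc₁0, hc₂0, ?_⟩
  rw [integral_congr_ae hΦeq, ← integral_map hpair.aemeasurable hΦ.aestronglyMeasurable,
    M.map_past_η t, integral_prod _ hΦi]
  simp only [hinner]
  rw [integral_map (measurable_past M.y_meas t).aemeasurable (by fun_prop),
    integral_add (i1.mul_const _) (i2.mul_const _), integral_mul_const, integral_mul_const]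
  ring

theorem memLp_normDir_σ (M : IsModel P g σ Θ θ₀ y η) (t : ℤ) (w : EuclideanSpace ℝ (Fin d)) :
    MemLp (fun ω => normDir σ σ θ₀ w (past y t ω)) 2 P :=
  (memLp_two_iff_integrable_sq ((M.measurable_normDir_σ w).comp
    (measurable_past M.y_meas t)).aestronglyMeasurable).2 (M.integrable_sq_normDir t w).1

theorem memLp_normDir_g (M : IsModel P g σ Θ θ₀ y η) (t : ℤ) (w : EuclideanSpace ℝ (Fin d)) :
    MemLp (fun ω => normDir g σ θ₀ w (past y t ω)) 2 P :=
  (memLp_two_iff_integrable_sq ((M.measurable_normDir_g w).comp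
    (measurable_past M.y_meas t)).aestronglyMeasurable).2 (M.integrable_sq_normDir t w).2.1

/-- At the true parameter the standardized residual is the innovation, so each term is a function of
the past times a centred function of `η`. -/
theorem dirScore_eq (M : IsModel P g σ Θ θ₀ y η) (t : ℤ) (w : EuclideanSpace ℝ (Fin d)) :
    (fun ω => dirScore g σ θ₀ w (obs y t ω)) =ᵐ[P] fun ω =>
      normDir σ σ θ₀ w (past y t ω) * (h (η t ω) - 1) +
        normDir g σ θ₀ w (past y t ω) * (2 * Real.sigmoid (η t ω) - 1) := by
  filter_upwards [M.model t] with ω hω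
  have hpos := M.σ_pos (past y t ω) θ₀
  have he : (y t ω - g (past y t ω) θ₀) / σ (past y t ω) θ₀ = η t ω := by
    rw [hω]; field_simp; ring
  have := fderiv_logLik (v := y t ω) isOpen_interior M.σ_pos (M.C2 (past y t ω)).1
    (M.C2 (past y t ω)).2 M.interior w
  rw [he] at this
  exact this

theorem indepFun_past (M : IsModel P g σ Θ θ₀ y η) (t : ℤ) {φ : (ℕ → ℝ) → ℝ} {ψ : ℝ → ℝ}
    (hφ : Measurable φ) (hψ : Measurable ψ) :
    IndepFun (fun ω => φ (past y t ω)) (fun ω => ψ (η t ω)) P :=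
  (M.η_past t).symm.comp hφ hψ

/-- The squares of the two factors are integrable and independent, so their product is integrable
and no fourth moments enter. -/
theorem memLp_scale_term (M : IsModel P g σ Θ θ₀ y η) (t : ℤ) (w : EuclideanSpace ℝ (Fin d)) :
    MemLp (fun ω => normDir σ σ θ₀ w (past y t ω) * (h (η t ω) - 1)) 2 P := by
  have h1 := M.memLp_normDir_σ t w
  have h2 := M.memLp_h_sub_one t
  rw [memLp_two_iff_integrable_sq (h1.1.fun_mul h2.1)]
  have hh : Measurable fun e => (h e - 1) ^ 2 :=
    (continuous_h.measurable.sub_const 1).pow_const 2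
  have := (M.indepFun_past t ((M.measurable_normDir_σ w).pow_const 2) hh).integrable_mul
    h1.integrable_sq h2.integrable_sq
  refine this.congr (ae_of_all _ fun ω => ?_)
  simp only [Pi.mul_apply]
  ring

theorem memLp_mean_term (M : IsModel P g σ Θ θ₀ y η) (t : ℤ) (w : EuclideanSpace ℝ (Fin d)) :
    MemLp (fun ω => normDir g σ θ₀ w (past y t ω) * (2 * Real.sigmoid (η t ω) - 1)) 2 P := by
  have h1 := M.memLp_normDir_g t w
  refine h1.mono (h1.1.mul (measurable_weight.comp (M.η_meas t)).aestronglyMeasurable)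
    (ae_of_all _ fun ω => ?_)
  rw [norm_mul]
  exact mul_le_of_le_one_right (norm_nonneg _) (abs_weight_le _)

theorem memLp_dirScore (M : IsModel P g σ Θ θ₀ y η) (t : ℤ) (w : EuclideanSpace ℝ (Fin d)) :
    MemLp (fun ω => dirScore g σ θ₀ w (obs y t ω)) 2 P :=
  ((M.memLp_scale_term t w).add (M.memLp_mean_term t w)).ae_eq (M.dirScore_eq t w).symm

/-- The scores form a martingale difference sequence; in particular they are uncorrelated. -/
theorem integral_mul_dirScore (M : IsModel P g σ Θ θ₀ y η) (t : ℤ)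
    (w : EuclideanSpace ℝ (Fin d)) {ψ : (ℕ → ℝ) → ℝ} (hψ : Measurable ψ)
    (hψ2 : MemLp (fun ω => ψ (past y t ω)) 2 P) :
    ∫ ω, ψ (past y t ω) * dirScore g σ θ₀ w (obs y t ω) ∂P = 0 := by
  have h1 : ∫ ω, ψ (past y t ω) * dirScore g σ θ₀ w (obs y t ω) ∂P =
      ∫ ω, (ψ (past y t ω) * normDir σ σ θ₀ w (past y t ω) * (h (η t ω) - 1) +
        ψ (past y t ω) * normDir g σ θ₀ w (past y t ω) *
          (2 * Real.sigmoid (η t ω) - 1)) ∂P := by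
    refine integral_congr_ae ?_
    filter_upwards [M.dirScore_eq t w] with ω hω
    rw [hω]; ring
  have i1 : Integrable (fun ω => ψ (past y t ω) * normDir σ σ θ₀ w (past y t ω) *
      (h (η t ω) - 1)) P :=
    (hψ2.integrable_mul (M.memLp_scale_term t w)).congr (ae_of_all _ fun ω => by
      simp only [Pi.mul_apply]; ring)
  have i2 : Integrable (fun ω => ψ (past y t ω) * normDir g σ θ₀ w (past y t ω) *
      (2 * Real.sigmoid (η t ω) - 1)) P :=
    (hψ2.integrable_mul (M.memLp_mean_term t w)).congr (ae_of_all _ fun ω => by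
      simp only [Pi.mul_apply]; ring)
  have hh : Measurable fun e => h e - 1 := continuous_h.measurable.sub_const 1
  have hp := measurable_past M.y_meas t
  have e1 : ∫ ω, (h (η t ω) - 1) ∂P = 0 := by
    rw [integral_sub (M.integrable_h t) (integrable_const _), M.η_psi t]; simp
  have z1 :=
    (M.indepFun_past t (hψ.mul (M.measurable_normDir_σ w)) hh).integral_fun_mul_eq_mul_integral
    ((hψ.mul (M.measurable_normDir_σ w)).comp hp).aestronglyMeasurable
    (hh.comp (M.η_meas t)).aestronglyMeasurable
  have z2 := (M.indepFun_past t (hψ.mul (M.measurable_normDir_g w))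
    measurable_weight).integral_fun_mul_eq_mul_integral
    ((hψ.mul (M.measurable_normDir_g w)).comp hp).aestronglyMeasurable
    (measurable_weight.comp (M.η_meas t)).aestronglyMeasurable
  rw [e1, mul_zero] at z1
  rw [M.integral_weight t, mul_zero] at z2
  simp only [Pi.mul_apply] at z1 z2
  rw [h1, integral_add i1 i2, z1, z2, add_zero]

/-- An earlier observation, read off a later past. -/
def pastObs (k : ℕ) (Y : ℕ → ℝ) : (ℕ → ℝ) × ℝ := (fun j => Y (k + 1 + j), Y k)

theorem measurable_pastObs (k : ℕ) : Measurable (pastObs k) :=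
  (measurable_pi_lambda _ fun _ => measurable_pi_apply _).prodMk (measurable_pi_apply _)

theorem pastObs_past (y : ℤ → Ω → ℝ) (k : ℕ) (t : ℤ) (ω : Ω) :
    pastObs k (past y t ω) = obs y (t - 1 - k) ω := by
  simp only [pastObs, past, obs, Prod.mk.injEq, and_true]
  funext j
  congr 1
  push_cast
  ring

/-- Earlier scores are functions of the later past, so the cross term vanishes by orthogonality, and
stationarity equates the squares. -/
theorem integral_sq_sum_dirScore (M : IsModel P g σ Θ θ₀ y η) (w : EuclideanSpace ℝ (Fin d))
    (n : ℕ) :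
    ∫ ω, (∑ t ∈ Finset.Icc 1 n, dirScore g σ θ₀ w (obs y t ω)) ^ 2 ∂P =
      n * ∫ ω, dirScore g σ θ₀ w (obs y 0 ω) ^ 2 ∂P := by
  induction n with
  | zero => simp
  | succ n ih =>
    have hS : MemLp (fun ω => ∑ t ∈ Finset.Icc 1 n, dirScore g σ θ₀ w (obs y t ω)) 2 P :=
      memLp_finsetSum _ fun t _ => M.memLp_dirScore t w
    have hs := M.memLp_dirScore ((n + 1 : ℕ) : ℤ) w
    -- Seen from time `n + 1`, the observation at time `t` sits at position `n - t` of the past.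
    let ψ : (ℕ → ℝ) → ℝ := fun Y =>
      ∑ t ∈ Finset.Icc 1 n, dirScore g σ θ₀ w (pastObs (n - t) Y)
    have hψ : Measurable ψ := Finset.measurable_sum _ fun t _ =>
      (M.measurable_dirScore w).comp (measurable_pastObs _)
    have hψeq : ∀ ω, ψ (past y ((n + 1 : ℕ) : ℤ) ω) =
        ∑ t ∈ Finset.Icc 1 n, dirScore g σ θ₀ w (obs y t ω) := by
      intro ω
      refine Finset.sum_congr rfl fun t ht => ?_
      rw [pastObs_past]
      congr 2
      have := (Finset.mem_Icc.1 ht).2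
      omega
    have hz := M.integral_mul_dirScore ((n + 1 : ℕ) : ℤ) w hψ (by simpa only [hψeq] using hS)
    simp only [hψeq] at hz
    have hsq : ∫ ω, dirScore g σ θ₀ w (obs y ((n + 1 : ℕ) : ℤ) ω) ^ 2 ∂P =
        ∫ ω, dirScore g σ θ₀ w (obs y 0 ω) ^ 2 ∂P :=
      integral_obs_eq M.y_meas M.erg _ ((M.measurable_dirScore w).pow_const 2)
    have hexp : ∀ ω, (∑ t ∈ Finset.Icc 1 (n + 1), dirScore g σ θ₀ w (obs y t ω)) ^ 2 =
        (∑ t ∈ Finset.Icc 1 n, dirScore g σ θ₀ w (obs y t ω)) ^ 2 +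
        2 * ((∑ t ∈ Finset.Icc 1 n, dirScore g σ θ₀ w (obs y t ω)) *
          dirScore g σ θ₀ w (obs y ((n + 1 : ℕ) : ℤ) ω)) +
        dirScore g σ θ₀ w (obs y ((n + 1 : ℕ) : ℤ) ω) ^ 2 := by
      intro ω
      rw [Finset.sum_Icc_succ_top (by omega)]
      ring
    simp only [hexp]
    have k1 : Integrable (fun ω => 2 * ((∑ t ∈ Finset.Icc 1 n, dirScore g σ θ₀ w (obs y t ω)) *
        dirScore g σ θ₀ w (obs y ((n + 1 : ℕ) : ℤ) ω))) P := (hS.integrable_mul hs).const_mul 2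
    rw [integral_add (hS.integrable_sq.fun_add k1) hs.integrable_sq,
      integral_add hS.integrable_sq k1,
      integral_const_mul, hz, ih, hsq]
    push_cast
    ring

/-- The expected Hessian is positive definite. -/
theorem integral_bilin_hess_pos (M : IsModel P g σ Θ θ₀ y η) (t : ℤ)
    {w : EuclideanSpace ℝ (Fin d)} (hw : w ≠ 0) :
    0 < ∫ ω, bilin (hessMat (logLik g σ (past y t ω) (y t ω)) θ₀) w w ∂P := by
  obtain ⟨i1, i2, c₁, c₂, hc₁, hc₂, heq⟩ := M.integrable_sq_normDir t w
  rw [heq]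
  have n1 : 0 ≤ ∫ ω, normDir σ σ θ₀ w (past y t ω) ^ 2 ∂P := integral_nonneg fun _ => sq_nonneg _
  have n2 : 0 ≤ ∫ ω, normDir g σ θ₀ w (past y t ω) ^ 2 ∂P := integral_nonneg fun _ => sq_nonneg _
  -- A vanishing second moment makes the directional derivative zero almost surely, against one of
  -- the two rank alternatives.
  have hzero : ∀ f : (ℕ → ℝ) → EuclideanSpace ℝ (Fin d) → ℝ,
      Integrable (fun ω => normDir f σ θ₀ w (past y t ω) ^ 2) P →
      ∫ ω, normDir f σ θ₀ w (past y t ω) ^ 2 ∂P = 0 →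
      ∀ᵐ ω ∂P, fderiv ℝ (f (past y t ω)) θ₀ w = 0 := by
    intro f hf hf0
    rw [integral_eq_zero_iff_of_nonneg (fun _ => sq_nonneg _) hf] at hf0
    filter_upwards [hf0] with ω hω
    have h1 : normDir f σ θ₀ w (past y t ω) = 0 := by simpa using hω
    rw [normDir, div_eq_zero_iff] at h1
    exact h1.resolve_right (M.σ_pos _ _).ne'
  rcases M.rank t with hr | hr
  · refine add_pos_of_pos_of_nonneg (mul_pos hc₁ (lt_of_le_of_ne n1 fun h0 => hr ?_))
      (mul_nonneg hc₂.le n2)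
    refine ⟨w, hw, ?_⟩
    filter_upwards [hzero σ i1 h0.symm] with ω hω
    rw [real_inner_comm, inner_gradient]
    have hd := differentiableAt_of_contDiffOn_two isOpen_interior (M.C2 (past y t ω)).2 M.interior
    rw [fderiv_fun_pow 2 hd]
    simp [hω]
  · refine add_pos_of_nonneg_of_pos (mul_nonneg hc₁.le n1)
      (mul_pos hc₂ (lt_of_le_of_ne n2 fun h0 => hr ?_))
    refine ⟨w, hw, ?_⟩
    filter_upwards [hzero g i2 h0.symm] with ω hω
    rw [real_inner_comm, inner_gradient]
    exact hω

end Directions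

end IsModel

end

section

/-! ### Elementary facts on averages and negligible sequences. -/

section Averages

theorem avg_le_avg {n : ℕ} {a b : ℕ → ℝ} (hab : ∀ t ∈ Finset.Icc 1 n, a t ≤ b t) :
    avg n a ≤ avg n b :=
  mul_le_mul_of_nonneg_left (Finset.sum_le_sum hab) (by positivity)

theorem avg_nonneg {n : ℕ} {a : ℕ → ℝ} (ha : ∀ t ∈ Finset.Icc 1 n, 0 ≤ a t) : 0 ≤ avg n a :=
  mul_nonneg (by positivity) (Finset.sum_nonneg ha)

theorem avg_add (n : ℕ) (a b : ℕ → ℝ) : avg n (fun t => a t + b t) = avg n a + avg n b := by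
  simp only [avg, Finset.sum_add_distrib, mul_add]

theorem avg_neg (n : ℕ) (a : ℕ → ℝ) : avg n (fun t => -a t) = -avg n a := by
  simp only [avg, Finset.sum_neg_distrib, mul_neg]

theorem avg_const_mul (n : ℕ) (c : ℝ) (a : ℕ → ℝ) : avg n (fun t => c * a t) = c * avg n a := by
  simp only [avg, ← Finset.mul_sum]; ring

theorem tendsto_avg_zero {a : ℕ → ℝ} (ha : Tendsto a atTop (𝓝 0)) :
    Tendsto (fun n => avg n a) atTop (𝓝 0) := by
  have h1 := ((tendsto_add_atTop_iff_nat 1).2 ha).cesaro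
  refine h1.congr fun n => ?_
  unfold avg
  congr 1
  rw [Finset.range_eq_Ico, show Finset.Icc 1 n = Finset.Ico (0 + 1) (n + 1) from rfl,
    ← Finset.sum_Ico_add' a 0 n 1]

variable {Ω : Type*} [MeasurableSpace Ω] {P : Measure Ω}

/-- Averages of random sequences tending to zero almost surely tend to zero in probability. -/
theorem tendsto_avg_inProb_zero [IsProbabilityMeasure P] {S : ℕ → Ω → ℝ}
    (hS : ∀ t, 1 ≤ t → Measurable (S t))
    (h : ∀ᵐ ω ∂P, Tendsto (fun t => S t ω) atTop (𝓝 0)) :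
    Tendsto (fun p : ℕ × Ω => avg p.1 fun t => S t p.2) (inProb P) (𝓝 0) := by
  refine tendsto_inProb_of_ae (f := fun n ω => avg n fun t => S t ω) (fun n => ?_) ?_
  · exact ((Finset.measurable_sum _ fun t ht =>
      hS t (Finset.mem_Icc.1 ht).1).const_mul _).aestronglyMeasurable
  · filter_upwards [h] with ω hω
    exact tendsto_avg_zero hω

/-- Random variables with bounded moments are almost surely negligible against a geometric
sequence. -/
theorem ae_tendsto_pow_mul_zero {X : ℕ → Ω → ℝ≥0∞} (hX : ∀ t, AEMeasurable (X t) P) {C : ℝ≥0∞}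
    (hC : C ≠ ∞) (hXC : ∀ t, ∫⁻ ω, X t ω ∂P ≤ C) {r : ℝ≥0∞} (hr : r < 1) :
    ∀ᵐ ω ∂P, Tendsto (fun t => r ^ t * X t ω) atTop (𝓝 0) := by
  -- The expected series is dominated by a geometric one, so it converges almost surely and its
  -- terms tend to zero.
  have h1 : ∫⁻ ω, ∑' t, r ^ t * X t ω ∂P ≠ ∞ := by
    rw [lintegral_tsum fun t => (hX t).const_mul _]
    refine ne_top_of_le_ne_top ?_ (ENNReal.tsum_le_tsum (g := fun t => r ^ t * C) fun t => ?_)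
    · rw [ENNReal.tsum_mul_right, ENNReal.tsum_geometric]
      exact ENNReal.mul_ne_top (ENNReal.inv_ne_top.2 (tsub_pos_of_lt hr).ne') hC
    · rw [lintegral_const_mul'' _ (hX t)]
      gcongr
      exact hXC t
  filter_upwards [ae_lt_top' (AEMeasurable.tsum fun t => (hX t).const_mul _) h1] with ω hω
  exact ENNReal.tendsto_atTop_zero_of_tsum_ne_top hω.ne

end Averages

/-! ### Stability of the log-likelihood in mean and scale, and identification. -/

section Perturbation

/-- The effect on the log-likelihood of a perturbation of mean and squared scale. -/
theorem abs_logLik_perturb_le {s s' m m' v a b : ℝ} (hb : 0 < b) (hs : b ≤ s) (hs' : 0 < s')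
    (ha : |m' - m| + |s' ^ 2 - s ^ 2| ≤ a) (hab : a ≤ 3 / 4 * b ^ 2) :
    |(-Real.log s' + logLogistic ((v - m') / s')) - (-Real.log s + logLogistic ((v - m) / s))| ≤
      (2 / b ^ 2 + 2 / b) * a + 2 / b ^ 3 * (a * |v - m|) := by
  have hs0 : 0 < s := hb.trans_le hs
  have hm : |m' - m| ≤ a := by linarith [abs_nonneg (s' ^ 2 - s ^ 2)]
  have hq : |s' ^ 2 - s ^ 2| ≤ a := by linarith [abs_nonneg (m' - m)]
  have ha0 : 0 ≤ a := (abs_nonneg _).trans hm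
  -- From `a ≤ 3/4 b²` one gets `s'² ≥ s² - a ≥ b² / 4`; this is the origin of the constant `3/4`.
  have hs'b : b / 2 ≤ s' := by
    have h1 := (abs_le.1 hq).1
    have h2 : (b / 2) ^ 2 ≤ s' ^ 2 := by nlinarith
    exact le_of_sq_le_sq h2 hs'.le
  have hd : |s' - s| ≤ a / b := by
    rw [le_div_iff₀ hb]
    have h1 : |s' ^ 2 - s ^ 2| = |s' - s| * (s' + s) := by
      rw [← abs_of_pos (show 0 < s' + s by linarith), ← abs_mul]; congr 1; ring
    rw [h1] at hq
    have := mul_le_mul_of_nonneg_left (show b ≤ s' + s by linarith) (abs_nonneg (s' - s))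
    linarith
  have hlog : |Real.log s' - Real.log s| ≤ 2 / b ^ 2 * a := by
    have hkey : ∀ x z : ℝ, b / 2 ≤ x → 0 < z → |z - x| ≤ a / b →
        Real.log z - Real.log x ≤ 2 / b ^ 2 * a := by
      intro x z hx hz hzx
      have hx0 : 0 < x := by linarith
      have h1 := Real.log_le_sub_one_of_pos (div_pos hz hx0)
      rw [Real.log_div hz.ne' hx0.ne'] at h1
      refine h1.trans ?_
      have h2 : z / x - 1 = (z - x) / x := by field_simp
      rw [h2]
      calc (z - x) / x ≤ (a / b) / (b / 2) := by
            have := (le_abs_self _).trans hzx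
            gcongr
        _ = 2 / b ^ 2 * a := by field_simp
    refine abs_sub_le_iff.2 ⟨hkey s s' (by linarith) hs' hd, hkey s' s hs'b hs0 ?_⟩
    rwa [abs_sub_comm]
  have hres : |(v - m') / s' - (v - m) / s| ≤ 2 / b * a + 2 / b ^ 3 * (a * |v - m|) := by
    have h1 : (v - m') / s' - (v - m) / s = (m - m') / s' + (v - m) * (s - s') / (s * s') := by
      field_simp; ring
    rw [h1]
    refine (abs_add_le _ _).trans (add_le_add ?_ ?_)
    · rw [abs_div, abs_of_pos hs', abs_sub_comm]
      calc |m' - m| / s' ≤ a / (b / 2) := by gcongr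
        _ = 2 / b * a := by field_simp
    · rw [abs_div, abs_mul, abs_of_pos (mul_pos hs0 hs'), abs_sub_comm s s']
      calc |v - m| * |s' - s| / (s * s') ≤ |v - m| * (a / b) / (b * (b / 2)) := by gcongr
        _ = 2 / b ^ 3 * (a * |v - m|) := by field_simp
  have hlip := (abs_logLogistic_sub_le ((v - m') / s') ((v - m) / s)).trans hres
  calc _ = |-(Real.log s' - Real.log s) +
        (logLogistic ((v - m') / s') - logLogistic ((v - m) / s))| := by congr 1; ring
    _ ≤ |Real.log s' - Real.log s| + |logLogistic ((v - m') / s') - logLogistic ((v - m) / s)| := by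
        rw [← abs_neg (Real.log s' - Real.log s)]; exact abs_add_le _ _
    _ ≤ _ := by linarith

end Perturbation

namespace IsModel

variable {Ω : Type*} [MeasurableSpace Ω] {P : Measure Ω} [IsProbabilityMeasure P] {d : ℕ}
  {g σ : (ℕ → ℝ) → EuclideanSpace ℝ (Fin d) → ℝ} {Θ : Set (EuclideanSpace ℝ (Fin d))}
  {θ₀ : EuclideanSpace ℝ (Fin d)} {y η : ℤ → Ω → ℝ}

theorem mem_Θ (M : IsModel P g σ Θ θ₀ y η) : θ₀ ∈ Θ := interior_subset M.interior

/-- The assumed null set depends on the parameter. A countable dense set and continuity give a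
common one, at the price of a weak inequality. -/
theorem exists_ae_le_σ (M : IsModel P g σ Θ θ₀ y η) :
    ∃ b : ℝ, 0 < b ∧ ∀ t, ∀ᵐ ω ∂P, ∀ θ ∈ Θ, b ≤ σ (past y t ω) θ := by
  obtain ⟨b, hb, hbσ⟩ := M.σ_low
  refine ⟨b, hb, fun t => ?_⟩
  obtain ⟨D, hDc, hDS, hSD⟩ := exists_countable_dense_subset Θ
  have h1 : ∀ᵐ ω ∂P, ∀ θ ∈ D, b < σ (past y t ω) θ :=
    (ae_ball_iff hDc).2 fun θ hθ => hbσ t θ (hDS hθ)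
  filter_upwards [h1] with ω hω θ hθ
  exact mem_of_forall_mem_dense hSD hDS isOpen_univ (M.cont (past y t ω)).2 isClosed_Ici
    (fun θ hθ => Set.mem_Ici.2 (hω θ hθ.1).le) θ ⟨hθ, trivial⟩

theorem integrable_σ_rpow {ι : ℝ} (M : IsModel P g σ Θ θ₀ y η) (t : ℤ)
    (hfin : ∫⁻ ω, ENNReal.ofReal (σ (past y t ω) θ₀ ^ ι) ∂P < ∞) :
    Integrable (fun ω => σ (past y t ω) θ₀ ^ ι) P := by
  have hm : Measurable fun ω => σ (past y t ω) θ₀ ^ ι :=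
    ((M.measurable_σ θ₀).comp (measurable_past M.y_meas t)).pow_const ι
  refine ⟨hm.aestronglyMeasurable, ?_⟩
  rwa [hasFiniteIntegral_iff_ofReal (ae_of_all _ fun ω => Real.rpow_nonneg (M.σ_pos _ _).le _)]

theorem ae_logLik_true (M : IsModel P g σ Θ θ₀ y η) (t : ℤ) :
    ∀ᵐ ω ∂P, logLik g σ (past y t ω) (y t ω) θ₀ =
      -Real.log (σ (past y t ω) θ₀) + logLogistic (η t ω) := by
  filter_upwards [M.model t] with ω hω
  have := M.σ_pos (past y t ω) θ₀
  rw [logLik_eq, hω]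
  congr 2
  field_simp
  ring

/-- The logarithm of the scale lies between `log b` and `σ^ι / ι`, and the logistic log-density,
being 1-Lipschitz, grows at most like `|η|`. -/
theorem integrable_logLik_true (M : IsModel P g σ Θ θ₀ y η) (t : ℤ) :
    Integrable (fun ω => logLik g σ (past y t ω) (y t ω) θ₀) P := by
  obtain ⟨ι, hι, hmom⟩ := M.mom
  obtain ⟨b, hb, hbσ⟩ := M.exists_ae_le_σ
  have hσi := M.integrable_σ_rpow t (lt_of_le_of_lt le_add_self (hmom t))
  have hm : Measurable fun ω => logLik g σ (past y t ω) (y t ω) θ₀ :=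
    (measurable_logLik M.g_meas M.σ_meas θ₀).comp (measurable_obs M.y_meas t)
  have hi := (((integrable_const (|Real.log b|)).fun_add (hσi.div_const ι)).fun_add
    ((M.integrable_η t).abs.fun_add (integrable_const (|logLogistic 0|))))
  refine hi.mono' hm.aestronglyMeasurable ?_
  filter_upwards [M.ae_logLik_true t, hbσ t] with ω hω hb'
  rw [hω, Real.norm_eq_abs]
  have hσ0 := M.σ_pos (past y t ω) θ₀
  have h1 := Real.log_le_rpow_div hσ0.le hι
  have h2 := Real.log_le_log hb (hb' θ₀ M.mem_Θ)
  have h3 := abs_logLogistic_sub_le (η t ω) 0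
  rw [sub_zero] at h3
  have h4 : |Real.log (σ (past y t ω) θ₀)| ≤ |Real.log b| + σ (past y t ω) θ₀ ^ ι / ι := by
    have : 0 ≤ σ (past y t ω) θ₀ ^ ι / ι := div_nonneg (Real.rpow_nonneg hσ0.le _) hι.le
    rw [abs_le]
    constructor <;> linarith [neg_abs_le (Real.log b), abs_nonneg (Real.log b)]
  have h5 : |logLogistic (η t ω)| ≤ |η t ω| + |logLogistic 0| := by
    have := abs_sub_abs_le_abs_sub (logLogistic (η t ω)) (logLogistic 0)
    linarith
  refine (abs_add_le _ _).trans ?_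
  rw [abs_neg]
  linarith

/-- The expected log-likelihood is smaller at any other parameter. -/
theorem integral_logLik_lt (M : IsModel P g σ Θ θ₀ y η) (t : ℤ) {θ : EuclideanSpace ℝ (Fin d)}
    (hθ : θ ∈ Θ) (hne : θ ≠ θ₀)
    (hint : Integrable (fun ω => logLik g σ (past y t ω) (y t ω) θ) P) :
    ∫ ω, logLik g σ (past y t ω) (y t ω) θ ∂P < ∫ ω, logLik g σ (past y t ω) (y t ω) θ₀ ∂P := by
  by_contra hcon
  rw [not_lt] at hcon
  have hint₀ := M.integrable_logLik_true t
  let A : (ℕ → ℝ) × ℝ → ℝ := fun z =>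
    (-Real.log (σ z.1 θ) + logLogistic ((g z.1 θ₀ + σ z.1 θ₀ * z.2 - g z.1 θ) / σ z.1 θ)) -
      (-Real.log (σ z.1 θ₀) + logLogistic z.2)
  let B : (ℕ → ℝ) → ℝ → ℝ := fun Y e =>
    (σ Y θ₀ / σ Y θ - 1) * (1 - h e) - (g Y θ₀ - g Y θ) / σ Y θ * (2 * Real.sigmoid e - 1)
  have hlm : Measurable logLogistic := contDiff_logLogistic.continuous.measurable
  have hA : Measurable A := by
    have h1 : Measurable fun z : (ℕ → ℝ) × ℝ => σ z.1 θ :=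
      (M.measurable_σ θ).comp measurable_fst
    have h2 : Measurable fun z : (ℕ → ℝ) × ℝ => σ z.1 θ₀ :=
      (M.measurable_σ θ₀).comp measurable_fst
    have h3 : Measurable fun z : (ℕ → ℝ) × ℝ => g z.1 θ :=
      (M.measurable_g θ).comp measurable_fst
    have h4 : Measurable fun z : (ℕ → ℝ) × ℝ => g z.1 θ₀ :=
      (M.measurable_g θ₀).comp measurable_fst
    exact ((Real.measurable_log.comp h1).neg.add
      (hlm.comp (((h4.add (h2.mul measurable_snd)).sub h3).div h1))).sub
      ((Real.measurable_log.comp h2).neg.add (hlm.comp measurable_snd))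
  have hpair : Measurable fun ω => (past y t ω, η t ω) :=
    (measurable_past M.y_meas t).prodMk (M.η_meas t)
  have hAeq : (fun ω => logLik g σ (past y t ω) (y t ω) θ -
      logLik g σ (past y t ω) (y t ω) θ₀) =ᵐ[P] fun ω => A (past y t ω, η t ω) := by
    filter_upwards [M.ae_logLik_true t, M.model t] with ω h1 h2
    rw [h1, logLik_eq, h2]
  have hAi : Integrable A ((P.map (past y t)).prod (P.map (η t))) := by
    rw [← M.map_past_η t, integrable_map_measure hA.aestronglyMeasurable hpair.aemeasurable]
    exact (hint.sub hint₀).congr hAeq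
  have : IsProbabilityMeasure (P.map (past y t)) :=
    Measure.isProbabilityMeasure_map (measurable_past M.y_meas t).aemeasurable
  have : IsProbabilityMeasure (P.map (η t)) :=
    Measure.isProbabilityMeasure_map (M.η_meas t).aemeasurable
  have hBm : ∀ Y, Measurable (B Y) := fun Y =>
    ((continuous_h.measurable.const_sub 1).const_mul _).sub (measurable_weight.const_mul _)
  have hBi : ∀ Y, Integrable (B Y) (P.map (η t)) := fun Y => by
    rw [integrable_map_measure (hBm Y).aestronglyMeasurable (M.η_meas t).aemeasurable]
    exact (((integrable_const (1 : ℝ)).sub (M.integrable_h t)).const_mul _).sub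
      ((M.integrable_weight t).const_mul _)
  -- The tangent bound is integrated for each fixed past `Y`; its coefficients depend on `Y` and
  -- need not be integrable.
  have hB0 : ∀ Y, ∫ e, B Y e ∂(P.map (η t)) = 0 := fun Y => by
    rw [integral_map (M.η_meas t).aemeasurable (hBm Y).aestronglyMeasurable]
    have j1 : Integrable (fun ω => 1 - h (η t ω)) P :=
      (integrable_const (1 : ℝ)).sub (M.integrable_h t)
    simp only [B]
    rw [integral_sub (j1.const_mul _) ((M.integrable_weight t).const_mul _),
      integral_const_mul, integral_const_mul, M.integral_weight t,
      integral_sub (integrable_const _) (M.integrable_h t), M.η_psi t]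
    simp
  have hAB : ∀ Y e, A (Y, e) ≤ B Y e ∧ (A (Y, e) = B Y e → g Y θ = g Y θ₀ ∧ σ Y θ = σ Y θ₀) :=
    fun Y e => logLogistic_sub_tangent (M.σ_pos Y θ₀) (M.σ_pos Y θ)
  have hle : ∀ᵐ Y ∂(P.map (past y t)), ∫ e, A (Y, e) ∂(P.map (η t)) ≤ 0 := by
    filter_upwards [hAi.prod_right_ae] with Y hY
    rw [← hB0 Y]
    exact integral_mono hY (hBi Y) fun e => (hAB Y e).1
  have hge : 0 ≤ ∫ Y, ∫ e, A (Y, e) ∂(P.map (η t)) ∂(P.map (past y t)) := by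
    rw [← integral_prod _ hAi, ← M.map_past_η t,
      integral_map hpair.aemeasurable hA.aestronglyMeasurable, ← integral_congr_ae hAeq,
      integral_sub hint hint₀]
    linarith
  -- The conditional mean is nonpositive while its integral is nonnegative, by the contrary
  -- assumption.
  have hzero : (fun Y => ∫ e, A (Y, e) ∂(P.map (η t))) =ᵐ[P.map (past y t)] 0 := by
    have hneg : 0 ≤ᵐ[P.map (past y t)] fun Y => -∫ e, A (Y, e) ∂(P.map (η t)) := by
      filter_upwards [hle] with Y hY
      simpa using hY
    have h0 : ∫ Y, -∫ e, A (Y, e) ∂(P.map (η t)) ∂(P.map (past y t)) = 0 :=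
      le_antisymm (by rw [integral_neg]; linarith) (integral_nonneg_of_ae hneg)
    have := (integral_eq_zero_iff_of_nonneg_ae hneg hAi.integral_prod_left.neg).1 h0
    filter_upwards [this] with Y hY
    simpa using hY
  have hfin : ∀ᵐ Y ∂(P.map (past y t)), g Y θ = g Y θ₀ ∧ σ Y θ = σ Y θ₀ := by
    filter_upwards [hzero, hAi.prod_right_ae] with Y hY hYi
    have hd : 0 ≤ᵐ[P.map (η t)] fun e => B Y e - A (Y, e) :=
      ae_of_all _ fun e => sub_nonneg.2 (hAB Y e).1
    have h0 : ∫ e, (B Y e - A (Y, e)) ∂(P.map (η t)) = 0 := by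
      rw [integral_sub (hBi Y) hYi, hB0 Y]
      simpa using hY
    have h1 := (integral_eq_zero_iff_of_nonneg_ae hd ((hBi Y).sub hYi)).1 h0
    -- Equality holds for almost every `e`, and a single such value already identifies mean and
    -- scale.
    obtain ⟨e, he⟩ := h1.exists
    exact (hAB Y e).2 (sub_eq_zero.1 he).symm
  exact hne ((M.ident t θ hθ).1 (ae_of_ae_map (measurable_past M.y_meas t).aemeasurable hfin))

end IsModel

end

section

/-! ### Consistency of the estimator. -/

namespace IsModel

variable {Ω : Type*} [MeasurableSpace Ω] {P : Measure Ω} [IsProbabilityMeasure P] {d : ℕ}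
  {g σ : (ℕ → ℝ) → EuclideanSpace ℝ (Fin d) → ℝ} {Θ : Set (EuclideanSpace ℝ (Fin d))}
  {θ₀ : EuclideanSpace ℝ (Fin d)} {y η : ℤ → Ω → ℝ}

theorem continuousOn_ℓ (M : IsModel P g σ Θ θ₀ y η) (Y : ℕ → ℝ) (v : ℝ) :
    ContinuousOn (logLik g σ Y v) Θ :=
  continuousOn_logLik M.σ_pos (M.cont Y).1 (M.cont Y).2

/-- Near a wrong parameter, minus the log-likelihood has an integrable minorant whose expectation
exceeds the expectation at the true parameter. -/
theorem exists_local_minorant (M : IsModel P g σ Θ θ₀ y η) {θ₁ : EuclideanSpace ℝ (Fin d)}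
    (hθ₁ : θ₁ ∈ Θ) (hne : θ₁ ≠ θ₀) :
    ∃ (B : Set (EuclideanSpace ℝ (Fin d))) (φ : (ℕ → ℝ) × ℝ → ℝ), IsOpen B ∧ θ₁ ∈ B ∧
      Measurable φ ∧ Integrable (fun ω => φ (obs y 0 ω)) P ∧
      -∫ ω, logLik g σ (past y 0 ω) (y 0 ω) θ₀ ∂P < ∫ ω, φ (obs y 0 ω) ∂P ∧
      ∀ t, ∀ᵐ ω ∂P, ∀ θ ∈ Θ ∩ B, φ (obs y t ω) ≤ -logLik g σ (past y t ω) (y t ω) θ := by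
  obtain ⟨b, hb, hbσ⟩ := M.exists_ae_le_σ
  -- The logistic density is at most `1` and the scale at least `b`, so `c - ℓ` is nonnegative
  -- almost surely, which opens the way to monotone convergence.
  set c : ℝ := -Real.log b with hc
  have hnonneg : ∀ t, ∀ᵐ ω ∂P, ∀ θ ∈ Θ, 0 ≤ c - logLik g σ (past y t ω) (y t ω) θ := by
    intro t
    filter_upwards [hbσ t] with ω hω θ hθ
    rw [logLik_eq]
    have h1 := Real.log_le_log hb (hω θ hθ)
    have h2 := logLogistic_le_zero ((y t ω - g (past y t ω) θ) / σ (past y t ω) θ)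
    linarith
  let N : (ℕ → ℝ) × ℝ → EuclideanSpace ℝ (Fin d) → ℝ≥0∞ :=
    fun z θ => ENNReal.ofReal (c - logLik g σ z.1 z.2 θ)
  have hNm : ∀ θ, Measurable fun z => N z θ := fun θ =>
    ((measurable_logLik M.g_meas M.σ_meas θ).const_sub c).ennreal_ofReal
  have hNc : ∀ z, ContinuousOn (N z) Θ := fun z =>
    ENNReal.continuous_ofReal.comp_continuousOn (continuousOn_const.sub (M.continuousOn_ℓ z.1 z.2))
  let r : ℕ → ℝ := fun k => 1 / ((k : ℝ) + 1)
  have hr0 : ∀ k, 0 < r k := fun k => by positivity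
  -- Infima over shrinking balls increase with `k` and, by continuity, reach at least the value at
  -- `θ₁`. The cap `k` makes each of them integrable.
  let W : ℕ → (ℕ → ℝ) × ℝ → ℝ≥0∞ := fun k z =>
    min (⨅ θ ∈ Θ ∩ Metric.ball θ₁ (r k), N z θ) k
  have hWm : ∀ k, Measurable (W k) := fun k =>
    (measurable_biInf_of_continuousOn Metric.isOpen_ball hNc fun θ _ => hNm θ).min measurable_const
  have hWmono : Monotone W := by
    intro k l hkl z
    have hrr : r l ≤ r k := one_div_le_one_div_of_le (by positivity) (by gcongr)
    refine min_le_min (biInf_mono fun θ hθ => ⟨hθ.1, Metric.ball_subset_ball hrr hθ.2⟩) ?_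
    exact_mod_cast hkl
  have hWsup : ∀ z, N z θ₁ ≤ ⨆ k, W k z := by
    intro z
    refine le_of_forall_lt_imp_le_of_dense fun a ha => ?_
    have h1 : ∀ᶠ θ in 𝓝[Θ] θ₁, a < N z θ := (hNc z θ₁ hθ₁).eventually_const_lt ha
    obtain ⟨ε, hε, hball⟩ := Metric.mem_nhdsWithin_iff.1 h1
    obtain ⟨k1, hk1⟩ := exists_nat_one_div_lt hε
    obtain ⟨k2, hk2⟩ := ENNReal.exists_nat_gt ha.ne_top
    refine le_trans ?_ (le_iSup (fun k => W k z) (max k1 k2))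
    refine le_min (le_iInf₂ fun θ hθ => ?_) (hk2.le.trans (by exact_mod_cast le_max_right k1 k2))
    have hrr : r (max k1 k2) ≤ r k1 :=
      one_div_le_one_div_of_le (by positivity) (by gcongr; exact le_max_left _ _)
    exact (hball ⟨Metric.ball_subset_ball (hrr.trans hk1.le) hθ.2, hθ.1⟩ :).le
  have hint₀ := M.integrable_logLik_true 0
  set I₀ : ℝ := ∫ ω, logLik g σ (past y 0 ω) (y 0 ω) θ₀ ∂P with hI₀
  have hcI : 0 ≤ c - I₀ := by
    have : 0 ≤ ∫ ω, (c - logLik g σ (past y 0 ω) (y 0 ω) θ₀) ∂P := by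
      refine integral_nonneg_of_ae ?_
      filter_upwards [hnonneg 0] with ω hω
      exact hω θ₀ M.mem_Θ
    rw [integral_sub (integrable_const _) hint₀] at this
    simpa using this
  -- The log-likelihood at `θ₁` may fail to be integrable; the expectation on the right is then
  -- infinite and nothing is to be shown.
  have hlt : ENNReal.ofReal (c - I₀) < ∫⁻ ω, N (obs y 0 ω) θ₁ ∂P := by
    by_cases hfin : ∫⁻ ω, N (obs y 0 ω) θ₁ ∂P = ∞
    · rw [hfin]; exact ENNReal.ofReal_lt_top
    have hm : Measurable fun ω => c - logLik g σ (past y 0 ω) (y 0 ω) θ₁ :=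
      ((measurable_logLik M.g_meas M.σ_meas θ₁).comp (measurable_obs M.y_meas 0)).const_sub c
    have hnn : 0 ≤ᵐ[P] fun ω => c - logLik g σ (past y 0 ω) (y 0 ω) θ₁ := by
      filter_upwards [hnonneg 0] with ω hω
      exact hω θ₁ hθ₁
    have hint : Integrable (fun ω => c - logLik g σ (past y 0 ω) (y 0 ω) θ₁) P := by
      refine ⟨hm.aestronglyMeasurable, ?_⟩
      rw [hasFiniteIntegral_iff_ofReal hnn]
      exact lt_top_iff_ne_top.2 hfin
    have hint₁ : Integrable (fun ω => logLik g σ (past y 0 ω) (y 0 ω) θ₁) P :=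
      ((integrable_const c).sub hint).congr (ae_of_all _ fun ω => by simp)
    have h1 := M.integral_logLik_lt 0 hθ₁ hne hint₁
    have h2 : ∫⁻ ω, N (obs y 0 ω) θ₁ ∂P =
        ENNReal.ofReal (∫ ω, (c - logLik g σ (past y 0 ω) (y 0 ω) θ₁) ∂P) :=
      (ofReal_integral_eq_lintegral_ofReal hint hnn).symm
    rw [h2, ENNReal.ofReal_lt_ofReal_iff_of_nonneg hcI, integral_sub (integrable_const _) hint₁]
    simp only [integral_const, probReal_univ, one_smul]
    linarith
  have hobs := measurable_obs M.y_meas 0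
  obtain ⟨k, hk⟩ : ∃ k, ENNReal.ofReal (c - I₀) < ∫⁻ ω, W k (obs y 0 ω) ∂P := by
    have hWo : ∀ k, Measurable fun ω => W k (obs y 0 ω) := fun k => (hWm k).comp hobs
    rw [← lt_iSup_iff, ← lintegral_iSup hWo fun k l hkl ω => hWmono hkl _]
    exact hlt.trans_le (lintegral_mono fun ω => hWsup _)
  have hWk : ∀ z, W k z ≤ k := fun z => min_le_right _ _
  have hWfin : ∀ z, W k z ≠ ∞ := fun z => ne_top_of_le_ne_top (ENNReal.natCast_ne_top k) (hWk z)
  have hWint : Integrable (fun ω => (W k (obs y 0 ω)).toReal) P := by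
    refine Integrable.of_bound ((hWm k).comp hobs).ennreal_toReal.aestronglyMeasurable k
      (ae_of_all _ fun ω => ?_)
    rw [Real.norm_of_nonneg ENNReal.toReal_nonneg]
    simpa using ENNReal.toReal_mono (ENNReal.natCast_ne_top k) (hWk (obs y 0 ω))
  refine ⟨Metric.ball θ₁ (r k), fun z => (W k z).toReal - c, Metric.isOpen_ball,
    Metric.mem_ball_self (hr0 k), (hWm k).ennreal_toReal.sub_const c,
    hWint.sub (integrable_const c), ?_, fun t => ?_⟩
  · rw [integral_sub hWint (integrable_const c)]
    have hfin : ∫⁻ ω, W k (obs y 0 ω) ∂P ≠ ∞ := by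
      refine ne_top_of_le_ne_top (ENNReal.natCast_ne_top k) ?_
      calc ∫⁻ ω, W k (obs y 0 ω) ∂P ≤ ∫⁻ _, (k : ℝ≥0∞) ∂P := lintegral_mono fun ω => hWk _
        _ = k := by simp
    have h1 : ∫ ω, (W k (obs y 0 ω)).toReal ∂P = (∫⁻ ω, W k (obs y 0 ω) ∂P).toReal :=
      integral_toReal ((hWm k).comp hobs).aemeasurable
        (ae_of_all _ fun ω => lt_top_iff_ne_top.2 (hWfin _))
    have h2 := (ENNReal.ofReal_lt_iff_lt_toReal hcI hfin).1 hk
    rw [h1]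
    simp only [integral_const, probReal_univ, one_smul]
    linarith
  · filter_upwards [hnonneg t] with ω hω θ hθ
    have h1 : W k (obs y t ω) ≤ N (obs y t ω) θ := (min_le_left _ _).trans (iInf₂_le θ hθ)
    have h2 : (W k (obs y t ω)).toReal ≤
        (ENNReal.ofReal (c - logLik g σ (past y t ω) (y t ω) θ)).toReal :=
      ENNReal.toReal_mono ENNReal.ofReal_ne_top h1
    rw [ENNReal.toReal_ofReal (hω θ hθ.1)] at h2
    linarith

theorem le_toReal_rpow_inv {x ι : ℝ} {K : ℝ≥0∞} (hx : 0 ≤ x) (hι : 0 < ι) (hK : K ≠ ∞)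
    (h : ENNReal.ofReal (x ^ ι) ≤ K) : x ≤ K.toReal ^ ι⁻¹ := by
  have h1 : x ^ ι ≤ K.toReal := (ENNReal.ofReal_le_iff_le_toReal hK).1 h
  have h2 := Real.rpow_le_rpow (Real.rpow_nonneg hx _) h1 (inv_nonneg.2 hι.le)
  rwa [Real.rpow_rpow_inv hx hι.ne'] at h2

theorem ofReal_pow_mul_rpow {r x ι : ℝ} (hr : 0 ≤ r) (hx : 0 ≤ x) (t : ℕ) :
    ENNReal.ofReal ((r ^ t * x) ^ ι) = ENNReal.ofReal (r ^ ι) ^ t * ENNReal.ofReal (x ^ ι) := by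
  rw [Real.mul_rpow (by positivity) hx, ENNReal.ofReal_mul (by positivity),
    ← ENNReal.ofReal_pow (by positivity), ← Real.rpow_natCast, ← Real.rpow_natCast,
    ← Real.rpow_mul hr, ← Real.rpow_mul hr, mul_comm ι]

theorem tendsto_toReal_rpow_inv {ι : ℝ} (hι : 0 < ι) {K : ℕ → ℝ≥0∞}
    (hK : Tendsto K atTop (𝓝 0)) : Tendsto (fun t => (K t).toReal ^ ι⁻¹) atTop (𝓝 0) := by
  have h1 := (ENNReal.tendsto_toReal ENNReal.zero_ne_top).comp hK
  have h2 := h1.rpow_const (p := ι⁻¹) (Or.inr (inv_nonneg.2 hι.le))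
  simpa [Real.zero_rpow (inv_ne_zero hι.ne')] using h2

/-- The residuals grow at most subexponentially, uniformly in the parameter. -/
theorem ae_exists_residual_bound (M : IsModel P g σ Θ θ₀ y η) {ρ : ℝ} (hρ0 : 0 < ρ) (hρ1 : ρ < 1) :
    ∀ᵐ ω ∂P, ∃ β : ℕ → ℝ, Tendsto β atTop (𝓝 0) ∧
      ∀ t : ℕ, ∀ θ ∈ Θ, ρ ^ t * |y t ω - g (past y t ω) θ| ≤ β t := by
  obtain ⟨ι, hι, hmom⟩ := M.mom
  let φ : (ℕ → ℝ) × ℝ → ℝ≥0∞ := fun z => ⨆ θ ∈ Θ ∩ Set.univ, ENNReal.ofReal (|g z.1 θ| ^ ι)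
  have hφ : Measurable φ := by
    refine measurable_biSup_of_continuousOn isOpen_univ (fun z => ?_) fun θ _ => ?_
    · exact ENNReal.continuous_ofReal.comp_continuousOn
        ((M.cont z.1).1.abs.rpow_const fun _ _ => Or.inr hι.le)
    · have h1 : Measurable fun z : (ℕ → ℝ) × ℝ => g z.1 θ := (M.measurable_g θ).comp measurable_fst
      exact (h1.abs.pow_const ι).ennreal_ofReal
  have hφfin : ∫⁻ ω, φ (obs y 0 ω) ∂P < ∞ := by
    refine lt_of_le_of_lt ?_ (hmom 0)
    refine le_add_right (le_of_eq (lintegral_congr fun ω => ?_))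
    simp only [φ, Set.inter_univ]
    rfl
  let ψ : (ℕ → ℝ) × ℝ → ℝ≥0∞ := fun z => ENNReal.ofReal (σ z.1 θ₀ ^ ι)
  have hψ : Measurable ψ := by
    have h1 : Measurable fun z : (ℕ → ℝ) × ℝ => σ z.1 θ₀ := (M.measurable_σ θ₀).comp measurable_fst
    exact (h1.pow_const ι).ennreal_ofReal
  have hψfin : ∫⁻ ω, ψ (obs y 0 ω) ∂P < ∞ := lt_of_le_of_lt le_add_self (hmom 0)
  have hηfin : ∫⁻ ω, ENNReal.ofReal |η 0 ω| ∂P < ∞ := by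
    have := (M.integrable_η 0).abs.2
    rwa [hasFiniteIntegral_iff_ofReal (ae_of_all _ fun ω => abs_nonneg _)] at this
  -- Writing `ρ^t = q^t q^t` gives one geometric factor to the scale, which has a fractional moment,
  -- and one to `η`, which has a first moment.
  set q := Real.sqrt ρ with hq
  have hq0 : 0 < q := Real.sqrt_pos.2 hρ0
  have hq1 : q < 1 := by rw [hq, Real.sqrt_lt' one_pos]; simpa using hρ1
  have hqq : q * q = ρ := Real.mul_self_sqrt hρ0.le
  have hlt1 : ∀ r : ℝ, 0 < r → r < 1 → ENNReal.ofReal (r ^ ι) < 1 := fun r h0 h1 => by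
    rw [← ENNReal.ofReal_one, ENNReal.ofReal_lt_ofReal_iff one_pos]
    exact Real.rpow_lt_one h0.le h1 hι
  have A1 := ae_tendsto_pow_mul_zero (P := P) (X := fun t ω => φ (obs y t ω))
    (fun t => (hφ.comp (measurable_obs M.y_meas t)).aemeasurable) hφfin.ne
    (fun t => (lintegral_obs_eq M.y_meas M.erg t hφ).le) (hlt1 ρ hρ0 hρ1)
  have A2 := ae_tendsto_pow_mul_zero (P := P) (X := fun t ω => ψ (obs y t ω))
    (fun t => (hψ.comp (measurable_obs M.y_meas t)).aemeasurable) hψfin.ne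
    (fun t => (lintegral_obs_eq M.y_meas M.erg t hψ).le) (hlt1 q hq0 hq1)
  have A3 := ae_tendsto_pow_mul_zero (P := P) (X := fun t ω => ENNReal.ofReal |η t ω|)
    (fun t => (M.η_meas t).abs.ennreal_ofReal.aemeasurable) hηfin.ne
    (fun t => ((M.η_ident t 0).comp
      (u := fun x => ENNReal.ofReal |x|) (by fun_prop)).lintegral_eq.le)
    (r := ENNReal.ofReal q) (by
      rw [← ENNReal.ofReal_one, ENNReal.ofReal_lt_ofReal_iff one_pos]; exact hq1)
  have A4 : ∀ᵐ ω ∂P, ∀ t : ℕ, φ (obs y t ω) < ∞ := ae_all_iff.2 fun t =>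
    ae_lt_top (hφ.comp (measurable_obs M.y_meas t))
      ((lintegral_obs_eq M.y_meas M.erg t hφ).trans_lt hφfin).ne
  have A5 : ∀ᵐ ω ∂P, ∀ t : ℕ, y t ω = g (past y t ω) θ₀ + σ (past y t ω) θ₀ * η t ω :=
    ae_all_iff.2 fun t => M.model t
  filter_upwards [A1, A2, A3, A4, A5] with ω h1 h2 h3 h4 h5
  refine ⟨fun t => 2 * (ENNReal.ofReal (ρ ^ ι) ^ t * φ (obs y t ω)).toReal ^ ι⁻¹ +
    (ENNReal.ofReal (q ^ ι) ^ t * ψ (obs y t ω)).toReal ^ ι⁻¹ *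
      (ENNReal.ofReal q ^ t * ENNReal.ofReal |η t ω|).toReal, ?_, fun t θ hθ => ?_⟩
  · have := ((tendsto_toReal_rpow_inv hι h1).const_mul 2).add
      ((tendsto_toReal_rpow_inv hι h2).mul
        ((ENNReal.tendsto_toReal ENNReal.zero_ne_top).comp h3))
    simpa using this
  · have hg : ∀ θ ∈ Θ, ρ ^ t * |g (past y t ω) θ| ≤
        (ENNReal.ofReal (ρ ^ ι) ^ t * φ (obs y t ω)).toReal ^ ι⁻¹ := fun θ hθ => by
      refine le_toReal_rpow_inv (by positivity) hι
        (ENNReal.mul_ne_top (ENNReal.pow_ne_top ENNReal.ofReal_ne_top) (h4 t).ne) ?_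
      rw [ofReal_pow_mul_rpow hρ0.le (abs_nonneg _)]
      gcongr
      exact le_iSup₂_of_le (f := fun θ _ => ENNReal.ofReal (|g (past y t ω) θ| ^ ι)) θ
        ⟨hθ, trivial⟩ le_rfl
    have hs : q ^ t * σ (past y t ω) θ₀ ≤
        (ENNReal.ofReal (q ^ ι) ^ t * ψ (obs y t ω)).toReal ^ ι⁻¹ := by
      have hσ0 := M.σ_pos (past y t ω) θ₀
      refine le_toReal_rpow_inv (by positivity) hι
        (ENNReal.mul_ne_top (ENNReal.pow_ne_top ENNReal.ofReal_ne_top) ENNReal.ofReal_ne_top) ?_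
      rw [ofReal_pow_mul_rpow hq0.le hσ0.le]
      rfl
    have hη : (ENNReal.ofReal q ^ t * ENNReal.ofReal |η t ω|).toReal = q ^ t * |η t ω| := by
      rw [ENNReal.toReal_mul, ENNReal.toReal_pow, ENNReal.toReal_ofReal hq0.le,
        ENNReal.toReal_ofReal (abs_nonneg _)]
    have hσ0 := M.σ_pos (past y t ω) θ₀
    have hres : |y t ω - g (past y t ω) θ| ≤
        |g (past y t ω) θ₀| + |g (past y t ω) θ| + σ (past y t ω) θ₀ * |η t ω| := by
      rw [h5 t, show g (past y t ω) θ₀ + σ (past y t ω) θ₀ * η t ω - g (past y t ω) θ =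
        (g (past y t ω) θ₀ - g (past y t ω) θ) + σ (past y t ω) θ₀ * η t ω by ring]
      refine (abs_add_le _ _).trans (add_le_add (abs_sub _ _) ?_)
      rw [abs_mul, abs_of_pos hσ0]
    have hpow : ρ ^ t = q ^ t * q ^ t := by rw [← mul_pow, hqq]
    have h6 := hg θ hθ
    have h7 := hg θ₀ M.mem_Θ
    have h8 : q ^ t * σ (past y t ω) θ₀ * (q ^ t * |η t ω|) ≤
      (ENNReal.ofReal (q ^ ι) ^ t * ψ (obs y t ω)).toReal ^ ι⁻¹ * (q ^ t * |η t ω|) := by gcongr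
    simp only [hη]
    calc ρ ^ t * |y t ω - g (past y t ω) θ| ≤ ρ ^ t * (|g (past y t ω) θ₀| +
          |g (past y t ω) θ| + σ (past y t ω) θ₀ * |η t ω|) := by gcongr
      _ = ρ ^ t * |g (past y t ω) θ₀| + ρ ^ t * |g (past y t ω) θ| +
          q ^ t * σ (past y t ω) θ₀ * (q ^ t * |η t ω|) := by rw [hpow]; ring
      _ ≤ _ := by linarith

theorem measurable_obsPast (M : IsModel P g σ Θ θ₀ y η) {y0 : Ω → ℕ → ℝ} (hy0 : Measurable y0)
    (t : ℕ) : Measurable (obsPast y y0 t) := by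
  refine measurable_pi_lambda _ fun j => ?_
  unfold obsPast
  split_ifs
  · exact M.y_meas _
  · exact (measurable_pi_apply _).comp hy0

/-- The initial value affects the log-likelihood of one observation by an asymptotically negligible
amount, uniformly in the parameter. -/
theorem exists_logLik_approx (M : IsModel P g σ Θ θ₀ y η) {y0 : Ω → ℕ → ℝ} (hy0 : Measurable y0)
    {C : Ω → ℝ} (hC : ∀ ω, 0 ≤ C ω) {ρ : ℝ} (hρ0 : 0 < ρ) (hρ1 : ρ < 1)
    (hinit : ∀ t : ℕ, 1 ≤ t → ∀ᵐ ω ∂P, ∀ θ ∈ Θ,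
      |g (obsPast y y0 t ω) θ - g (past y t ω) θ|
        + |σ (obsPast y y0 t ω) θ ^ 2 - σ (past y t ω) θ ^ 2| ≤ C ω * ρ ^ t) :
    ∃ S : ℕ → Ω → ℝ, (∀ t, Measurable (S t)) ∧
      (∀ᵐ ω ∂P, Tendsto (fun t => S t ω) atTop (𝓝 0)) ∧
      ∀ t ω, ∀ θ ∈ Θ, |logLik g σ (obsPast y y0 t ω) (y t ω) θ -
        logLik g σ (past y t ω) (y t ω) θ| ≤ S t ω := by
  let F : ℕ → Ω → EuclideanSpace ℝ (Fin d) → ℝ := fun t ω θ =>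
    |logLik g σ (obsPast y y0 t ω) (y t ω) θ - logLik g σ (past y t ω) (y t ω) θ|
  have hFc : ∀ t ω, ContinuousOn (F t ω) Θ := fun t ω =>
    ((M.continuousOn_ℓ _ _).sub (M.continuousOn_ℓ _ _)).abs
  have hFm : ∀ t θ, Measurable fun ω => F t ω θ := fun t θ => by
    have h1 := measurable_logLik M.g_meas M.σ_meas θ
    exact ((h1.comp ((M.measurable_obsPast hy0 t).prodMk (M.y_meas t))).sub
      (h1.comp (measurable_obs M.y_meas t))).abs
  have hfin : ∀ t ω, (⨆ θ ∈ Θ ∩ Set.univ, ENNReal.ofReal (F t ω θ)) ≠ ∞ := by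
    intro t ω
    obtain ⟨K, hK⟩ := M.compact.bddAbove_image (hFc t ω)
    refine ne_top_of_le_ne_top (ENNReal.ofReal_ne_top (r := K)) (iSup₂_le fun θ hθ => ?_)
    exact ENNReal.ofReal_le_ofReal (hK ⟨θ, hθ.1, rfl⟩)
  -- The supremum itself is taken: measurable by continuity in the parameter, and finite for every
  -- `ω` by compactness.
  refine ⟨fun t ω => (⨆ θ ∈ Θ ∩ Set.univ, ENNReal.ofReal (F t ω θ)).toReal, fun t => ?_, ?_,
    fun t ω θ hθ => ?_⟩
  · exact (measurable_biSup_of_continuousOn isOpen_univ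
      (fun ω => ENNReal.continuous_ofReal.comp_continuousOn (hFc t ω))
      fun θ _ => (hFm t θ).ennreal_ofReal).ennreal_toReal
  · obtain ⟨b, hb, hbσ⟩ := M.exists_ae_le_σ
    have A1 : ∀ᵐ ω ∂P, ∀ t : ℕ, ∀ θ ∈ Θ, b ≤ σ (past y t ω) θ := ae_all_iff.2 fun t => hbσ t
    have A2 : ∀ᵐ ω ∂P, ∀ t : ℕ, 1 ≤ t → ∀ θ ∈ Θ,
        |g (obsPast y y0 t ω) θ - g (past y t ω) θ|
        + |σ (obsPast y y0 t ω) θ ^ 2 - σ (past y t ω) θ ^ 2| ≤ C ω * ρ ^ t :=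
      ae_all_iff.2 fun t => by
        by_cases ht : 1 ≤ t
        · filter_upwards [hinit t ht] with ω hω _ using hω
        · exact ae_of_all _ fun ω h => absurd h ht
    filter_upwards [A1, A2, M.ae_exists_residual_bound hρ0 hρ1] with ω h1 h2 ⟨β, hβ, hβr⟩
    have hpow : Tendsto (fun t : ℕ => C ω * ρ ^ t) atTop (𝓝 0) := by
      simpa using (tendsto_pow_atTop_nhds_zero_of_lt_one hρ0.le hρ1).const_mul (C ω)
    have hlim : Tendsto (fun t : ℕ => (2 / b ^ 2 + 2 / b) * (C ω * ρ ^ t) +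
        2 / b ^ 3 * (C ω * β t)) atTop (𝓝 0) := by
      simpa using (hpow.const_mul (2 / b ^ 2 + 2 / b)).add
        ((hβ.const_mul (C ω)).const_mul (2 / b ^ 3))
    refine squeeze_zero' (Eventually.of_forall fun t => ENNReal.toReal_nonneg) ?_ hlim
    filter_upwards [eventually_ge_atTop 1,
      hpow.eventually_le_const (show 0 < 3 / 4 * b ^ 2 by positivity)] with t ht1 ht2
    have hbound : ∀ θ ∈ Θ, F t ω θ ≤ (2 / b ^ 2 + 2 / b) * (C ω * ρ ^ t) +
        2 / b ^ 3 * (C ω * β t) := by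
      intro θ hθ
      refine (abs_logLik_perturb_le hb (h1 t θ hθ) (M.σ_pos _ _) (h2 t ht1 θ hθ) ht2).trans ?_
      have h5 : C ω * ρ ^ t * |y t ω - g (past y t ω) θ| ≤ C ω * β t := by
        rw [mul_assoc]
        exact mul_le_mul_of_nonneg_left (hβr t θ hθ) (hC ω)
      have h6 := mul_le_mul_of_nonneg_left h5 (show 0 ≤ 2 / b ^ 3 by positivity)
      linarith
    have h0 : 0 ≤ (2 / b ^ 2 + 2 / b) * (C ω * ρ ^ t) + 2 / b ^ 3 * (C ω * β t) :=
      (abs_nonneg _).trans (hbound θ₀ M.mem_Θ)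
    exact ENNReal.toReal_le_of_le_ofReal h0
      (iSup₂_le fun θ hθ => ENNReal.ofReal_le_ofReal (hbound θ hθ.1))
  · have h1 : ENNReal.ofReal (F t ω θ) ≤ ⨆ θ ∈ Θ ∩ Set.univ, ENNReal.ofReal (F t ω θ) :=
      le_iSup₂_of_le (f := fun θ _ => ENNReal.ofReal (F t ω θ)) θ ⟨hθ, trivial⟩ le_rfl
    exact (ENNReal.ofReal_le_iff_le_toReal (hfin t ω)).1 h1

/-- Consistency of the quasi-maximum likelihood estimator. -/
theorem tendsto_estimator (M : IsModel P g σ Θ θ₀ y η) {y0 : Ω → ℕ → ℝ} (hy0 : Measurable y0)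
    {C : Ω → ℝ} (hC : ∀ ω, 0 ≤ C ω) {ρ : ℝ} (hρ0 : 0 < ρ) (hρ1 : ρ < 1)
    (hinit : ∀ t : ℕ, 1 ≤ t → ∀ᵐ ω ∂P, ∀ θ ∈ Θ,
      |g (obsPast y y0 t ω) θ - g (past y t ω) θ|
        + |σ (obsPast y y0 t ω) θ ^ 2 - σ (past y t ω) θ ^ 2| ≤ C ω * ρ ^ t)
    {θhat : ℕ → Ω → EuclideanSpace ℝ (Fin d)}
    (hθhat : ∀ n, ∀ᵐ ω ∂P, θhat n ω ∈ Θ ∧ IsMaxOn (quasiLogLik g σ y y0 n ω) Θ (θhat n ω)) :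
    Tendsto (fun p : ℕ × Ω => θhat p.1 p.2) (inProb P) (𝓝 θ₀) := by
  obtain ⟨S, hSm, hS0, hSb⟩ := M.exists_logLik_approx hy0 hC hρ0 hρ1 hinit
  have hmem := eventually_inProb_of_ae hθhat
  -- By compactness it is enough to exclude cluster points other than `θ₀`, and one neighbourhood of
  -- each such point suffices.
  refine M.compact.le_nhds_of_unique_clusterPt (Filter.mem_map.2 ?_) fun θ₁ hθ₁ hcl => ?_
  · filter_upwards [hmem] with p hp using hp.1
  by_contra hne
  obtain ⟨B, φ, hBo, hB, hφm, hφi, hφlt, hφle⟩ := M.exists_local_minorant hθ₁ hne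
  set I₁ := ∫ ω, φ (obs y 0 ω) ∂P
  set I₀ := ∫ ω, logLik g σ (past y 0 ω) (y 0 ω) θ₀ ∂P
  -- If the estimator lay in `B`, maximality would make this gap smaller than the errors of the two
  -- laws of large numbers (a quarter each) plus two initial-value errors (an eighth each), three
  -- quarters of it in all.
  have hδ : 0 < I₁ + I₀ := by linarith
  have L1 := tendsto_avg_obs M.y_meas M.erg hφm hφi
  have L2 := tendsto_avg_obs M.y_meas M.erg (measurable_logLik M.g_meas M.σ_meas θ₀)
    (M.integrable_logLik_true 0)
  have L3 := tendsto_avg_inProb_zero (P := P) (fun t _ => hSm t) hS0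
  have A : ∀ᵐ ω ∂P, ∀ t : ℕ, ∀ θ ∈ Θ ∩ B,
      φ (obs y t ω) ≤ -logLik g σ (past y t ω) (y t ω) θ := ae_all_iff.2 fun t => hφle t
  have hev : ∀ᶠ p in inProb P, θhat p.1 p.2 ∉ B := by
    filter_upwards [hmem, L1.eventually_const_lt (show I₁ - (I₁ + I₀) / 4 < I₁ by linarith),
      L2.eventually_const_lt (show I₀ - (I₁ + I₀) / 4 < I₀ by linarith),
      L3.eventually_lt_const (show 0 < (I₁ + I₀) / 8 by linarith),
      eventually_inProb_of_ae (fun _ => A)] with p hp h1 h2 h3 h4 hpB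
    have e1 : avg p.1 (fun t => φ (obs y t p.2)) ≤
        -avg p.1 (fun t => logLik g σ (past y t p.2) (y t p.2) (θhat p.1 p.2)) := by
      rw [← avg_neg]
      exact avg_le_avg fun t _ => h4 t _ ⟨hp.1, hpB⟩
    have e2 : avg p.1 (fun t => logLik g σ (obsPast y y0 t p.2) (y t p.2) (θhat p.1 p.2)) ≤
        avg p.1 (fun t => logLik g σ (past y t p.2) (y t p.2) (θhat p.1 p.2)) +
          avg p.1 (fun t => S t p.2) := by
      rw [← avg_add]
      refine avg_le_avg fun t _ => ?_
      linarith [(abs_le.1 (hSb t p.2 _ hp.1)).2]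
    have e3 : avg p.1 (fun t => logLik g σ (past y t p.2) (y t p.2) θ₀) ≤
        avg p.1 (fun t => logLik g σ (obsPast y y0 t p.2) (y t p.2) θ₀) +
          avg p.1 (fun t => S t p.2) := by
      rw [← avg_add]
      refine avg_le_avg fun t _ => ?_
      linarith [(abs_le.1 (hSb t p.2 _ M.mem_Θ)).1]
    have e4 : avg p.1 (fun t => logLik g σ (obsPast y y0 t p.2) (y t p.2) θ₀) ≤
        avg p.1 (fun t => logLik g σ (obsPast y y0 t p.2) (y t p.2) (θhat p.1 p.2)) :=
      mul_le_mul_of_nonneg_left (hp.2 M.mem_Θ) (by positivity)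
    have h2' : I₀ - (I₁ + I₀) / 4 < avg p.1 fun t => logLik g σ (past y t p.2) (y t p.2) θ₀ := h2
    linarith
  exact (hcl.frequently (hBo.mem_nhds hB)) (eventually_map.2 hev)

end IsModel

end

section

/-! ### Matrix averages, the law of large numbers for the Hessian, size of the score. -/

section MatrixAverages

variable {d : ℕ}

theorem norm_smul_sum_sub_le (n : ℕ) (M N : ℕ → Matrix (Fin d) (Fin d) ℝ) {a : ℕ → ℝ}
    (h : ∀ t ∈ Finset.Icc 1 n, ‖M t - N t‖ ≤ a t) :
    ‖(n : ℝ)⁻¹ • ∑ t ∈ Finset.Icc 1 n, M t - (n : ℝ)⁻¹ • ∑ t ∈ Finset.Icc 1 n, N t‖ ≤ avg n a := by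
  rw [← smul_sub, ← Finset.sum_sub_distrib, norm_smul, Real.norm_of_nonneg (by positivity)]
  exact mul_le_mul_of_nonneg_left ((norm_sum_le _ _).trans (Finset.sum_le_sum h)) (by positivity)

theorem avg_mul_le_sqrt (n : ℕ) (a b : ℕ → ℝ) :
    avg n (fun t => a t * b t) ≤
      Real.sqrt (avg n fun t => a t ^ 2) * Real.sqrt (avg n fun t => b t ^ 2) := by
  unfold avg
  rw [Real.sqrt_mul (by positivity), Real.sqrt_mul (by positivity)]
  have h1 := Real.sum_mul_le_sqrt_mul_sqrt (Finset.Icc 1 n) a b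
  have h2 : Real.sqrt ((n : ℝ)⁻¹) * Real.sqrt ((n : ℝ)⁻¹) = (n : ℝ)⁻¹ :=
    Real.mul_self_sqrt (by positivity)
  calc (n : ℝ)⁻¹ * ∑ t ∈ Finset.Icc 1 n, a t * b t
      ≤ (n : ℝ)⁻¹ * (Real.sqrt (∑ t ∈ Finset.Icc 1 n, a t ^ 2) *
        Real.sqrt (∑ t ∈ Finset.Icc 1 n, b t ^ 2)) := by gcongr
    _ = _ := by conv_lhs => rw [← h2]
                ring

/-- A quadratic form which is positive away from zero is bounded below on the sphere. -/
theorem exists_mul_sq_le_bilin (A : Matrix (Fin d) (Fin d) ℝ)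
    (hA : ∀ w : EuclideanSpace ℝ (Fin d), w ≠ 0 → 0 < bilin A w w) :
    ∃ c : ℝ, 0 < c ∧ ∀ w : EuclideanSpace ℝ (Fin d), c * ‖w‖ ^ 2 ≤ bilin A w w := by
  have hcont : Continuous fun w : EuclideanSpace ℝ (Fin d) => bilin A w w := by
    unfold bilin
    fun_prop
  have hhom : ∀ (a : ℝ) (w : EuclideanSpace ℝ (Fin d)),
      bilin A (a • w) (a • w) = a ^ 2 * bilin A w w := by
    intro a w
    simp only [bilin, PiLp.smul_apply, smul_eq_mul, Finset.mul_sum]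
    exact Finset.sum_congr rfl fun i _ => Finset.sum_congr rfl fun j _ => by ring
  rcases (Metric.sphere (0 : EuclideanSpace ℝ (Fin d)) 1).eq_empty_or_nonempty with hE | hE
  -- The unit sphere is empty only in dimension zero.
  · refine ⟨1, one_pos, fun w => ?_⟩
    have hw : w = 0 := by
      by_contra hw
      have : (‖w‖⁻¹ • w) ∈ Metric.sphere (0 : EuclideanSpace ℝ (Fin d)) 1 := by
        simp [norm_smul, hw]
      rw [hE] at this
      exact this
    simp [hw, bilin]
  · obtain ⟨u, hu, hmin⟩ := (isCompact_sphere (0 : EuclideanSpace ℝ (Fin d)) 1).exists_isMinOn hE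
      hcont.continuousOn
    have hu0 : u ≠ 0 := by
      rintro rfl
      simp at hu
    refine ⟨bilin A u u, hA u hu0, fun w => ?_⟩
    rcases eq_or_ne w 0 with rfl | hw
    · simp [bilin]
    have hn : 0 < ‖w‖ := norm_pos_iff.2 hw
    have h1 : bilin A u u ≤ bilin A (‖w‖⁻¹ • w) (‖w‖⁻¹ • w) :=
      hmin (show (‖w‖⁻¹ • w) ∈ Metric.sphere (0 : EuclideanSpace ℝ (Fin d)) 1 by
        simp [norm_smul, hw])
    rw [hhom] at h1
    calc bilin A u u * ‖w‖ ^ 2 ≤ (‖w‖⁻¹ ^ 2 * bilin A w w) * ‖w‖ ^ 2 := by gcongr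
      _ = bilin A w w := by field_simp

end MatrixAverages

namespace IsModel

variable {Ω : Type*} [MeasurableSpace Ω] {P : Measure Ω} [IsProbabilityMeasure P] {d : ℕ}
  {g σ : (ℕ → ℝ) → EuclideanSpace ℝ (Fin d) → ℝ} {Θ : Set (EuclideanSpace ℝ (Fin d))}
  {θ₀ : EuclideanSpace ℝ (Fin d)} {y η : ℤ → Ω → ℝ}

/-- The modulus of continuity of the Hessian at the true parameter has small expectation. -/
theorem exists_hess_modulus (M : IsModel P g σ Θ θ₀ y η) :
    ∃ (r : ℝ) (m : ℝ → (ℕ → ℝ) × ℝ → ℝ), 0 < r ∧ Metric.ball θ₀ r ⊆ _root_.interior Θ ∧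
      (∀ δ, Measurable (m δ)) ∧ (∀ δ z, 0 ≤ m δ z) ∧
      (∀ δ ≤ r, Integrable (fun ω => m δ (obs y 0 ω)) P) ∧
      (∀ ε > 0, ∃ δ, 0 < δ ∧ δ ≤ r ∧ ∫ ω, m δ (obs y 0 ω) ∂P < ε) ∧
      ∀ t : ℤ, ∀ᵐ ω ∂P, ∀ δ ≤ r, ∀ θ ∈ Metric.ball θ₀ δ,
        ‖hessMat (logLik g σ (past y t ω) (y t ω)) θ -
          hessMat (logLik g σ (past y t ω) (y t ω)) θ₀‖ ≤ m δ (obs y t ω) := by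
  obtain ⟨κ, hκ, hκfin⟩ := M.hess
  obtain ⟨r', hr', hball⟩ := Metric.isOpen_iff.1 isOpen_interior θ₀ M.interior
  -- The ball must lie both where the likelihood is twice differentiable and where the Hessian is
  -- dominated.
  set r := min r' κ with hr
  have hr0 : 0 < r := lt_min hr' hκ
  have hballr : Metric.ball θ₀ r ⊆ _root_.interior Θ :=
    (Metric.ball_subset_ball (min_le_left _ _)).trans hball
  let H : (ℕ → ℝ) × ℝ → EuclideanSpace ℝ (Fin d) → Matrix (Fin d) (Fin d) ℝ :=
    fun z θ => hessMat (logLik g σ z.1 z.2) θ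
  have hHc : ∀ z, ContinuousOn (H z) (_root_.interior Θ) := fun z =>
    continuousOn_hessMat isOpen_interior (M.contDiffOn_ℓ z.1 z.2)
  let w : ℝ → (ℕ → ℝ) × ℝ → ℝ≥0∞ := fun δ z =>
    ⨆ θ ∈ _root_.interior Θ ∩ Metric.ball θ₀ δ, ‖H z θ - H z θ₀‖ₑ
  have hwm : ∀ δ, Measurable (w δ) := fun δ => by
    refine measurable_biSup_of_continuousOn Metric.isOpen_ball (fun z => ?_) fun θ hθ => ?_
    · exact ((hHc z).sub continuousOn_const).enorm
    · exact measurable_enorm_of_entries fun i j =>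
        (M.measurable_hess_entry hθ i j).sub (M.measurable_hess_entry M.interior i j)
  have hwmono : ∀ δ ≤ r, ∀ z, w δ z ≤ w r z := fun δ hδ z =>
    biSup_mono fun θ hθ => ⟨hθ.1, Metric.ball_subset_ball hδ hθ.2⟩
  have hwfin : ∫⁻ ω, w r (obs y 0 ω) ∂P < ∞ := by
    have h1 : ∀ ω, w r (obs y 0 ω) ≤
        2 * ⨆ θ ∈ Metric.closedBall θ₀ κ, ‖negHess g σ (past y 0 ω) (y 0 ω) θ‖ₑ := by
      intro ω
      refine iSup₂_le fun θ hθ => (enorm_sub_le).trans ?_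
      rw [two_mul]
      refine add_le_add ?_ ?_
      · exact le_iSup₂_of_le (f := fun θ _ => ‖negHess g σ (past y 0 ω) (y 0 ω) θ‖ₑ) θ
          (Metric.ball_subset_closedBall (Metric.ball_subset_ball (min_le_right _ _) hθ.2)) le_rfl
      · exact le_iSup₂_of_le (f := fun θ _ => ‖negHess g σ (past y 0 ω) (y 0 ω) θ‖ₑ) θ₀
          (Metric.mem_closedBall_self hκ.le) le_rfl
    refine lt_of_le_of_lt (lintegral_mono h1) ?_
    rw [lintegral_const_mul' _ _ (by norm_num)]
    exact ENNReal.mul_lt_top (by norm_num) (hκfin 0)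
  have hobs := fun t => measurable_obs M.y_meas t
  have hae : ∀ t : ℤ, ∀ᵐ ω ∂P, w r (obs y t ω) < ∞ := fun t =>
    ae_lt_top ((hwm r).comp (hobs t))
      ((lintegral_obs_eq M.y_meas M.erg t (hwm r)).trans_lt hwfin).ne
  have hint : ∀ δ ≤ r, Integrable (fun ω => (w δ (obs y 0 ω)).toReal) P := fun δ hδ =>
    integrable_toReal_of_lintegral_ne_top ((hwm δ).comp (hobs 0)).aemeasurable
      (ne_top_of_le_ne_top hwfin.ne (lintegral_mono fun ω => hwmono δ hδ _))
  refine ⟨r, fun δ z => (w δ z).toReal, hr0, hballr, fun δ => (hwm δ).ennreal_toReal,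
    fun _ _ => ENNReal.toReal_nonneg, hint, fun ε hε => ?_, fun t => ?_⟩
  · let δ : ℕ → ℝ := fun k => r * (1 / ((k : ℝ) + 1))
    have hδ0 : ∀ k, 0 < δ k := fun k => by positivity
    have hδr : ∀ k, δ k ≤ r := fun k => by
      refine mul_le_of_le_one_right hr0.le ?_
      rw [div_le_one (by positivity)]
      linarith [(Nat.cast_nonneg k : (0 : ℝ) ≤ k)]
    have hδlim : Tendsto δ atTop (𝓝 0) := by
      have h1 := (tendsto_one_div_add_atTop_nhds_zero_nat (𝕜 := ℝ)).const_mul r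
      rwa [mul_zero] at h1
    -- Continuity of the Hessian at `θ₀` gives the pointwise limit; the modulus at radius `r`
    -- dominates, being at most twice the local supremum.
    have hpt : ∀ z, Tendsto (fun k => w (δ k) z) atTop (𝓝 0) := by
      intro z
      rw [ENNReal.tendsto_nhds_zero]
      intro a ha
      have hc : ContinuousWithinAt (fun θ => ‖H z θ - H z θ₀‖ₑ) (_root_.interior Θ) θ₀ :=
        ((hHc z).sub continuousOn_const).enorm θ₀ M.interior
      have h0 : ‖H z θ₀ - H z θ₀‖ₑ < a := by simpa using ha
      obtain ⟨s, hs, hsb⟩ := Metric.mem_nhdsWithin_iff.1 (hc.eventually_lt_const h0)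
      filter_upwards [hδlim.eventually_lt_const hs] with k hk
      exact iSup₂_le fun θ hθ => (hsb ⟨Metric.ball_subset_ball hk.le hθ.2, hθ.1⟩ :).le
    have hlim : Tendsto (fun k => ∫ ω, (w (δ k) (obs y 0 ω)).toReal ∂P) atTop (𝓝 0) := by
      have h0 : (0 : ℝ) = ∫ _ : Ω, (0 : ℝ) ∂P := by simp
      rw [h0]
      refine tendsto_integral_of_dominated_convergence (fun ω => (w r (obs y 0 ω)).toReal)
        (fun k => ((hwm (δ k)).comp (hobs 0)).ennreal_toReal.aestronglyMeasurable)
        (hint r le_rfl) (fun k => ?_) (ae_of_all _ fun ω => ?_)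
      · filter_upwards [hae 0] with ω hω
        rw [Real.norm_of_nonneg ENNReal.toReal_nonneg]
        exact ENNReal.toReal_mono hω.ne (hwmono _ (hδr k) _)
      · exact (ENNReal.tendsto_toReal ENNReal.zero_ne_top).comp (hpt (obs y 0 ω))
    obtain ⟨k, hk⟩ := (hlim.eventually_lt_const hε).exists
    exact ⟨δ k, hδ0 k, hδr k, hk⟩
  · filter_upwards [hae t] with ω hω δ hδ θ hθ
    have h1 : ‖H (obs y t ω) θ - H (obs y t ω) θ₀‖ₑ ≤ w δ (obs y t ω) :=
      le_iSup₂_of_le (f := fun θ _ => ‖H (obs y t ω) θ - H (obs y t ω) θ₀‖ₑ) θ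
        ⟨hballr (Metric.ball_subset_ball hδ hθ), hθ⟩ le_rfl
    have h2 := ENNReal.toReal_mono (ne_top_of_le_ne_top hω.ne (hwmono δ hδ _)) h1
    rwa [toReal_enorm] at h2

/-- The expected Hessian at the true parameter. -/
theorem bilin_expMatrix (M : IsModel P g σ Θ θ₀ y η) (w : EuclideanSpace ℝ (Fin d)) :
    bilin (expMatrix P fun ω => hessMat (logLik g σ (past y 0 ω) (y 0 ω)) θ₀) w w =
      ∫ ω, bilin (hessMat (logLik g σ (past y 0 ω) (y 0 ω)) θ₀) w w ∂P := by
  unfold bilin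
  rw [integral_finsetSum _ fun i _ => integrable_finsetSum _ fun j _ =>
    ((M.integrable_hess_entry 0 i j).const_mul _).mul_const _]
  refine Finset.sum_congr rfl fun i _ => ?_
  rw [integral_finsetSum _ fun j _ => ((M.integrable_hess_entry 0 i j).const_mul _).mul_const _]
  refine Finset.sum_congr rfl fun j _ => ?_
  rw [integral_mul_const, integral_const_mul]
  rfl

/-- The law of large numbers for the Hessian at the true parameter. -/
theorem tendsto_avg_hess (M : IsModel P g σ Θ θ₀ y η) :
    Tendsto (fun p : ℕ × Ω => (p.1 : ℝ)⁻¹ • ∑ t ∈ Finset.Icc 1 p.1,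
        hessMat (logLik g σ (past y t p.2) (y t p.2)) θ₀) (inProb P)
      (𝓝 (expMatrix P fun ω => hessMat (logLik g σ (past y 0 ω) (y 0 ω)) θ₀)) := by
  refine tendsto_pi_nhds.2 fun i => tendsto_pi_nhds.2 fun j => ?_
  have h1 := tendsto_avg_obs M.y_meas M.erg (M.measurable_hess_entry M.interior i j)
    (M.integrable_hess_entry 0 i j)
  refine h1.congr fun p => ?_
  simp only [avg, Matrix.smul_apply, Matrix.sum_apply, smul_eq_mul]
  rfl

/-- The normalized score is bounded in `L²`, hence negligible against any sequence that tends to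
zero in probability. -/
theorem tendsto_score_mul (M : IsModel P g σ Θ θ₀ y η) (w : EuclideanSpace ℝ (Fin d))
    {Q : ℕ → Ω → ℝ} (hQ : Tendsto (fun p : ℕ × Ω => Q p.1 p.2) (inProb P) (𝓝 0)) :
    Tendsto (fun p : ℕ × Ω => Real.sqrt p.1 * (avg p.1 fun t => dirScore g σ θ₀ w (obs y t p.2)) *
      Q p.1 p.2) (inProb P) (𝓝 0) := by
  have hm : ∀ n : ℕ, Measurable fun ω =>
      Real.sqrt n * avg n fun t => dirScore g σ θ₀ w (obs y t ω) := fun n => by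
    have h1 : ∀ t : ℕ, Measurable fun ω => dirScore g σ θ₀ w (obs y t ω) := fun t =>
      (M.measurable_dirScore w).comp (measurable_obs M.y_meas t)
    exact ((Finset.measurable_sum _ fun t _ => h1 t).const_mul _).const_mul _
  refine tendsto_inProb_mul_of_lintegral_sq_le
    (X := fun n ω => Real.sqrt n * avg n fun t => dirScore g σ θ₀ w (obs y t ω))
    (fun n => (hm n).aemeasurable)
    (C := ENNReal.ofReal (∫ ω, dirScore g σ θ₀ w (obs y 0 ω) ^ 2 ∂P)) ENNReal.ofReal_ne_top ?_ hQ
  filter_upwards [eventually_gt_atTop 0] with n hn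
  have hn' : (0 : ℝ) < n := by exact_mod_cast hn
  have hS : MemLp (fun ω => ∑ t ∈ Finset.Icc 1 n, dirScore g σ θ₀ w (obs y t ω)) 2 P :=
    memLp_finsetSum _ fun t _ => M.memLp_dirScore t w
  -- Orthogonality makes the second moment of the sum exactly `n` times that of one score, so the
  -- normalized mean has constant second moment.
  have hsq : ∀ ω, (Real.sqrt n * avg n fun t => dirScore g σ θ₀ w (obs y t ω)) ^ 2 =
      (n : ℝ)⁻¹ * (∑ t ∈ Finset.Icc 1 n, dirScore g σ θ₀ w (obs y t ω)) ^ 2 := fun ω => by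
    rw [mul_pow, Real.sq_sqrt hn'.le, avg]
    field_simp
  simp only [hsq]
  rw [← ofReal_integral_eq_lintegral_ofReal (hS.integrable_sq.const_mul _)
    (ae_of_all _ fun ω => by positivity), integral_const_mul, M.integral_sq_sum_dirScore w n]
  refine ENNReal.ofReal_le_ofReal (le_of_eq ?_)
  field_simp

end IsModel

end

section

/-! ### Consistency of the Hessian average and the rate of the estimator. -/

namespace IsModel

variable {Ω : Type*} [MeasurableSpace Ω] {P : Measure Ω} [IsProbabilityMeasure P] {d : ℕ}
  {g σ : (ℕ → ℝ) → EuclideanSpace ℝ (Fin d) → ℝ} {Θ : Set (EuclideanSpace ℝ (Fin d))}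
  {θ₀ : EuclideanSpace ℝ (Fin d)} {y η : ℤ → Ω → ℝ} {y0 : Ω → ℕ → ℝ}
  {θhat : ℕ → Ω → EuclideanSpace ℝ (Fin d)} {C : Ω → ℝ} {ρ : ℝ}

theorem ae_score_approx
    (hinit : ∀ t : ℕ, 1 ≤ t → ∀ᵐ ω ∂P, ∀ θ ∈ _root_.interior Θ,
      ‖score g σ (obsPast y y0 t ω) (y t ω) θ - score g σ (past y t ω) (y t ω) θ‖
        + ‖negHess g σ (obsPast y y0 t ω) (y t ω) θ - negHess g σ (past y t ω) (y t ω) θ‖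
        ≤ C ω * ρ ^ t) :
    ∀ᵐ ω ∂P, ∀ t : ℕ, 1 ≤ t → ∀ θ ∈ _root_.interior Θ,
      ‖score g σ (obsPast y y0 t ω) (y t ω) θ - score g σ (past y t ω) (y t ω) θ‖ ≤ C ω * ρ ^ t ∧
      ‖hessMat (logLik g σ (obsPast y y0 t ω) (y t ω)) θ -
        hessMat (logLik g σ (past y t ω) (y t ω)) θ‖ ≤ C ω * ρ ^ t := by
  refine ae_all_iff.2 fun t => ?_
  by_cases ht : 1 ≤ t
  · filter_upwards [hinit t ht] with ω hω _ θ hθ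
    have h1 := hω θ hθ
    have h2 := norm_nonneg
      (score g σ (obsPast y y0 t ω) (y t ω) θ - score g σ (past y t ω) (y t ω) θ)
    have h3 := norm_nonneg (negHess g σ (obsPast y y0 t ω) (y t ω) θ -
      negHess g σ (past y t ω) (y t ω) θ)
    exact ⟨by linarith, le_trans (le_of_eq rfl) (show ‖negHess g σ (obsPast y y0 t ω) (y t ω) θ -
      negHess g σ (past y t ω) (y t ω) θ‖ ≤ _ by linarith)⟩
  · exact ae_of_all _ fun ω h => absurd h ht

theorem tendsto_mul_pow (c : ℝ) {ρ : ℝ} (hρ0 : 0 < ρ) (hρ1 : ρ < 1) :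
    Tendsto (fun t : ℕ => c * ρ ^ t) atTop (𝓝 0) := by
  simpa using (tendsto_pow_atTop_nhds_zero_of_lt_one hρ0.le hρ1).const_mul c

/-- Consistency of the averaged Hessian at a consistent estimator. -/
theorem tendsto_hatA (M : IsModel P g σ Θ θ₀ y η) (hCm : Measurable C) (hρ0 : 0 < ρ) (hρ1 : ρ < 1)
    (hinit : ∀ t : ℕ, 1 ≤ t → ∀ᵐ ω ∂P, ∀ θ ∈ _root_.interior Θ,
      ‖score g σ (obsPast y y0 t ω) (y t ω) θ - score g σ (past y t ω) (y t ω) θ‖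
        + ‖negHess g σ (obsPast y y0 t ω) (y t ω) θ - negHess g σ (past y t ω) (y t ω) θ‖
        ≤ C ω * ρ ^ t)
    (hcons : Tendsto (fun p : ℕ × Ω => θhat p.1 p.2) (inProb P) (𝓝 θ₀)) :
    Tendsto (fun p : ℕ × Ω => hatA g σ y y0 (θhat p.1) p.1 p.2) (inProb P)
      (𝓝 (expMatrix P fun ω => hessMat (logLik g σ (past y 0 ω) (y 0 ω)) θ₀)) := by
  obtain ⟨r, m, hr0, hball, hmm, hm0, hmi, hmε, hmle⟩ := M.exists_hess_modulus
  have L0 := M.tendsto_avg_hess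
  have L1 : Tendsto (fun p : ℕ × Ω => avg p.1 fun t => C p.2 * ρ ^ t) (inProb P) (𝓝 0) :=
    tendsto_avg_inProb_zero (S := fun t ω => C ω * ρ ^ t) (fun t _ => hCm.mul_const _)
      (ae_of_all _ fun ω => tendsto_mul_pow _ hρ0 hρ1)
  have hdiff : Tendsto (fun p : ℕ × Ω => hatA g σ y y0 (θhat p.1) p.1 p.2 -
      (p.1 : ℝ)⁻¹ • ∑ t ∈ Finset.Icc 1 p.1, hessMat (logLik g σ (past y t p.2) (y t p.2)) θ₀)
      (inProb P) (𝓝 0) := by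
    rw [Metric.tendsto_nhds]
    intro ε hε
    -- Half of `ε` goes to the oscillation of the Hessian on a small ball, the other half to the
    -- initial value.
    obtain ⟨δ, hδ0, hδr, hδε⟩ := hmε (ε / 2) (by positivity)
    have L2 := tendsto_avg_obs M.y_meas M.erg (hmm δ) (hmi δ hδr)
    have A : ∀ᵐ ω ∂P, ∀ t : ℕ, ∀ δ ≤ r, ∀ θ ∈ Metric.ball θ₀ δ,
        ‖hessMat (logLik g σ (past y t ω) (y t ω)) θ -
          hessMat (logLik g σ (past y t ω) (y t ω)) θ₀‖ ≤ m δ (obs y t ω) :=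
      ae_all_iff.2 fun t => hmle t
    filter_upwards [L1.eventually_lt_const (show 0 < ε / 2 by positivity),
      L2.eventually_lt_const hδε, hcons.eventually_mem (Metric.ball_mem_nhds θ₀ hδ0),
      eventually_inProb_of_ae (fun _ => A),
      eventually_inProb_of_ae (fun _ => ae_score_approx hinit)] with p h1 h2 h3 h4 h5
    rw [dist_zero_right]
    refine lt_of_le_of_lt (norm_smul_sum_sub_le p.1
      (fun t => negHess g σ (obsPast y y0 t p.2) (y t p.2) (θhat p.1 p.2)) _
      (a := fun t => C p.2 * ρ ^ t + m δ (obs y t p.2)) fun t ht => ?_) ?_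
    · have h6 := (h5 t (Finset.mem_Icc.1 ht).1 (θhat p.1 p.2)
        (hball (Metric.ball_subset_ball hδr h3))).2
      have h7 := h4 t δ hδr (θhat p.1 p.2) h3
      refine le_trans ?_ (add_le_add h6 h7)
      exact norm_sub_le_norm_sub_add_norm_sub _ _ _
    · rw [avg_add]
      linarith
  have := hdiff.add L0
  simpa using this

theorem dirScore_eq_sum (w : EuclideanSpace ℝ (Fin d)) (z : (ℕ → ℝ) × ℝ) :
    dirScore g σ θ₀ w z = ∑ i, w i * dirScore g σ θ₀ (EuclideanSpace.single i 1) z := by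
  have hsum : w = ∑ i, w i • EuclideanSpace.single i (1 : ℝ) := by
    simpa using ((EuclideanSpace.basisFun (Fin d) ℝ).sum_repr w).symm
  unfold dirScore
  conv_lhs => rw [hsum]
  simp only [map_sum, map_smul, smul_eq_mul]

theorem abs_avg_dirScore_le (w : EuclideanSpace ℝ (Fin d)) (n : ℕ) (z : ℕ → (ℕ → ℝ) × ℝ) :
    |avg n fun t => dirScore g σ θ₀ w (z t)| ≤
      ‖w‖ * ∑ i, |avg n fun t => dirScore g σ θ₀ (EuclideanSpace.single i 1) (z t)| := by
  have h1 : (avg n fun t => dirScore g σ θ₀ w (z t)) =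
      ∑ i, w i * avg n fun t => dirScore g σ θ₀ (EuclideanSpace.single i 1) (z t) := by
    simp only [avg, dirScore_eq_sum w, Finset.mul_sum]
    rw [Finset.sum_comm]
    exact Finset.sum_congr rfl fun i _ => Finset.sum_congr rfl fun t _ => by ring
  rw [h1, Finset.mul_sum]
  refine (Finset.abs_sum_le_sum_abs _ _).trans (Finset.sum_le_sum fun i _ => ?_)
  rw [abs_mul]
  gcongr
  exact PiLp.norm_apply_le w i

/-- The first-order condition at an interior maximizer. -/
theorem sum_fderiv_eq_zero (M : IsModel P g σ Θ θ₀ y η) {n : ℕ} {ω : Ω}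
    {θ : EuclideanSpace ℝ (Fin d)} (hθ : θ ∈ _root_.interior Θ)
    (hmax : IsMaxOn (quasiLogLik g σ y y0 n ω) Θ θ) (w : EuclideanSpace ℝ (Fin d)) :
    ∑ t ∈ Finset.Icc 1 n, fderiv ℝ (logLik g σ (obsPast y y0 t ω) (y t ω)) θ w = 0 := by
  have h1 : IsLocalMax (quasiLogLik g σ y y0 n ω) θ :=
    hmax.isLocalMax (mem_interior_iff_mem_nhds.1 hθ)
  have h2 : fderiv ℝ (quasiLogLik g σ y y0 n ω) θ =
      ∑ t ∈ Finset.Icc 1 n, fderiv ℝ (logLik g σ (obsPast y y0 t ω) (y t ω)) θ :=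
    fderiv_fun_sum fun t _ =>
      differentiableAt_of_contDiffOn_two isOpen_interior (M.contDiffOn_ℓ _ _) hθ
  rw [← _root_.sum_apply, ← h2, h1.fderiv_eq_zero]
  rfl

/-- The estimation error is controlled by the averaged score at the true parameter. -/
theorem exists_rate (M : IsModel P g σ Θ θ₀ y η)
    (hinit : ∀ t : ℕ, 1 ≤ t → ∀ᵐ ω ∂P, ∀ θ ∈ _root_.interior Θ,
      ‖score g σ (obsPast y y0 t ω) (y t ω) θ - score g σ (past y t ω) (y t ω) θ‖
        + ‖negHess g σ (obsPast y y0 t ω) (y t ω) θ - negHess g σ (past y t ω) (y t ω) θ‖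
        ≤ C ω * ρ ^ t)
    (hθhat : ∀ n, ∀ᵐ ω ∂P, θhat n ω ∈ Θ ∧ IsMaxOn (quasiLogLik g σ y y0 n ω) Θ (θhat n ω))
    (hcons : Tendsto (fun p : ℕ × Ω => θhat p.1 p.2) (inProb P) (𝓝 θ₀)) :
    ∃ K : ℝ, 0 ≤ K ∧ ∀ᶠ p in inProb P, ‖θhat p.1 p.2 - θ₀‖ ≤
      K * ((avg p.1 fun t => C p.2 * ρ ^ t) +
        ∑ i, |avg p.1 fun t => dirScore g σ θ₀ (EuclideanSpace.single i 1) (obs y t p.2)|) := by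
  obtain ⟨r, m, hr0, hball, hmm, hm0, hmi, hmε, hmle⟩ := M.exists_hess_modulus
  set A₀ := expMatrix P fun ω => hessMat (logLik g σ (past y 0 ω) (y 0 ω)) θ₀ with hA₀
  obtain ⟨c, hc, hcle⟩ := exists_mul_sq_le_bilin A₀ fun w hw => by
    rw [hA₀, M.bilin_expMatrix]
    exact M.integral_bilin_hess_pos 0 hw
  -- Replacing `A₀` by the sample Hessian costs `c / 4` and the oscillation another `c / 4`. Of the
  -- curvature `c` there remains `c / 2`, whence the constant `2 / c` below.
  obtain ⟨δ, hδ0, hδr, hδε⟩ := hmε (c / 4) (by positivity)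
  have L2 := tendsto_avg_obs M.y_meas M.erg (hmm δ) (hmi δ hδr)
  have A : ∀ᵐ ω ∂P, ∀ t : ℕ, ∀ δ ≤ r, ∀ θ ∈ Metric.ball θ₀ δ,
      ‖hessMat (logLik g σ (past y t ω) (y t ω)) θ -
        hessMat (logLik g σ (past y t ω) (y t ω)) θ₀‖ ≤ m δ (obs y t ω) :=
    ae_all_iff.2 fun t => hmle t
  refine ⟨2 / c, by positivity, ?_⟩
  filter_upwards [L2.eventually_lt_const hδε, hcons.eventually_mem (Metric.ball_mem_nhds θ₀ hδ0),
    M.tendsto_avg_hess.eventually_mem (Metric.ball_mem_nhds _ (show 0 < c / 4 by positivity)),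
    eventually_inProb_of_ae (fun _ => A), eventually_inProb_of_ae hθhat,
    eventually_inProb_of_ae (fun _ => ae_score_approx hinit)] with p h1 h2 h3 h4 h5 h6
  set x := θhat p.1 p.2 - θ₀ with hx
  have hint : θhat p.1 p.2 ∈ _root_.interior Θ := hball (Metric.ball_subset_ball hδr h2)
  have hfoc := M.sum_fderiv_eq_zero hint h5.2 x
  -- Expansion of the score in the direction of the error `x` itself. The first term on the right
  -- disappears after summation by the first-order condition.
  have hterm : ∀ t ∈ Finset.Icc 1 p.1,
      bilin (hessMat (logLik g σ (past y t p.2) (y t p.2)) θ₀) x x ≤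
        fderiv ℝ (logLik g σ (obsPast y y0 t p.2) (y t p.2)) (θhat p.1 p.2) (-x) +
        dirScore g σ θ₀ x (obs y t p.2) + ‖x‖ * (C p.2 * ρ ^ t) +
        ‖x‖ ^ 2 * m δ (obs y t p.2) := by
    intro t ht
    have e1 := norm_fderiv_sub_le ((Metric.ball_subset_ball hδr).trans hball) isOpen_interior
      (M.contDiffOn_ℓ (past y t p.2) (y t p.2)) h2 (h4 t δ hδr) x
    have e2 := (h6 t (Finset.mem_Icc.1 ht).1 _ hint).1
    have e3 : |fderiv ℝ (logLik g σ (obsPast y y0 t p.2) (y t p.2)) (θhat p.1 p.2) x -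
        fderiv ℝ (logLik g σ (past y t p.2) (y t p.2)) (θhat p.1 p.2) x| ≤
        (C p.2 * ρ ^ t) * ‖x‖ := by
      rw [← inner_score, ← inner_score, ← inner_sub_left]
      exact (abs_real_inner_le_norm _ _).trans (by gcongr)
    have e4 := (abs_le.1 e1).2
    have e5 := (abs_le.1 e3).2
    have e6 : dirScore g σ θ₀ x (obs y t p.2) =
      fderiv ℝ (logLik g σ (past y t p.2) (y t p.2)) θ₀ x := rfl
    rw [map_neg, e6]
    rw [← hx] at e4
    nlinarith
  have hsum : bilin ((p.1 : ℝ)⁻¹ • ∑ t ∈ Finset.Icc 1 p.1,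
      hessMat (logLik g σ (past y t p.2) (y t p.2)) θ₀) x x ≤
      (avg p.1 fun t => dirScore g σ θ₀ x (obs y t p.2)) +
        ‖x‖ * (avg p.1 fun t => C p.2 * ρ ^ t) +
        ‖x‖ ^ 2 * avg p.1 fun t => m δ (obs y t p.2) := by
    rw [bilin_smul, bilin_sum, ← avg_const_mul, ← avg_const_mul, ← avg_add, ← avg_add]
    have h7 := avg_le_avg hterm
    have h8 : (avg p.1 fun t =>
        fderiv ℝ (logLik g σ (obsPast y y0 t p.2) (y t p.2)) (θhat p.1 p.2) (-x)) = 0 := by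
      simp only [avg, map_neg, Finset.sum_neg_distrib, hfoc, neg_zero, mul_zero]
    simp only [avg_add, h8, zero_add] at h7 ⊢
    exact h7
  have hlow : (c - c / 4) * ‖x‖ ^ 2 ≤ bilin ((p.1 : ℝ)⁻¹ • ∑ t ∈ Finset.Icc 1 p.1,
      hessMat (logLik g σ (past y t p.2) (y t p.2)) θ₀) x x := by
    have h7 := hcle x
    have h8 := abs_bilin_le ((p.1 : ℝ)⁻¹ • ∑ t ∈ Finset.Icc 1 p.1,
      hessMat (logLik g σ (past y t p.2) (y t p.2)) θ₀ - A₀) x x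
    rw [bilin_sub] at h8
    rw [Metric.mem_ball, dist_eq_norm] at h3
    have h9 := (abs_le.1 h8).1
    have h10 := mul_le_mul_of_nonneg_right h3.le (sq_nonneg ‖x‖)
    nlinarith
  have hdir := (le_abs_self _).trans (abs_avg_dirScore_le (g := g) (σ := σ) (θ₀ := θ₀) x p.1
    fun t => obs y t p.2)
  have hm4 : ‖x‖ ^ 2 * (avg p.1 fun t => m δ (obs y t p.2)) ≤ ‖x‖ ^ 2 * (c / 4) := by gcongr
  set a := avg p.1 fun t => C p.2 * ρ ^ t
  set b := ∑ i, |avg p.1 fun t => dirScore g σ θ₀ (EuclideanSpace.single i 1) (obs y t p.2)|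
  have hfin : c / 2 * ‖x‖ ^ 2 ≤ ‖x‖ * (a + b) := by linarith
  rcases (norm_nonneg x).eq_or_lt with h0 | h0
  · rw [← h0]
    have ha : 0 ≤ a := by
      refine avg_nonneg fun t ht => ?_
      exact (norm_nonneg _).trans (h6 t (Finset.mem_Icc.1 ht).1 _ hint).1
    have hb : 0 ≤ b := Finset.sum_nonneg fun i _ => abs_nonneg _
    positivity
  · have h7 : c / 2 * ‖x‖ ≤ a + b := by
      have : ‖x‖ * (c / 2 * ‖x‖) ≤ ‖x‖ * (a + b) := by linarith
      exact le_of_mul_le_mul_left this h0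
    rw [div_mul_eq_mul_div, le_div_iff₀ hc]
    linarith

end IsModel

end

section

/-! ### Mean-square closeness of the scores and the outer-product average. -/

variable {Ω : Type*} [MeasurableSpace Ω] {P : Measure Ω} [IsProbabilityMeasure P]

/-- For an integrable stationary ergodic sequence, the average of squares is of smaller order than
`n`. -/
theorem tendsto_sqrt_inv_mul_avg_sq {y : ℤ → Ω → ℝ} (hy : ∀ t, Measurable (y t))
    (he : StationaryErgodic P y) {Z : (ℕ → ℝ) × ℝ → ℝ} (hZ : Measurable Z) (hZ0 : ∀ z, 0 ≤ Z z)
    (hint : Integrable (fun ω => Z (obs y 0 ω)) P) :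
    Tendsto (fun p : ℕ × Ω => Real.sqrt ((p.1 : ℝ)⁻¹ * avg p.1 fun t => Z (obs y t p.2) ^ 2))
      (inProb P) (𝓝 0) := by
  have htail : Tendsto (fun k : ℕ => ∫ ω, max (Z (obs y 0 ω) - k) 0 ∂P) atTop (𝓝 0) := by
    suffices hs : Tendsto (fun k : ℕ => ∫ ω, max (Z (obs y 0 ω) - k) 0 ∂P) atTop
        (𝓝 (∫ _ : Ω, (0 : ℝ) ∂P)) by rwa [integral_zero] at hs
    refine tendsto_integral_of_dominated_convergence (fun ω => Z (obs y 0 ω)) (fun k => ?_) hint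
      (fun k => ae_of_all _ fun ω => ?_) (ae_of_all _ fun ω => ?_)
    · exact ((hint.1.sub aestronglyMeasurable_const).sup aestronglyMeasurable_const)
    · rw [Real.norm_of_nonneg (le_max_right _ _)]
      exact max_le (by linarith [Nat.cast_nonneg (α := ℝ) k]) (hZ0 _)
    · refine tendsto_const_nhds.congr' ?_
      filter_upwards [eventually_ge_atTop ⌈Z (obs y 0 ω)⌉₊] with k hk
      have := Nat.ceil_le.1 hk
      rw [max_eq_right (by linarith)]
  rw [Metric.tendsto_nhds]
  intro ε hε
  -- One has `Z ≤ k + (Z - k)⁺`, and the sum of squares of the excesses is at most the square of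
  -- their sum. Hence `n⁻² ∑ Z² ≤ 2k² / n + 2 (avg (Z - k)⁺)² < ε² / 2 + 2 (ε / 2)²`.
  obtain ⟨k, hk⟩ := (htail.eventually_lt_const (show 0 < ε / 2 by positivity)).exists
  have hWm : Measurable fun z => max (Z z - k) 0 := (hZ.sub_const _).max measurable_const
  have hWi : Integrable (fun ω => max (Z (obs y 0 ω) - k) 0) P := by
    refine hint.mono' (hWm.comp (measurable_obs hy 0)).aestronglyMeasurable
      (ae_of_all _ fun ω => ?_)
    rw [Real.norm_of_nonneg (le_max_right _ _)]
    exact max_le (by linarith [Nat.cast_nonneg (α := ℝ) k]) (hZ0 _)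
  have L := tendsto_avg_obs hy he hWm hWi
  have hn : Tendsto (fun n : ℕ => 2 * (k : ℝ) ^ 2 * (n : ℝ)⁻¹) atTop (𝓝 0) := by
    simpa using (tendsto_inv_atTop_nhds_zero_nat (𝕜 := ℝ)).const_mul (2 * (k : ℝ) ^ 2)
  filter_upwards [L.eventually_lt_const hk,
    tendsto_fst_inProb.eventually (hn.eventually_lt_const (show 0 < ε ^ 2 / 2 by positivity)),
    tendsto_fst_inProb.eventually (eventually_gt_atTop 0)] with p h1 h2 h3
  have hp : (0 : ℝ) < p.1 := by exact_mod_cast h3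
  rw [dist_zero_right, Real.norm_of_nonneg (Real.sqrt_nonneg _), Real.sqrt_lt' hε]
  have h4 : ∑ t ∈ Finset.Icc 1 p.1, Z (obs y t p.2) ^ 2 ≤
      2 * p.1 * (k : ℝ) ^ 2 + 2 * (∑ t ∈ Finset.Icc 1 p.1, max (Z (obs y t p.2) - k) 0) ^ 2 := by
    have h5 := Finset.sum_sq_le_sq_sum_of_nonneg (s := Finset.Icc 1 p.1)
      (f := fun t : ℕ => max (Z (obs y t p.2) - k) 0) fun t _ => le_max_right _ _
    have h6 : ∑ t ∈ Finset.Icc 1 p.1, Z (obs y t p.2) ^ 2 ≤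
        ∑ t ∈ Finset.Icc 1 p.1, (2 * (k : ℝ) ^ 2 + 2 * max (Z (obs y t p.2) - k) 0 ^ 2) := by
      refine Finset.sum_le_sum fun t _ => ?_
      have h7 := le_max_left (Z (obs y t p.2) - k) 0
      have h8 := hZ0 (obs y t p.2)
      nlinarith [sq_nonneg ((k : ℝ) - max (Z (obs y t p.2) - k) 0)]
    rw [Finset.sum_add_distrib, ← Finset.mul_sum, ← Finset.mul_sum, Finset.sum_const, Nat.card_Icc,
      Nat.add_sub_cancel, nsmul_eq_mul] at h6
    linarith
  have h9 : 0 ≤ avg p.1 fun t => max (Z (obs y t p.2) - k) 0 :=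
    avg_nonneg fun t _ => le_max_right _ _
  calc (p.1 : ℝ)⁻¹ * avg p.1 (fun t => Z (obs y t p.2) ^ 2)
      ≤ (p.1 : ℝ)⁻¹ * ((p.1 : ℝ)⁻¹ * (2 * p.1 * (k : ℝ) ^ 2 +
        2 * (∑ t ∈ Finset.Icc 1 p.1, max (Z (obs y t p.2) - k) 0) ^ 2)) := by
        unfold avg; gcongr
    _ = 2 * (k : ℝ) ^ 2 * (p.1 : ℝ)⁻¹ + 2 * (avg p.1 fun t => max (Z (obs y t p.2) - k) 0) ^ 2 := by
        unfold avg; field_simp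
    _ < ε ^ 2 := by nlinarith

/-- The geometric sum stays bounded, so the initial value contributes only order `n^(-1/2)` after
scaling by `√n`. -/
theorem tendsto_sqrt_mul_avg_pow {C : Ω → ℝ} (hCm : Measurable C) {ρ : ℝ} (hρ0 : 0 < ρ)
    (hρ1 : ρ < 1) :
    Tendsto (fun p : ℕ × Ω => Real.sqrt p.1 * avg p.1 fun t => C p.2 * ρ ^ t) (inProb P)
      (𝓝 0) := by
  refine tendsto_inProb_of_ae (f := fun n ω => Real.sqrt n * avg n fun t => C ω * ρ ^ t)
    (fun n => ?_) (ae_of_all _ fun ω => ?_)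
  · exact (((Finset.measurable_sum _ fun t _ => hCm.mul_const _).const_mul _).const_mul
      _).aestronglyMeasurable
  · have h1 : Tendsto (fun n : ℕ => (Real.sqrt n)⁻¹ * (|C ω| * ∑' t : ℕ, ρ ^ t)) atTop (𝓝 0) := by
      simpa using ((Real.tendsto_sqrt_atTop.comp
        tendsto_natCast_atTop_atTop).inv_tendsto_atTop).mul_const (|C ω| * ∑' t : ℕ, ρ ^ t)
    refine squeeze_zero_norm (fun n => ?_) h1
    have h2 : Real.sqrt n * (n : ℝ)⁻¹ = (Real.sqrt n)⁻¹ := by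
      rw [← div_eq_mul_inv, Real.sqrt_div_self']
      exact one_div _
    unfold avg
    rw [← mul_assoc, h2, ← Finset.mul_sum, norm_mul, norm_mul, Real.norm_of_nonneg (by positivity),
      Real.norm_eq_abs, Real.norm_of_nonneg (Finset.sum_nonneg fun t _ => by positivity)]
    gcongr
    exact (summable_geometric_of_lt_one hρ0.le hρ1).sum_le_tsum _ fun t _ => by positivity

namespace IsModel

variable {d : ℕ}
  {g σ : (ℕ → ℝ) → EuclideanSpace ℝ (Fin d) → ℝ} {Θ : Set (EuclideanSpace ℝ (Fin d))}
  {θ₀ : EuclideanSpace ℝ (Fin d)} {y η : ℤ → Ω → ℝ} {y0 : Ω → ℕ → ℝ}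
  {θhat : ℕ → Ω → EuclideanSpace ℝ (Fin d)} {C : Ω → ℝ} {ρ : ℝ}

/-- The score is Lipschitz near the true parameter, with an integrable stationary constant. -/
theorem exists_score_lipschitz (M : IsModel P g σ Θ θ₀ y η) :
    ∃ (r : ℝ) (Z : (ℕ → ℝ) × ℝ → ℝ), 0 < r ∧ Metric.ball θ₀ r ⊆ _root_.interior Θ ∧
      Measurable Z ∧ (∀ z, 0 ≤ Z z) ∧ Integrable (fun ω => Z (obs y 0 ω)) P ∧
      ∀ t : ℤ, ∀ᵐ ω ∂P, ∀ θ ∈ Metric.ball θ₀ r,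
        ‖score g σ (past y t ω) (y t ω) θ - score g σ (past y t ω) (y t ω) θ₀‖ ≤
          Z (obs y t ω) * ‖θ - θ₀‖ := by
  obtain ⟨r, m, hr0, hball, hmm, hm0, hmi, -, hmle⟩ := M.exists_hess_modulus
  refine ⟨r, fun z => m r z + ∑ i, ∑ j, |hessMat (logLik g σ z.1 z.2) θ₀ i j|, hr0, hball, ?_,
    fun z => ?_, ?_, fun t => ?_⟩
  · exact (hmm r).add (Finset.measurable_sum _ fun i _ => Finset.measurable_sum _ fun j _ =>
      (M.measurable_hess_entry M.interior i j).abs)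
  · exact add_nonneg (hm0 r z)
      (Finset.sum_nonneg fun i _ => Finset.sum_nonneg fun j _ => abs_nonneg _)
  · exact (hmi r le_rfl).add (integrable_finsetSum _ fun i _ => integrable_finsetSum _ fun j _ =>
      (M.integrable_hess_entry 0 i j).abs)
  · filter_upwards [hmle t] with ω hω θ hθ
    set D := score g σ (past y t ω) (y t ω) θ - score g σ (past y t ω) (y t ω) θ₀ with hD
    set A := hessMat (logLik g σ (past y t ω) (y t ω)) θ₀ with hA
    -- The score difference `D` is tested against itself, so that one factor `‖D‖` cancels at the
    -- end.
    have e1 := norm_fderiv_sub_le hball isOpen_interior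
      (M.contDiffOn_ℓ (past y t ω) (y t ω)) hθ (hω r le_rfl) D
    rw [← inner_score, ← inner_score, ← inner_sub_left, ← hD, real_inner_self_eq_norm_sq] at e1
    have e2 : |bilin A (θ - θ₀) D| ≤ (∑ i, ∑ j, |A i j|) * ‖θ - θ₀‖ * ‖D‖ := by
      simp only [bilin, Finset.sum_mul]
      refine (Finset.abs_sum_le_sum_abs _ _).trans (Finset.sum_le_sum fun i _ => ?_)
      refine (Finset.abs_sum_le_sum_abs _ _).trans (Finset.sum_le_sum fun j _ => ?_)
      rw [abs_mul, abs_mul, mul_comm |(θ - θ₀) i|]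
      gcongr
      · exact PiLp.norm_apply_le (θ - θ₀) i
      · exact PiLp.norm_apply_le D j
    have e3 := (abs_le.1 e1).2
    have e4 := (abs_le.1 e2).1
    rcases (norm_nonneg D).eq_or_lt with h0 | h0
    · rw [← h0]
      exact mul_nonneg (add_nonneg (hm0 r _)
        (Finset.sum_nonneg fun i _ => Finset.sum_nonneg fun j _ => abs_nonneg _)) (norm_nonneg _)
    · refine le_of_mul_le_mul_right ?_ h0
      change ‖D‖ * ‖D‖ ≤ (m r (obs y t ω) + ∑ i, ∑ j, |A i j|) * ‖θ - θ₀‖ * ‖D‖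
      linarith

/-- The feasible scores at the estimator are close in mean square to the scores at the true
parameter. -/
theorem tendsto_avg_score_sub (M : IsModel P g σ Θ θ₀ y η) (hCm : Measurable C)
    (hρ0 : 0 < ρ) (hρ1 : ρ < 1)
    (hinit : ∀ t : ℕ, 1 ≤ t → ∀ᵐ ω ∂P, ∀ θ ∈ _root_.interior Θ,
      ‖score g σ (obsPast y y0 t ω) (y t ω) θ - score g σ (past y t ω) (y t ω) θ‖
        + ‖negHess g σ (obsPast y y0 t ω) (y t ω) θ - negHess g σ (past y t ω) (y t ω) θ‖
        ≤ C ω * ρ ^ t)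
    (hθhat : ∀ n, ∀ᵐ ω ∂P, θhat n ω ∈ Θ ∧ IsMaxOn (quasiLogLik g σ y y0 n ω) Θ (θhat n ω))
    (hcons : Tendsto (fun p : ℕ × Ω => θhat p.1 p.2) (inProb P) (𝓝 θ₀)) :
    Tendsto (fun p : ℕ × Ω => avg p.1 fun t =>
      ‖score g σ (obsPast y y0 t p.2) (y t p.2) (θhat p.1 p.2) -
        score g σ (past y t p.2) (y t p.2) θ₀‖ ^ 2) (inProb P) (𝓝 0) := by
  obtain ⟨r, Z, hr0, hball, hZm, hZ0, hZi, hZle⟩ := M.exists_score_lipschitz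
  obtain ⟨K, hK0, hK⟩ := M.exists_rate hinit hθhat hcons
  set Q : ℕ → Ω → ℝ := fun n ω => Real.sqrt ((n : ℝ)⁻¹ * avg n fun t => Z (obs y t ω) ^ 2) with hQ
  have LQ : Tendsto (fun p : ℕ × Ω => Q p.1 p.2) (inProb P) (𝓝 0) :=
    tendsto_sqrt_inv_mul_avg_sq M.y_meas M.erg hZm hZ0 hZi
  have L1 : Tendsto (fun p : ℕ × Ω => avg p.1 fun t => (C p.2 * ρ ^ t) ^ 2) (inProb P) (𝓝 0) :=
    tendsto_avg_inProb_zero (S := fun t ω => (C ω * ρ ^ t) ^ 2)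
      (fun t _ => (hCm.mul_const _).pow_const 2)
      (ae_of_all _ fun ω => by simpa using (tendsto_mul_pow (C ω) hρ0 hρ1).pow 2)
  have L2 := (tendsto_sqrt_mul_avg_pow (P := P) hCm hρ0 hρ1).mul LQ
  have L3 : Tendsto (fun p : ℕ × Ω => ∑ i, |Real.sqrt p.1 *
      (avg p.1 fun t => dirScore g σ θ₀ (EuclideanSpace.single i 1) (obs y t p.2)) * Q p.1 p.2|)
      (inProb P) (𝓝 0) := by
    have := tendsto_finsetSum (Finset.univ : Finset (Fin d)) fun i _ =>
      (M.tendsto_score_mul (EuclideanSpace.single i 1) LQ).abs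
    simpa using this
  have L4 := (L1.const_mul 2).add ((((L2.add L3).const_mul K).pow 2).const_mul 2)
  simp only [mul_zero, add_zero, ne_eq, OfNat.ofNat_ne_zero, not_false_eq_true, zero_pow] at L4
  have A : ∀ᵐ ω ∂P, ∀ t : ℕ, ∀ θ ∈ Metric.ball θ₀ r,
      ‖score g σ (past y t ω) (y t ω) θ - score g σ (past y t ω) (y t ω) θ₀‖ ≤
        Z (obs y t ω) * ‖θ - θ₀‖ := ae_all_iff.2 fun t => hZle t
  refine squeeze_zero' (Eventually.of_forall fun p => avg_nonneg fun t _ => sq_nonneg _) ?_ L4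
  filter_upwards [hK, hcons.eventually_mem (Metric.ball_mem_nhds θ₀ hr0),
    eventually_inProb_of_ae (fun _ => A),
    eventually_inProb_of_ae (fun _ => ae_score_approx hinit)] with p h1 h2 h3 h4
  set x := θhat p.1 p.2 - θ₀ with hx
  have h5 : (avg p.1 fun t => ‖score g σ (obsPast y y0 t p.2) (y t p.2) (θhat p.1 p.2) -
      score g σ (past y t p.2) (y t p.2) θ₀‖ ^ 2) ≤
      avg p.1 fun t => 2 * (C p.2 * ρ ^ t) ^ 2 + (2 * ‖x‖ ^ 2) * Z (obs y t p.2) ^ 2 := by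
    refine avg_le_avg fun t ht => ?_
    have e1 := (h4 t (Finset.mem_Icc.1 ht).1 _ (hball h2)).1
    have e2 := h3 t _ h2
    have e3 := (norm_sub_le_norm_sub_add_norm_sub
      (score g σ (obsPast y y0 t p.2) (y t p.2) (θhat p.1 p.2))
      (score g σ (past y t p.2) (y t p.2) (θhat p.1 p.2))
      (score g σ (past y t p.2) (y t p.2) θ₀)).trans (add_le_add e1 e2)
    have e4 := pow_le_pow_left₀ (norm_nonneg _) e3 2
    rw [← hx] at e4
    nlinarith [sq_nonneg (C p.2 * ρ ^ t - Z (obs y t p.2) * ‖x‖)]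
  -- The factor `n` is moved from the average of `Z²` to the estimation error: `Q` tends to zero,
  -- and `√n ‖x‖` is controlled by `exists_rate`.
  have h6 : ‖x‖ ^ 2 * (avg p.1 fun t => Z (obs y t p.2) ^ 2) =
      (Real.sqrt p.1 * Q p.1 p.2 * ‖x‖) ^ 2 := by
    rw [mul_pow, mul_pow, hQ, Real.sq_sqrt (by positivity), Real.sq_sqrt]
    · rcases Nat.eq_zero_or_pos p.1 with h0 | h0
      · simp [h0, avg]
      · have : (0 : ℝ) < p.1 := by exact_mod_cast h0
        field_simp
    · exact mul_nonneg (by positivity) (avg_nonneg fun t _ => sq_nonneg _)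
  have hs : 0 ≤ Real.sqrt p.1 * Q p.1 p.2 := mul_nonneg (Real.sqrt_nonneg _) (Real.sqrt_nonneg _)
  have h7 : Real.sqrt p.1 * Q p.1 p.2 * ‖x‖ ≤
      K * (Real.sqrt p.1 * (avg p.1 fun t => C p.2 * ρ ^ t) * Q p.1 p.2 + ∑ i, |Real.sqrt p.1 *
      (avg p.1 fun t => dirScore g σ θ₀ (EuclideanSpace.single i 1) (obs y t p.2)) *
        Q p.1 p.2|) := by
    refine (mul_le_mul_of_nonneg_left h1 hs).trans (le_of_eq ?_)
    simp only [abs_mul, abs_of_nonneg (Real.sqrt_nonneg _), abs_of_nonneg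
      (show 0 ≤ Q p.1 p.2 from Real.sqrt_nonneg _)]
    rw [← Finset.sum_mul, ← Finset.mul_sum]
    ring
  have h8 := pow_le_pow_left₀ (mul_nonneg hs (norm_nonneg x)) h7 2
  rw [avg_add, avg_const_mul, avg_const_mul, mul_assoc, h6] at h5
  linarith

theorem integrable_dirScore_mul (M : IsModel P g σ Θ θ₀ y η) (t : ℤ)
    (u w : EuclideanSpace ℝ (Fin d)) :
    Integrable (fun ω => dirScore g σ θ₀ u (obs y t ω) * dirScore g σ θ₀ w (obs y t ω)) P :=
  (M.memLp_dirScore t u).integrable_mul (M.memLp_dirScore t w)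

theorem outer_score_apply (Y : ℕ → ℝ) (v : ℝ) (i j : Fin d) :
    outer (score g σ Y v θ₀) i j = dirScore g σ θ₀ (EuclideanSpace.single i 1) (Y, v) *
      dirScore g σ θ₀ (EuclideanSpace.single j 1) (Y, v) := by
  simp only [outer, Matrix.of_apply, score_apply, dirScore]

/-- Consistency of the averaged outer product of the scores at the estimator. -/
theorem tendsto_hatB (M : IsModel P g σ Θ θ₀ y η) (hCm : Measurable C)
    (hρ0 : 0 < ρ) (hρ1 : ρ < 1)
    (hinit : ∀ t : ℕ, 1 ≤ t → ∀ᵐ ω ∂P, ∀ θ ∈ _root_.interior Θ,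
      ‖score g σ (obsPast y y0 t ω) (y t ω) θ - score g σ (past y t ω) (y t ω) θ‖
        + ‖negHess g σ (obsPast y y0 t ω) (y t ω) θ - negHess g σ (past y t ω) (y t ω) θ‖
        ≤ C ω * ρ ^ t)
    (hθhat : ∀ n, ∀ᵐ ω ∂P, θhat n ω ∈ Θ ∧ IsMaxOn (quasiLogLik g σ y y0 n ω) Θ (θhat n ω))
    (hcons : Tendsto (fun p : ℕ × Ω => θhat p.1 p.2) (inProb P) (𝓝 θ₀)) :
    Tendsto (fun p : ℕ × Ω => hatB g σ y y0 (θhat p.1) p.1 p.2) (inProb P)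
      (𝓝 (expMatrix P fun ω => outer (score g σ (past y 0 ω) (y 0 ω) θ₀))) := by
  refine tendsto_pi_nhds.2 fun i => tendsto_pi_nhds.2 fun j => ?_
  have hdir := fun k : Fin d => M.measurable_dirScore (EuclideanSpace.single k 1)
  have L1 := M.tendsto_avg_score_sub hCm hρ0 hρ1 hinit hθhat hcons
  have L2 := tendsto_avg_obs M.y_meas M.erg
    (φ := fun z => ∑ k, dirScore g σ θ₀ (EuclideanSpace.single k 1) z ^ 2)
    (Finset.measurable_sum _ fun k _ => (hdir k).pow_const 2)
    (integrable_finsetSum _ fun k _ => (M.memLp_dirScore 0 _).integrable_sq)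
  have L3 := tendsto_avg_obs M.y_meas M.erg
    (φ := fun z => dirScore g σ θ₀ (EuclideanSpace.single i 1) z *
      dirScore g σ θ₀ (EuclideanSpace.single j 1) z)
    ((hdir i).mul (hdir j)) (M.integrable_dirScore_mul 0 _ _)
  -- With `R` the score error and `S` the true score, `(R + S)(R + S)ᵀ - S Sᵀ` has average at most
  -- `avg ‖R‖² + 2 √(avg ‖R‖²) √(avg ‖S‖²)` in each entry.
  have L4 := L1.add ((L1.sqrt.mul L2.sqrt).const_mul 2)
  rw [Real.sqrt_zero, zero_mul, mul_zero, add_zero] at L4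
  have hdiff : Tendsto (fun p : ℕ × Ω => hatB g σ y y0 (θhat p.1) p.1 p.2 i j -
      avg p.1 fun t => dirScore g σ θ₀ (EuclideanSpace.single i 1) (obs y t p.2) *
        dirScore g σ θ₀ (EuclideanSpace.single j 1) (obs y t p.2)) (inProb P) (𝓝 0) := by
    refine squeeze_zero_norm (fun p => ?_) L4
    set R : ℕ → EuclideanSpace ℝ (Fin d) := fun t =>
      score g σ (obsPast y y0 t p.2) (y t p.2) (θhat p.1 p.2) -
        score g σ (past y t p.2) (y t p.2) θ₀ with hR
    set S : ℕ → EuclideanSpace ℝ (Fin d) := fun t => score g σ (past y t p.2) (y t p.2) θ₀ with hS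
    have hSn : ∀ t : ℕ, ∑ k, dirScore g σ θ₀ (EuclideanSpace.single k 1) (obs y t p.2) ^ 2 =
        ‖S t‖ ^ 2 := fun t => by
      rw [EuclideanSpace.norm_sq_eq]
      simp only [hS, score_apply, dirScore, Real.norm_eq_abs, sq_abs, obs]
    have e1 : hatB g σ y y0 (θhat p.1) p.1 p.2 i j -
        (avg p.1 fun t => dirScore g σ θ₀ (EuclideanSpace.single i 1) (obs y t p.2) *
          dirScore g σ θ₀ (EuclideanSpace.single j 1) (obs y t p.2)) =
        avg p.1 fun t => R t i * R t j + R t i * S t j + S t i * R t j := by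
      simp only [hatB, avg, Matrix.smul_apply, Matrix.sum_apply, smul_eq_mul]
      rw [← mul_sub, ← Finset.sum_sub_distrib]
      congr 1
      refine Finset.sum_congr rfl fun t _ => ?_
      have e2 := outer_score_apply (g := g) (σ := σ) (θ₀ := θ₀) (past y t p.2) (y t p.2) i j
      change _ - (dirScore g σ θ₀ (EuclideanSpace.single i 1) (past y t p.2, y t p.2) *
        dirScore g σ θ₀ (EuclideanSpace.single j 1) (past y t p.2, y t p.2)) = _
      rw [← e2]
      simp only [outer, Matrix.of_apply, hR, hS, PiLp.sub_apply]
      ring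
    simp only [hSn]
    rw [e1, Real.norm_eq_abs]
    have e3 := avg_mul_le_sqrt p.1 (fun t => ‖R t‖) fun t => ‖S t‖
    have e4 : |avg p.1 fun t => R t i * R t j + R t i * S t j + S t i * R t j| ≤
        avg p.1 fun t => ‖R t‖ ^ 2 + 2 * (‖R t‖ * ‖S t‖) := by
      unfold avg
      rw [abs_mul, abs_of_nonneg (show (0 : ℝ) ≤ (p.1 : ℝ)⁻¹ by positivity)]
      refine mul_le_mul_of_nonneg_left ((Finset.abs_sum_le_sum_abs _ _).trans
        (Finset.sum_le_sum fun t _ => ?_)) (by positivity)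
      have a1 := fun k => PiLp.norm_apply_le (R t) k
      have a2 := fun k => PiLp.norm_apply_le (S t) k
      have b1 := (abs_mul (R t i) (R t j)).le.trans
        (mul_le_mul (a1 i) (a1 j) (abs_nonneg _) (norm_nonneg _))
      have b2 := (abs_mul (R t i) (S t j)).le.trans
        (mul_le_mul (a1 i) (a2 j) (abs_nonneg _) (norm_nonneg _))
      have b3 := (abs_mul (S t i) (R t j)).le.trans
        (mul_le_mul (a2 i) (a1 j) (abs_nonneg _) (norm_nonneg _))
      refine (abs_add_three _ _ _).trans ?_
      nlinarith
    rw [avg_add p.1 fun t => ‖R t‖ ^ 2, avg_const_mul p.1 2] at e4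
    linarith
  have L5 := hdiff.add L3
  simp only [sub_add_cancel, zero_add] at L5
  convert L5 using 2
  simp only [expMatrix, Matrix.of_apply, outer_score_apply]
  rfl

end IsModel

end

end LQMLE

end

/-! ### The main theorem. -/

open LQMLE in
theorem theorem3 {Ω : Type*} [MeasurableSpace Ω] (P : Measure Ω) [IsProbabilityMeasure P]
    {d : ℕ}
    -- the conditional mean and scale functions
    (g σ : (ℕ → ℝ) → EuclideanSpace ℝ (Fin d) → ℝ)
    (hg_meas : Measurable (Function.uncurry g)) (hσ_meas : Measurable (Function.uncurry σ))
    (hσ_pos : ∀ Y θ, 0 < σ Y θ)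
    (Θ : Set (EuclideanSpace ℝ (Fin d))) (θ₀ : EuclideanSpace ℝ (Fin d))
    -- the process, the innovations and the model equation
    (y η : ℤ → Ω → ℝ) (hy_meas : ∀ t, Measurable (y t)) (hη_meas : ∀ t, Measurable (η t))
    (h_model : ∀ t, ∀ᵐ ω ∂P, y t ω = g (past y t ω) θ₀ + σ (past y t ω) θ₀ * η t ω)
    (hη_past : ∀ t, IndepFun (η t) (past y t) P)
    -- the initial value, which may be a constant
    (y0 : Ω → ℕ → ℝ) (hy0_meas : Measurable y0)
    -- the estimator: a maximizer of the quasi-likelihood over the parameter space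
    (θhat : ℕ → Ω → EuclideanSpace ℝ (Fin d)) (hθhat_meas : ∀ n, AEMeasurable (θhat n) P)
    (hθhat : ∀ n, ∀ᵐ ω ∂P, θhat n ω ∈ Θ ∧ IsMaxOn (quasiLogLik g σ y y0 n ω) Θ (θhat n ω))
    -- compact parameter space
    (h_compact : IsCompact Θ)
    -- i.i.d. symmetric innovations with `E h(η_t) = 1`
    (hη_indep : iIndepFun η P) (hη_ident : ∀ t u, IdentDistrib (η t) (η u) P P)
    (hη_symm : ∀ t, IdentDistrib (η t) (fun ω => -η t ω) P P)
    (hη_psi : ∀ t, ∫ ω, h (η t ω) ∂P = 1)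
    -- strict stationarity and ergodicity
    (hy_erg : StationaryErgodic P y)
    -- the scale is bounded away from zero
    (hσ_low : ∃ σlow : ℝ, 0 < σlow ∧ ∀ t, ∀ θ ∈ Θ, ∀ᵐ ω ∂P, σlow < σ (past y t ω) θ)
    -- continuity in the parameter
    (h_cont : ∀ Y, ContinuousOn (g Y) Θ ∧ ContinuousOn (σ Y) Θ)
    -- identification
    (h_ident : ∀ t, ∀ θ ∈ Θ,
      (∀ᵐ ω ∂P, g (past y t ω) θ = g (past y t ω) θ₀ ∧ σ (past y t ω) θ = σ (past y t ω) θ₀) ↔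
        θ = θ₀)
    -- fractional moments
    (h_mom : ∃ ι : ℝ, 0 < ι ∧ ∀ t,
      ∫⁻ ω, (⨆ θ ∈ Θ, ENNReal.ofReal (|g (past y t ω) θ| ^ ι)) ∂P
        + ∫⁻ ω, ENNReal.ofReal (σ (past y t ω) θ₀ ^ ι) ∂P < ∞)
    -- the effect of the initial value on the mean and the squared scale
    (h_init : ∃ C₁ : Ω → ℝ, Measurable[pastSigma y 0] C₁ ∧ (∀ ω, 0 ≤ C₁ ω) ∧
      ∃ ρ₁ : ℝ, 0 < ρ₁ ∧ ρ₁ < 1 ∧ ∀ t : ℕ, 1 ≤ t → ∀ᵐ ω ∂P, ∀ θ ∈ Θ,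
        |g (obsPast y y0 t ω) θ - g (past y t ω) θ|
          + |σ (obsPast y y0 t ω) θ ^ 2 - σ (past y t ω) θ ^ 2| ≤ C₁ ω * ρ₁ ^ t)
    -- the true parameter is an interior point
    (hθ₀ : θ₀ ∈ interior Θ)
    -- `0 < E (h(η_t) - 1)² < ∞`
    (hη_two : ∀ t, 0 < ∫⁻ ω, ENNReal.ofReal ((h (η t ω) - 1) ^ 2) ∂P ∧
      ∫⁻ ω, ENNReal.ofReal ((h (η t ω) - 1) ^ 2) ∂P < ∞)
    -- two continuous derivatives in the parameter
    (h_C2 : ∀ Y, ContDiffOn ℝ 2 (g Y) (interior Θ) ∧ ContDiffOn ℝ 2 (σ Y) (interior Θ))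
    -- first moments of the normalized gradients at the true parameter
    (h_dot : ∀ t,
      ∫⁻ ω, ‖(σ (past y t ω) θ₀)⁻¹ • gradient (g (past y t ω)) θ₀‖ₑ ∂P < ∞ ∧
      ∫⁻ ω, ‖(σ (past y t ω) θ₀ ^ 2)⁻¹ •
        gradient (fun θ => σ (past y t ω) θ ^ 2) θ₀‖ₑ ∂P < ∞)
    -- non-degeneracy of one of the two gradients
    (h_rank : ∀ t,
      (¬ ∃ x : EuclideanSpace ℝ (Fin d), x ≠ 0 ∧
        ∀ᵐ ω ∂P, inner ℝ x (gradient (fun θ => σ (past y t ω) θ ^ 2) θ₀) = 0) ∨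
      (¬ ∃ x : EuclideanSpace ℝ (Fin d), x ≠ 0 ∧
        ∀ᵐ ω ∂P, inner ℝ x (gradient (g (past y t ω)) θ₀) = 0))
    -- the Hessian is locally dominated
    (h_Hess : ∃ κ : ℝ, 0 < κ ∧ ∀ t,
      ∫⁻ ω, (⨆ θ ∈ Metric.closedBall θ₀ κ, ‖negHess g σ (past y t ω) (y t ω) θ‖ₑ) ∂P < ∞)
    -- the effect of the initial value on the score and the Hessian
    (h_init' : ∃ C₂ : Ω → ℝ, Measurable C₂ ∧ (∀ ω, 0 ≤ C₂ ω) ∧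
      ∃ ρ₂ : ℝ, 0 < ρ₂ ∧ ρ₂ < 1 ∧ ∀ t : ℕ, 1 ≤ t → ∀ᵐ ω ∂P, ∀ θ ∈ interior Θ,
        ‖score g σ (obsPast y y0 t ω) (y t ω) θ - score g σ (past y t ω) (y t ω) θ‖
          + ‖negHess g σ (obsPast y y0 t ω) (y t ω) θ - negHess g σ (past y t ω) (y t ω) θ‖
          ≤ C₂ ω * ρ₂ ^ t) :
    -- `A₀ = E H_t(θ₀)` and `B₀ = E s_t(θ₀) s_t(θ₀)ᵀ` exist (for every `t`) and are estimated
    -- consistently in probability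
    ∀ t : ℤ,
      (∀ i j, Integrable (fun ω => negHess g σ (past y t ω) (y t ω) θ₀ i j) P) ∧
      (∀ i j, Integrable (fun ω => outer (score g σ (past y t ω) (y t ω) θ₀) i j) P) ∧
      TendstoInMeasure P (fun n ω => hatA g σ y y0 (θhat n) n ω) atTop
        (fun _ => expMatrix P fun ω => negHess g σ (past y t ω) (y t ω) θ₀) ∧
      TendstoInMeasure P (fun n ω => hatB g σ y y0 (θhat n) n ω) atTop
        (fun _ => expMatrix P fun ω => outer (score g σ (past y t ω) (y t ω) θ₀)) := by
  have M : IsModel P g σ Θ θ₀ y η :=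
    { g_meas := hg_meas
      σ_meas := hσ_meas
      σ_pos := hσ_pos
      y_meas := hy_meas
      η_meas := hη_meas
      model := h_model
      η_past := hη_past
      compact := h_compact
      η_ident := hη_ident
      η_symm := hη_symm
      η_psi := hη_psi
      erg := hy_erg
      σ_low := hσ_low
      cont := h_cont
      ident := h_ident
      mom := h_mom
      interior := hθ₀
      η_two := fun t => (hη_two t).2
      C2 := h_C2
      rank := h_rank
      hess := h_Hess }
  obtain ⟨C₁, -, hC₁, ρ₁, hρ₁0, hρ₁1, hinit₁⟩ := h_init
  obtain ⟨C₂, hC₂m, -, ρ₂, hρ₂0, hρ₂1, hinit₂⟩ := h_init'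
  have hcons := M.tendsto_estimator hy0_meas hC₁ hρ₁0 hρ₁1 hinit₁ hθhat
  have hA := M.tendsto_hatA hC₂m hρ₂0 hρ₂1 hinit₂ hcons
  have hB := M.tendsto_hatB hC₂m hρ₂0 hρ₂1 hinit₂ hθhat hcons
  intro t
  -- The limits were obtained with expectations at time `0`; stationarity carries them to every `t`.
  have hA₀ : (expMatrix P fun ω => negHess g σ (past y t ω) (y t ω) θ₀) =
      expMatrix P fun ω => hessMat (logLik g σ (past y 0 ω) (y 0 ω)) θ₀ := by
    ext i j
    exact integral_obs_eq hy_meas hy_erg t (M.measurable_hess_entry hθ₀ i j)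
  have hB₀ : (expMatrix P fun ω => outer (score g σ (past y t ω) (y t ω) θ₀)) =
      expMatrix P fun ω => outer (score g σ (past y 0 ω) (y 0 ω) θ₀) := by
    ext i j
    simp only [expMatrix, Matrix.of_apply, IsModel.outer_score_apply]
    exact integral_obs_eq hy_meas hy_erg t
      ((M.measurable_dirScore (EuclideanSpace.single i 1)).mul
        (M.measurable_dirScore (EuclideanSpace.single j 1)))
  refine ⟨fun i j => M.integrable_hess_entry t i j, fun i j => ?_, ?_, ?_⟩
  · simp only [IsModel.outer_score_apply]
    exact M.integrable_dirScore_mul t _ _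
  · rw [hA₀]
    exact tendstoInMeasure_const_iff.2 hA
  · rw [hB₀]
    exact tendstoInMeasure_const_iff.2 hB
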